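/- Let $B$ be a smooth projective irreducible complex curve, i.e. a compact connected Riemann surface, and let $\pi:\mathcal X\to B$ be a surjective holomorphic map from a compact connected complex manifold $\mathcal X$ of dimension $n+1$ (for instance, a flat proper morphism from a smooth projective variety $\mathcal X$; nothing further is assumed on $\pi$). An *admissible $N$-th jet* at $b\in B$ is the truncation modulo $\mathfrak m_{B,b}^{N+1}$ of a local analytic section $s$ of $\pi$ near $b$; it is supported at the point $s(b)$ of the fiber $\mathcal X_b=\pi^{-1}(b)$. Let $\Sigma=\{\hat\sigma_j\}_{j\in J}$ be a finite set of admissible $N_j$-th jets at pairwise distinct points $b_j\in B$. Choose local holomorphic coordinates $z$ at $b_j$ and $(z,z_1,\dots,z_n)$ at the support of $\hat\sigma_j$, all vanishing there, in which $\pi$ is $(z,z_1,\dots,z_n)\mapsto z$, and let $\rho_i\in\mathbb C[z]$, $\deg\rho_i\le N_j$, be the polynomials with $z_i\circ s\equiv\rho_i(z)\pmod{z^{N_j+1}}$. A continuous family $\sigma:K\times B\to\mathcal X$ of sections of $\pi$, parametrized by a compact Hausdorff space $K$, *induces* $\hat\sigma_j$ if, for some such coordinates, $\sigma(K\times U)$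 lies in the coordinate neighborhood for some open $U\ni b_j$ and $z_i(\sigma(\xi,z))-\rho_i(z)=o(|z|^{N_j})$ as $z\to0$, uniformly in $\xi\in K$, for $i=1,\dots,n$. For $\alpha\in \mathrm H_2(\mathcal X,\mathbb Z)$ let $\mathrm{Sect}^{\mathrm{stop}}(\mathcal X/B,\alpha,\Sigma)$ be the set of continuous sections $\sigma$ of $\pi$ with $\sigma_*[B]=\alpha$ that induce all $\hat\sigma_j$, $j\in J$, with the compactly generated topology defined by such families: a subset is open if and only if its preimage in $K$ is open for every compact Hausdorff $K$ and every continuous family $K\times B\to\mathcal X$ of such sections which induces all $\hat\sigma_j$. Assume that for some $j_0\in J$ the fiber $\mathcal X_{b_0}$ over $b_0=b_{j_0}$ is smooth, and let $\beta=f_*[\mathbb P^1]\in\mathrm H_2(\mathcal X,\mathbb Z)$ be the class of a rational curve $f:\mathbb P^1\to\mathcal X_{b_0}$ (a nonconstant holomorphic map) in this fiber. Then, for every $\alpha\in\mathrm H_2(\mathcal X,\mathbb Z)$, there is a homotopy equivalence $$\mathrm{Sect}^{\mathrm{stop}}(\mathcal X/B,\alpha,\Sigma)\sim\mathrm{Sect}^{\mathrm{stop}}(\mathcal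 X/B,\alpha+\beta,\Sigma).$$ In particular, homological stability holds in all degrees: for all integers $m,i\ge0$, $$\mathrm H_i(\mathrm{Sect}^{\mathrm{stop}}(\mathcal X/B,\alpha+m\beta,\Sigma),\mathbb Z)\simeq\mathrm H_i(\mathrm{Sect}^{\mathrm{stop}}(\mathcal X/B,\alpha+(m+1)\beta,\Sigma),\mathbb Z).$$ -/

import Mathlib

open scoped Manifold ContDiff Topology Polynomial
open CategoryTheory

namespace SemiTop

noncomputable section

/-! ### Singular homology with integral coefficients -/

/-- The singular homology group `H_i(X, ℤ)`. -/
abbrev H (i : ℕ) (X : Type) [TopologicalSpace X] : AddCommGrpCat.{0} :=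
  ((AlgebraicTopology.singularHomologyFunctor AddCommGrpCat.{0} i).obj
    (AddCommGrpCat.of ℤ)).obj (TopCat.of X)

/-- The pushforward `f_* : H_i(X, ℤ) → H_i(Y, ℤ)`. -/
def push {X Y : Type} [TopologicalSpace X] [TopologicalSpace Y] (i : ℕ) (f : C(X, Y)) :
    H i X →+ H i Y :=
  (((AlgebraicTopology.singularHomologyFunctor AddCommGrpCat.{0} i).obj
    (AddCommGrpCat.of ℤ)).map (TopCat.ofHom f)).hom

/-! ### Fundamental classes of compact Riemann surfaces

The Riemann sphere is `OnePoint ℂ`, and its fundamental class is a generator `o` of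
`H_2(OnePoint ℂ, ℤ)`; choosing one of the two generators amounts to choosing an orientation
of `ℂ`, which orients all Riemann surfaces through their holomorphic charts. -/

/-- `o` generates `H_2` of the Riemann sphere. -/
def IsOrientation (o : H 2 (OnePoint ℂ)) : Prop :=
  ∀ v : H 2 (OnePoint ℂ), ∃ k : ℤ, v = k • o

/-- The map collapsing the complement of a coordinate patch `e ≃ ℂ` to the point `∞`. -/
def collapseFun {B : Type} [TopologicalSpace B] (e : OpenPartialHomeomorph B ℂ) :
    B → OnePoint ℂ := by
  classical
  exact fun b => if b ∈ e.source then ((e b : ℂ) : OnePoint ℂ) else OnePoint.infty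

theorem continuous_collapseFun {B : Type} [TopologicalSpace B] [T2Space B]
    (e : OpenPartialHomeomorph B ℂ) (he : e.target = Set.univ) :
    Continuous (collapseFun e) := by
  have hopen : ∀ W : Set ℂ, IsOpen W → IsOpen (e.source ∩ e ⁻¹' W) :=
    fun W hW => e.isOpen_inter_preimage hW
  have hpre : ∀ s : Set (OnePoint ℂ), e.source ∩ collapseFun e ⁻¹' s =
      e.source ∩ e ⁻¹' ((fun z : ℂ => (z : OnePoint ℂ)) ⁻¹' s) := by
    intro s
    ext b
    simp only [Set.mem_inter_iff, Set.mem_preimage]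
    refine and_congr_right fun hb => ?_
    simp [collapseFun, hb]
  refine continuous_def.2 fun s hs => ?_
  by_cases h : OnePoint.infty ∈ s
  · obtain ⟨hc, hk⟩ := (OnePoint.isOpen_iff_of_mem h).1 hs
    have hcl : IsClosed (e.symm '' ((fun z : ℂ => (z : OnePoint ℂ)) ⁻¹' s)ᶜ) := by
      refine (IsCompact.image_of_continuousOn hk (e.continuousOn_symm.mono ?_)).isClosed
      rw [he]
      exact Set.subset_univ _
    convert hcl.isOpen_compl using 1
    ext b
    simp only [Set.mem_preimage, Set.mem_compl_iff, Set.mem_image, not_exists, not_and]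
    constructor
    · rintro hb z hz rfl
      have hzt : z ∈ e.target := by rw [he]; trivial
      have := e.map_target hzt
      simp only [collapseFun, this, if_true, e.right_inv hzt] at hb
      exact hz hb
    · intro hb
      by_cases hbs : b ∈ e.source
      · simp only [collapseFun, hbs, if_true]
        by_contra hcon
        exact hb (e b) hcon (e.left_inv hbs)
      · simpa [collapseFun, hbs] using h
  · have hsub : collapseFun e ⁻¹' s = e.source ∩ collapseFun e ⁻¹' s := by
      refine (Set.inter_eq_right.2 fun b hb => ?_).symm
      by_contra hbs
      exact h (by simpa [collapseFun, hbs] using hb)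
    rw [hsub, hpre]
    exact hopen _ (hs.preimage OnePoint.continuous_coe)

/-- The collapse map `B → B / (B ∖ D) ≃ OnePoint ℂ` for a coordinate disc `D`, given by a chart
`ψ` that maps `D` onto the open unit disc; the open unit disc is identified with `ℂ` by the
radial homeomorphism `w ↦ w / √(1 - |w|²)`. -/
def collapse {B : Type} [TopologicalSpace B] [T2Space B]
    (ψ : OpenPartialHomeomorph B ℂ) (hψ : ψ.target = Metric.ball 0 1) : C(B, OnePoint ℂ) where
  toFun := collapseFun (ψ.trans (OpenPartialHomeomorph.univUnitBall (E := ℂ)).symm)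
  continuous_toFun := continuous_collapseFun _ (by
    have h : ∀ w : ℂ, OpenPartialHomeomorph.univUnitBall w ∈ Metric.ball (0 : ℂ) 1 := fun w =>
      OpenPartialHomeomorph.univUnitBall.map_source (Set.mem_univ w)
    ext w
    simp only [OpenPartialHomeomorph.trans_target, hψ, Set.mem_inter_iff, Set.mem_preimage,
      Set.mem_univ, iff_true]
    exact ⟨Set.mem_univ w, h w⟩)

/-- `c` is the fundamental class `[B]` of the Riemann surface `B` (with its complex orientation):
its image under `H_2(B) → H_2(B, B ∖ D) = H_2(B / (B ∖ D))` is the orientation class, for every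
holomorphic coordinate disc `D`. -/
def IsFundamentalClass {B : Type} [TopologicalSpace B] [T2Space B] [ChartedSpace ℂ B]
    (o : H 2 (OnePoint ℂ)) (c : H 2 B) : Prop :=
  ∀ ψ ∈ IsManifold.maximalAtlas 𝓘(ℂ) ω B, ∀ hψ : ψ.target = Metric.ball 0 1,
    push 2 (collapse ψ hψ) c = o

/-! ### Jets -/

section Jets

variable {B X : Type} [TopologicalSpace B] [ChartedSpace ℂ B] [TopologicalSpace X] {n : ℕ}
  [ChartedSpace (EuclideanSpace ℂ (Fin (n + 1))) X]

/-- The fiber of `π` over `b` is smooth: `π` is a submersion at each of its points. -/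
def SmoothFiber (n : ℕ) [ChartedSpace (EuclideanSpace ℂ (Fin (n + 1))) X]
    (π : X → B) (b : B) : Prop :=
  ∀ x, π x = b →
    Function.Surjective (mfderiv 𝓘(ℂ, EuclideanSpace ℂ (Fin (n + 1))) 𝓘(ℂ) π x)

/-- An admissible jet of order `N` at `b`, given by a local analytic section of `π` near `b`.
The jet is the truncation of `sec` modulo the power `N + 1` of the maximal ideal at `b`; below,
`sec` is only used through this truncation. -/
structure AdmissibleJet (n : ℕ) [ChartedSpace (EuclideanSpace ℂ (Fin (n + 1))) X]
    (π : X → B) where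
  /-- the point `b` -/
  base : B
  /-- the order `N` -/
  order : ℕ
  /-- the local section; its values away from `b` are irrelevant -/
  sec : B → X
  analytic : ContMDiffAt 𝓘(ℂ) 𝓘(ℂ, EuclideanSpace ℂ (Fin (n + 1))) ω sec base
  is_section : ∀ᶠ b in 𝓝 base, π (sec b) = b

/-- Local holomorphic coordinates `z` at `b` and `z, z_1, …, z_n` at `x`, all vanishing there, in
which `π` is `(z, z_1, …, z_n) ↦ z`. -/
structure FiberCoordinates (n : ℕ) [ChartedSpace (EuclideanSpace ℂ (Fin (n + 1))) X]
    (π : X → B) (b : B) (x : X) where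
  z : OpenPartialHomeomorph B ℂ
  w : OpenPartialHomeomorph X (EuclideanSpace ℂ (Fin (n + 1)))
  z_mem : z ∈ IsManifold.maximalAtlas 𝓘(ℂ) ω B
  w_mem : w ∈ IsManifold.maximalAtlas 𝓘(ℂ, EuclideanSpace ℂ (Fin (n + 1))) ω X
  base_mem : b ∈ z.source
  point_mem : x ∈ w.source
  z_base : z b = 0
  w_point : w x = 0
  maps : ∀ y ∈ w.source, π y ∈ z.source
  w_zero : ∀ y ∈ w.source, w y 0 = z (π y)

/-- In the coordinates `φ`, the jet `j` is given by the polynomials `ρ_1, …, ρ_n` of degree at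
most `N`: `z_i ∘ sec ≡ ρ_i(z)` modulo `z ^ (N + 1)`. -/
def AdmissibleJet.IsGivenBy {π : X → B} (j : AdmissibleJet n π)
    (φ : FiberCoordinates n π j.base (j.sec j.base)) (ρ : Fin n → ℂ[X]) : Prop :=
  ∀ i, (ρ i).natDegree ≤ j.order ∧
    (fun b => φ.w (j.sec b) i.succ - (ρ i).eval (φ.z b))
      =O[𝓝 j.base] fun b => φ.z b ^ (j.order + 1)

/-- The family `s`, parametrized by `K`, of sections of `π` induces the jet `j`: near the base
point, `z_i(s(ξ, b)) - ρ_i(z(b)) = o(|z(b)| ^ N)` uniformly in `ξ ∈ K`. -/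
def Induces {π : X → B} {K : Type} (s : K → B → X) (j : AdmissibleJet n π) : Prop :=
  ∃ (φ : FiberCoordinates n π j.base (j.sec j.base)) (ρ : Fin n → ℂ[X]),
    j.IsGivenBy φ ρ ∧
    ∃ U : Set B, IsOpen U ∧ j.base ∈ U ∧ U ⊆ φ.z.source ∧
      (∀ ξ, ∀ b ∈ U, s ξ b ∈ φ.w.source) ∧
      ∀ i, ∀ ε > (0 : ℝ), ∀ᶠ b in 𝓝 j.base, ∀ ξ,
        ‖φ.w (s ξ b) i.succ - (ρ i).eval (φ.z b)‖ ≤ ε * ‖φ.z b‖ ^ j.order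

/-! ### The semi-topological space of sections -/

/-- The points of `Sect^stop(X/B, α, Σ)`: the continuous sections `σ` of `π` with `σ_*[B] = α`
that induce all jets of `Σ`. Here `c` is the fundamental class `[B]`. -/
structure SectStop (π : X → B) (c : H 2 B) (α : H 2 X) {J : Type}
    (S : J → AdmissibleJet n π) where
  toMap : C(B, X)
  is_section : ∀ b, π (toMap b) = b
  class_eq : push 2 toMap c = α
  induces : ∀ j, Induces (fun (_ : Unit) b => toMap b) (S j)

/-- The continuous families, parametrized by `K`, of sections constrained by `Σ`. -/
def IsFamily {π : X → B} {c : H 2 B} {α : H 2 X} {J : Type} {S : J → AdmissibleJet n π}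
    {K : Type} [TopologicalSpace K] (s : K → SectStop π c α S) : Prop :=
  Continuous (fun p : K × B => (s p.1).toMap p.2) ∧
    ∀ j, Induces (fun ξ b => (s ξ).toMap b) (S j)

/-- The compactly generated topology defined by the families parametrized by compact (Hausdorff)
spaces: a set is open if and only if its preimage under every such family is open. -/
instance {π : X → B} {c : H 2 B} {α : H 2 X} {J : Type} {S : J → AdmissibleJet n π} :
    TopologicalSpace (SectStop π c α S) :=
  ⨆ (K : CompHaus.{0}) (s : {s : K → SectStop π c α S // IsFamily s}),
    TopologicalSpace.coinduced s.1 inferInstance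

end Jets

/-! ### Rational curves -/

/-- The coordinate `w = 1 / z` at infinity of the Riemann sphere, as a parametrization. -/
def coordAtInfinity : ℂ → OnePoint ℂ := by
  classical
  exact fun w => if w = 0 then OnePoint.infty else ((w⁻¹ : ℂ) : OnePoint ℂ)

/-- `f` is a rational curve: a nonconstant holomorphic map from the Riemann sphere. -/
structure IsRationalCurve (n : ℕ) {X : Type} [TopologicalSpace X]
    [ChartedSpace (EuclideanSpace ℂ (Fin (n + 1))) X] (f : C(OnePoint ℂ, X)) : Prop where
  holo_finite : ContMDiff 𝓘(ℂ) 𝓘(ℂ, EuclideanSpace ℂ (Fin (n + 1))) ω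
    (fun z : ℂ => f (z : OnePoint ℂ))
  holo_infty : ContMDiff 𝓘(ℂ) 𝓘(ℂ, EuclideanSpace ℂ (Fin (n + 1))) ω
    (fun w : ℂ => f (coordAtInfinity w))
  nonconstant : ∃ p q, f p ≠ f q

end

end SemiTop

/-! ### Singular chains: generators, boundary, cycles, functoriality. -/

namespace SemiTop
noncomputable section

open scoped Simplicial

/-! A section that induces the jet at `b₀` passes through the support of this jet, and near `b₀` it
stays in a tube around the local section `e` representing the jet. It can therefore be squeezed onto
`e` over a small disc, and a bubble can be inserted over an annulus around `b₀`. At a point b at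
distance |z| and in direction u from `b₀`, the new section takes the value G(b, k u), where G(b, ·)
is a disc in the fiber over b whose center and boundary circle both go to `e b`, and where the
profile k runs from 0 to 1 as |z| grows. Over `b₀` the disc is the rational curve with two tails
joining it to `e b₀`, so the bubble adds β to the class (`Bubble.push_attach`). Squeezing does not
increase the distance to `e`, the insertion avoids a neighborhood of `b₀`, and nothing changes
outside the coordinate disc; so all jets are preserved.

A profile running from 1 to 0 attaches the opposite bubble. If one bubble is attached and then the
opposite one, closer to `b₀`, the combined profile leaves its initial value and returns to it. It is
homotopic, with fixed ends, to a constant profile, which inserts only values of `e`; and squeezing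
is homotopic to the identity. Hence the two attachments are homotopy inverse to each other
(`IsAdapted.exists_attach_attach_homotopic_id`, `IsAdapted.nonempty_homotopyEquiv`). The radius of
the disc has to depend continuously on the section; this is the role of `rad`.

Three ingredients surround this construction. The change of class is an additivity statement in
singular homology, `push_add_push_eq`, proved by barycentric subdivision. The tails exist because a
smooth fiber is path connected as soon as π has a section (`joinedIn_smoothFiber`): the critical
values are countable, the union of the smooth fibers is connected, and being joined to the section
inside the fiber is an open and closed condition there. The discs spread to the neighboring fibers
by `exists_fiberwiseLift`, which glues submersion charts with Tietze's theorem.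

The topology on sections is tested on compact families, so it is enough that each operation takes
families of sections inducing the jets to such families (`IsJetOperator`). If neither class contains
a section, both spaces are empty; otherwise a section in either class supplies the connectedness of
the fiber. -/

abbrev singularSimplexEquiv (Y : Type) [TopologicalSpace Y] (n : ℕ) :
    (TopCat.toSSet.obj (TopCat.of Y)).obj (Opposite.op ⦋n⦌) ≃ C(stdSimplex ℝ (Fin (n + 1)), Y) :=
  TopCat.toSSetObjEquiv (TopCat.of Y) (Opposite.op ⦋n⦌)

/-- The singular chain complex of `Y` with integral coefficients. -/
abbrev chains (Y : Type) [TopologicalSpace Y] : ChainComplex AddCommGrpCat.{0} ℕ :=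
  ((AlgebraicTopology.singularChainComplexFunctor AddCommGrpCat.{0}).obj
    (AddCommGrpCat.of ℤ)).obj (TopCat.of Y)

abbrev chainsMap {Y Z : Type} [TopologicalSpace Y] [TopologicalSpace Z] (f : C(Y, Z)) :
    chains Y ⟶ chains Z :=
  ((AlgebraicTopology.singularChainComplexFunctor AddCommGrpCat.{0}).obj
    (AddCommGrpCat.of ℤ)).map (TopCat.ofHom f)

variable {Y Z : Type} [TopologicalSpace Y] [TopologicalSpace Z] {n : ℕ}

/-- The generator of the singular chains given by a singular simplex. -/
def gen (σ : C(stdSimplex ℝ (Fin (n + 1)), Y)) : (chains Y).X n :=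
  ((TopCat.toSSet.obj (TopCat.of Y)).ιChainComplex (R := AddCommGrpCat.of ℤ)
    ((singularSimplexEquiv Y n).symm σ)).hom (1 : ℤ)

/-- Additive maps out of singular chains are determined by their values on simplices. -/
def liftChains {A : Type} [AddCommGroup A] (F : C(stdSimplex ℝ (Fin (n + 1)), Y) → A) :
    (chains Y).X n →+ A :=
  (((TopCat.toSSet.obj (TopCat.of Y)).isColimitChainComplexXCofan
    (AddCommGrpCat.of ℤ) n).desc (Limits.Cofan.mk (AddCommGrpCat.of A)
      fun x => AddCommGrpCat.ofHom (zmultiplesHom A (F (singularSimplexEquiv Y n x))))).hom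

theorem liftChains_gen {A : Type} [AddCommGroup A] (F : C(stdSimplex ℝ (Fin (n + 1)), Y) → A)
    (σ : C(stdSimplex ℝ (Fin (n + 1)), Y)) : liftChains F (gen σ) = F σ := by
  have := ((TopCat.toSSet.obj (TopCat.of Y)).isColimitChainComplexXCofan
    (AddCommGrpCat.of ℤ) n).fac (Limits.Cofan.mk (AddCommGrpCat.of A)
      fun x => AddCommGrpCat.ofHom (zmultiplesHom A (F (singularSimplexEquiv Y n x))))
      ⟨(singularSimplexEquiv Y n).symm σ⟩
  have h2 := congrArg (fun g => g.hom (1:ℤ)) this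
  refine h2.trans ?_
  simp [Limits.Cofan.mk]
  
theorem chains_hom_ext {A : Type} [AddCommGroup A] {F G : (chains Y).X n →+ A}
    (h : ∀ σ, F (gen σ) = G (gen σ)) : F = G := by
  have : AddCommGrpCat.ofHom F = AddCommGrpCat.ofHom G := by
    refine SSet.chainComplex_hom_ext (fun x => ?_)
    ext
    have := h (singularSimplexEquiv Y n x)
    simp only [gen, Equiv.symm_apply_apply] at this
    exact this
  exact congrArg AddCommGrpCat.Hom.hom this

theorem chainsMap_gen (f : C(Y, Z)) (σ : C(stdSimplex ℝ (Fin (n + 1)), Y)) :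
    ((chainsMap f).f n).hom (gen σ) = gen (f.comp σ) := by
  have := SSet.ι_chainComplexMap_f _ _ (TopCat.toSSet.map (TopCat.ofHom f)) (AddCommGrpCat.of ℤ)
    ((singularSimplexEquiv Y n).symm σ)
  have h2 := congrArg (fun g => g.hom (1:ℤ)) this
  exact h2

/-- Evaluation of homomorphisms at `1`. -/
def evalOne (A : AddCommGrpCat.{0}) : (AddCommGrpCat.of ℤ ⟶ A) →+ A where
  toFun g := g.hom (1 : ℤ)
  map_zero' := rfl
  map_add' _ _ := rfl

theorem d_gen (σ : C(stdSimplex ℝ (Fin (n + 1 + 1)), Y)) :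
    ((chains Y).d (n + 1) n).hom (gen σ) = ∑ i : Fin (n + 2), (-1 : ℤ) ^ (i : ℕ) •
      gen (σ.comp ⟨stdSimplex.map (Fin.succAbove i), stdSimplex.continuous_map _⟩) := by
  have := SSet.ιChainComplex_d (TopCat.toSSet.obj (TopCat.of Y)) (R := AddCommGrpCat.of ℤ)
    ((singularSimplexEquiv Y (n+1)).symm σ)
  have h2 := congrArg (evalOne _) this
  rw [map_sum] at h2
  refine h2.trans (Finset.sum_congr rfl fun i _ => ?_)
  rw [map_zsmul]
  rfl

/-- The homology class of a cycle. -/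
def homClass (Y : Type) [TopologicalSpace Y] (n : ℕ) : (chains Y).cycles n →+ H n Y :=
  ((chains Y).homologyπ n).hom

theorem homClass_surjective : Function.Surjective (homClass Y n) := by
  have h : Epi ((chains Y).homologyπ n) := inferInstance
  exact (AddCommGrpCat.epi_iff_surjective _).1 h

theorem push_homClass (f : C(Y, Z)) (z : (chains Y).cycles n) :
    push n f (homClass Y n z) =
      homClass Z n ((HomologicalComplex.cyclesMap (chainsMap f) n).hom z) := by
  have := HomologicalComplex.homologyπ_naturality (chainsMap f) n
  exact (congrArg (fun g => g.hom z) this)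

theorem homClass_eq_zero_of_boundary (z : (chains Y).cycles n) (x : (chains Y).X (n + 1))
    (h : ((chains Y).iCycles n).hom z = ((chains Y).d (n + 1) n).hom x) :
    homClass Y n z = 0 := by
  have h1 : z = ((chains Y).toCycles (n + 1) n).hom x := by
    have hm : Mono ((chains Y).iCycles n) := inferInstance
    apply (AddCommGrpCat.mono_iff_injective _).1 hm
    rw [h]
    have := (chains Y).toCycles_i (n + 1) n
    exact (congrArg (fun g => g.hom x) this).symm
  rw [h1]
  have := (chains Y).toCycles_comp_homologyπ (n + 1) n
  exact (congrArg (fun g => g.hom x) this)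

theorem iCycles_cyclesMap (f : C(Y, Z)) (z : (chains Y).cycles n) :
    ((chains Z).iCycles n).hom ((HomologicalComplex.cyclesMap (chainsMap f) n).hom z) =
      ((chainsMap f).f n).hom (((chains Y).iCycles n).hom z) := by
  have := HomologicalComplex.cyclesMap_i (chainsMap f) n
  exact (congrArg (fun g => g.hom z) this)

theorem d_iCycles (z : (chains Y).cycles (n + 1)) :
    ((chains Y).d (n + 1) n).hom (((chains Y).iCycles (n + 1)).hom z) = 0 := by
  have := (chains Y).iCycles_d (n + 1) n
  exact (congrArg (fun g => g.hom z) this)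

theorem push_comp {W : Type} [TopologicalSpace W] (f : C(Y, Z)) (g : C(Z, W)) (c : H n Y) :
    push n (g.comp f) c = push n g (push n f c) := by
  have := ((AlgebraicTopology.singularHomologyFunctor AddCommGrpCat.{0} n).obj
    (AddCommGrpCat.of ℤ)).map_comp (TopCat.ofHom f) (TopCat.ofHom g)
  exact (congrArg (fun g => g.hom c) this)

theorem push_id (c : H n Y) : push n (ContinuousMap.id Y) c = c := by
  have := ((AlgebraicTopology.singularHomologyFunctor AddCommGrpCat.{0} n).obj
    (AddCommGrpCat.of ℤ)).map_id (TopCat.of Y)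
  exact (congrArg (fun g => g.hom c) this)

theorem push_eq_of_homotopic {f g : C(Y, Z)} (h : f.Homotopic g) (c : H n Y) :
    push n f c = push n g c := by
  obtain ⟨F⟩ := h
  have := TopCat.Homotopy.congr_homologyMap_singularChainComplexFunctor
    (f := TopCat.ofHom f) (g := TopCat.ofHom g) F (AddCommGrpCat.of ℤ) n
  exact (congrArg (fun g => g.hom c) this)

/-- A constant map factors through a point, which has no homology in nonzero degrees. -/
theorem push_const_eq_zero (hn : n ≠ 0) (x : Z) (c : H n Y) :
    push n (ContinuousMap.const Y x) c = 0 := by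
  have h1 : ContinuousMap.const Y x =
    (ContinuousMap.const Unit x).comp (ContinuousMap.const Y ()) := rfl
  have h2 := AlgebraicTopology.isZero_singularHomologyFunctor_of_totallyDisconnectedSpace
    AddCommGrpCat.{0} n (AddCommGrpCat.of ℤ) (TopCat.of Unit) hn
  have h3 : push n (ContinuousMap.const Y ()) c = 0 := 
    have := AddCommGrpCat.subsingleton_of_isZero h2
    Subsingleton.elim _ _
  rw [h1, push_comp, h3, map_zero]

/-- A homotopy equivalence induces isomorphisms in homology. -/
def homologyEquiv (e : ContinuousMap.HomotopyEquiv Y Z) : H n Y ≃+ H n Z where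
  toFun := push n e.toFun
  invFun := push n e.invFun
  left_inv c := by rw [← push_comp, push_eq_of_homotopic e.left_inv, push_id]
  right_inv c := by rw [← push_comp, push_eq_of_homotopic e.right_inv, push_id]
  map_add' := map_add _

end
end SemiTop


namespace SemiTop
noncomputable section

/-! ### Affine simplices and barycentric subdivision -/

/-- The standard topological simplex of dimension `n`. -/
abbrev Simp (n : ℕ) := stdSimplex ℝ (Fin (n + 1))

variable {n m k : ℕ}

/-- The affine simplex with given vertices in a standard simplex. -/
def aff (v : Fin (m + 1) → Simp n) : C(Simp m, Simp n) where
  toFun t := ⟨∑ i, t.1 i • (v i).1,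
    (convex_stdSimplex ℝ _).sum_mem (fun i _ => t.2.1 i) t.2.2 fun i _ => (v i).2⟩
  continuous_toFun := by
    refine Continuous.subtype_mk (continuous_finsetSum _ fun i _ => ?_) _
    exact ((continuous_apply i).comp continuous_subtype_val).smul continuous_const

theorem aff_coe (v : Fin (m + 1) → Simp n) (t : Simp m) :
    (aff v t).1 = ∑ i, t.1 i • (v i).1 := rfl

theorem aff_vertex (v : Fin (m + 1) → Simp n) (i : Fin (m + 1)) :
    aff v (stdSimplex.vertex i) = v i := by
  apply Subtype.ext
  rw [aff_coe, Finset.sum_eq_single i]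
  · simp
  · intro j _ hj
    simp [Pi.single_eq_of_ne hj]
  · simp

theorem aff_id : aff (stdSimplex.vertex : Fin (n + 1) → Simp n) = ContinuousMap.id _ := by
  ext1 t
  apply Subtype.ext
  rw [aff_coe]
  ext j
  simp [Finset.sum_apply, Pi.single_apply]

theorem aff_comp (v : Fin (m + 1) → Simp n) (w : Fin (k + 1) → Simp m) :
    (aff v).comp (aff w) = aff (aff v ∘ w) := by
  ext1 t
  apply Subtype.ext
  simp only [ContinuousMap.comp_apply, aff_coe, Function.comp]
  simp only [Finset.sum_apply, Pi.smul_apply, Finset.sum_smul, Finset.smul_sum, smul_smul,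
    smul_eq_mul]
  exact Finset.sum_comm

theorem map_succAbove_eq_aff (i : Fin (m + 2)) :
    (⟨stdSimplex.map (Fin.succAbove i), stdSimplex.continuous_map _⟩ : C(Simp m, Simp (m + 1))) =
      aff (stdSimplex.vertex ∘ Fin.succAbove i) := by
  ext1 t
  apply Subtype.ext
  ext j
  simp [aff_coe, stdSimplex.map, FunOnFinite.linearMap_apply_apply, Finset.sum_apply,
    Pi.single_apply, Finset.sum_filter, eq_comm]
  rfl

theorem aff_comp_face (v : Fin (m + 2) → Simp n) (i : Fin (m + 2)) :
    (aff v).comp ⟨stdSimplex.map (Fin.succAbove i), stdSimplex.continuous_map _⟩ =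
      aff (v ∘ Fin.succAbove i) := by
  rw [map_succAbove_eq_aff, aff_comp]
  congr 1
  ext1 j
  simp [aff_vertex]

/-- The barycenter of a finite nonempty family of points of a standard simplex. -/
def bary (v : Fin (m + 1) → Simp n) : Simp n := aff v stdSimplex.barycenter

theorem aff_bary (u : Fin (n + 1) → Simp k) (v : Fin (m + 1) → Simp n) :
    aff u (bary v) = bary (aff u ∘ v) := by
  rw [bary, bary, ← aff_comp]
  rfl

/-- Chains of affine simplices with `m` vertices; there is one simplex with no vertices. -/
abbrev AffChain (n m : ℕ) := FreeAbelianGroup (Fin m → Simp n)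

instance : AddCommGroup (AffChain n m) :=
  instAddCommGroupFreeAbelianGroup _

instance : AddGroup (AffChain n m) := AddCommGroup.toAddGroup

instance : AddZeroClass (AffChain n m) := AddMonoid.toAddZeroClass

instance : AddZero (AffChain n m) := AddZeroClass.toAddZero

open FreeAbelianGroup (of)

/-- The boundary of affine chains. -/
def bd : AffChain n (m + 1) →+ AffChain n m :=
  FreeAbelianGroup.lift fun v => ∑ i : Fin (m + 1), (-1 : ℤ) ^ (i : ℕ) • of (v ∘ Fin.succAbove i)

theorem bd_of (v : Fin (m + 1) → Simp n) :
    bd (of v) = ∑ i : Fin (m + 1), (-1 : ℤ) ^ (i : ℕ) • of (v ∘ Fin.succAbove i) :=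
  FreeAbelianGroup.lift_apply_of _ _

/-- The cone with apex `b` over an affine chain. -/
def cone (b : Simp n) : AffChain n m →+ AffChain n (m + 1) :=
  FreeAbelianGroup.map fun v => (Fin.cons b v : Fin (m + 1) → Simp n)

theorem cone_of (b : Simp n) (v : Fin m → Simp n) :
    cone b (of v) = of (Fin.cons b v : Fin (m + 1) → Simp n) :=
  FreeAbelianGroup.map_of_apply _

/-- The face opposite to the apex is the base. The other faces are cones over the faces of the base,
with the opposite sign because the apex comes first. -/
theorem bd_cone (b : Simp n) (x : AffChain n (m + 1)) :
    bd (cone b x) = x - cone b (bd x) := by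
  have : (bd.comp (cone b) : AffChain n (m + 1) →+ _) =
      AddMonoidHom.id _ - (cone b).comp bd := by
    refine FreeAbelianGroup.lift_ext _ _ fun v => ?_
    simp only [AddMonoidHom.comp_apply, AddMonoidHom.sub_apply, AddMonoidHom.id_apply, cone_of,
      bd_of, map_sum, map_zsmul]
    rw [Fin.sum_univ_succ, sub_eq_add_neg, ← Finset.sum_neg_distrib]
    refine congrArg₂ _ (one_smul ℤ _) (Finset.sum_congr rfl fun i _ => ?_)
    rw [Fin.val_succ, pow_succ, mul_neg_one, neg_smul]
    congr 3
    ext1 j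
    refine Fin.cases ?_ (fun j => ?_) j
    · simp
    · simp
  exact DFunLike.congr_fun this x

/-- Chains are indexed by their number of vertices, so the complex is augmented: the boundary of a
point is the empty simplex. -/
theorem bd_cone_empty (b : Simp n) (x : AffChain n 0) : bd (cone b x) = x := by
  have : (bd.comp (cone b) : AffChain n 0 →+ _) = AddMonoidHom.id _ := by
    refine FreeAbelianGroup.lift_ext _ _ fun v => ?_
    simp only [AddMonoidHom.comp_apply, AddMonoidHom.id_apply, cone_of, bd_of]
    rw [Fin.sum_univ_one]
    exact (one_smul _ _).trans (congrArg of (Subsingleton.elim _ _))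
  exact DFunLike.congr_fun this x

/-- Every simplex is the cone from its first vertex over the remaining face, so the cone formula
reduces the claim to fewer vertices. -/
theorem bd_bd : ∀ {m : ℕ} (x : AffChain n (m + 2)), bd (bd x) = 0
  | m, x => by
    have : (bd.comp bd : AffChain n (m + 2) →+ _) = 0 := by
      refine FreeAbelianGroup.lift_ext _ _ fun v => ?_
      have hv : (of v : AffChain n (m + 2)) = cone (v 0) (of (Fin.tail v)) := by
        rw [cone_of, Fin.cons_self_tail]
      rw [AddMonoidHom.comp_apply, hv, bd_cone, map_sub]
      cases m with
      | zero => rw [bd_cone_empty, sub_self]; rfl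
      | succ m => rw [bd_cone, bd_bd, map_zero, sub_zero, sub_self]; rfl
    exact DFunLike.congr_fun this x

/-- Barycentric subdivision of affine chains. -/
def sd : ∀ m : ℕ, AffChain n m →+ AffChain n m
  | 0 => AddMonoidHom.id _
  | m + 1 => FreeAbelianGroup.lift fun v => cone (bary v) (sd m (bd (of v)))

theorem sd_of (v : Fin (m + 1) → Simp n) :
    sd (m + 1) (of v) = cone (bary v) (sd m (bd (of v))) := by
  rw [sd]; exact FreeAbelianGroup.lift_apply_of _ _

/-- The homotopy from the identity to barycentric subdivision. -/
def sdHomotopy : ∀ m : ℕ, AffChain n m →+ AffChain n (m + 1)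
  | 0 => 0
  | m + 1 => FreeAbelianGroup.lift fun v =>
      cone (bary v) (of v - sd (m + 1) (of v) - sdHomotopy m (bd (of v)))

theorem sdHomotopy_of (v : Fin (m + 1) → Simp n) :
    sdHomotopy (m + 1) (of v) =
      cone (bary v) (of v - sd (m + 1) (of v) - sdHomotopy m (bd (of v))) := by
  rw [sdHomotopy]; exact FreeAbelianGroup.lift_apply_of _ _

theorem bd_sd : ∀ {m : ℕ} (x : AffChain n (m + 1)), bd (sd (m + 1) x) = sd m (bd x)
  | m, x => by
    have : (bd.comp (sd (m + 1)) : AffChain n (m + 1) →+ _) = (sd m).comp bd := by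
      refine FreeAbelianGroup.lift_ext _ _ fun v => ?_
      rw [AddMonoidHom.comp_apply, sd_of, AddMonoidHom.comp_apply]
      cases m with
      | zero => rw [bd_cone_empty]
      | succ m => rw [bd_cone, bd_sd, bd_bd, map_zero, map_zero, sub_zero]
    exact DFunLike.congr_fun this x

/-- The chain that is coned off in `sdHomotopy` is a cycle, by induction and `bd_sd`; the cone
formula then returns this chain itself. -/
theorem bd_sdHomotopy : ∀ {m : ℕ} (x : AffChain n (m + 1)),
    bd (sdHomotopy (m + 1) x) = x - sd (m + 1) x - sdHomotopy m (bd x)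
  | m, x => by
    have : (bd.comp (sdHomotopy (m + 1)) : AffChain n (m + 1) →+ _) =
        AddMonoidHom.id _ - sd (m + 1) - (sdHomotopy m).comp bd := by
      refine FreeAbelianGroup.lift_ext _ _ fun v => ?_
      simp only [AddMonoidHom.comp_apply, AddMonoidHom.sub_apply, AddMonoidHom.id_apply]
      rw [sdHomotopy_of, bd_cone]
      suffices h : bd (of v - sd (m + 1) (of v) - sdHomotopy m (bd (of v))) = 0 by
        rw [h, map_zero, sub_zero]
      rw [map_sub, map_sub, bd_sd]
      cases m with
      | zero => simp [sdHomotopy, sd]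
      | succ m =>
        rw [bd_sdHomotopy, bd_bd, map_zero, sub_zero, sub_self]
    exact DFunLike.congr_fun this x

/-- The action of an affine map between standard simplices on affine chains. -/
def affMap (u : Fin (n + 1) → Simp k) : AffChain n m →+ AffChain k m :=
  FreeAbelianGroup.map fun v => aff u ∘ v

theorem affMap_of (u : Fin (n + 1) → Simp k) (v : Fin m → Simp n) :
    affMap u (of v) = of (aff u ∘ v) :=
  FreeAbelianGroup.map_of_apply _

theorem affMap_cone (u : Fin (n + 1) → Simp k) (b : Simp n) (x : AffChain n m) :
    affMap u (cone b x) = cone (aff u b) (affMap u x) := by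
  have : (affMap u).comp (cone b) = (cone (aff u b)).comp (affMap (m := m) u) := by
    refine FreeAbelianGroup.lift_ext _ _ fun v => ?_
    simp only [AddMonoidHom.comp_apply, cone_of, affMap_of]
    congr 1
    ext1 j
    refine Fin.cases ?_ (fun j => ?_) j <;> simp
  exact DFunLike.congr_fun this x

theorem affMap_bd (u : Fin (n + 1) → Simp k) (x : AffChain n (m + 1)) :
    affMap u (bd x) = bd (affMap u x) := by
  have : (affMap u).comp bd = bd.comp (affMap (m := m + 1) u) := by
    refine FreeAbelianGroup.lift_ext _ _ fun v => ?_
    simp only [AddMonoidHom.comp_apply, affMap_of, bd_of, map_sum, map_zsmul]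
    rfl
  exact DFunLike.congr_fun this x

/-- Naturality under affine maps is what lets subdivision, prescribed on the identity simplex, act
on singular chains and be iterated. -/
theorem affMap_sd (u : Fin (n + 1) → Simp k) : ∀ {m : ℕ} (x : AffChain n m),
    affMap u (sd m x) = sd m (affMap u x)
  | 0, x => rfl
  | m + 1, x => by
    have : (affMap u).comp (sd (m + 1)) = (sd (m + 1)).comp (affMap u) := by
      refine FreeAbelianGroup.lift_ext _ _ fun v => ?_
      simp only [AddMonoidHom.comp_apply, affMap_of]
      rw [sd_of, sd_of, affMap_cone, aff_bary, affMap_sd, affMap_bd, affMap_of]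
    exact DFunLike.congr_fun this x

theorem affMap_sdHomotopy (u : Fin (n + 1) → Simp k) : ∀ {m : ℕ} (x : AffChain n m),
    affMap u (sdHomotopy m x) = sdHomotopy m (affMap u x)
  | 0, x => by simp [sdHomotopy]
  | m + 1, x => by
    have : (affMap u).comp (sdHomotopy (m + 1)) = (sdHomotopy (m + 1)).comp (affMap u) := by
      refine FreeAbelianGroup.lift_ext _ _ fun v => ?_
      simp only [AddMonoidHom.comp_apply, affMap_of]
      rw [sdHomotopy_of, sdHomotopy_of, affMap_cone, aff_bary, map_sub (affMap u), map_sub (affMap u), affMap_of,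
        affMap_sd, affMap_sdHomotopy, affMap_bd, affMap_of]
    exact DFunLike.congr_fun this x

/-! ### Mesh estimates -/

theorem dist_aff_le (v : Fin (m + 1) → Simp n) (x : Simp n) (d : ℝ)
    (h : ∀ i, dist x (v i) ≤ d) (t : Simp m) : dist x (aff v t) ≤ d := by
  have hc : Convex ℝ (Metric.closedBall x.1 d) := convex_closedBall _ _
  have : (aff v t).1 ∈ Metric.closedBall x.1 d := by
    rw [aff_coe]
    exact hc.sum_mem (fun i _ => t.2.1 i) t.2.2 fun i _ => by
      rw [Metric.mem_closedBall, dist_comm]; exact h i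
  rw [Metric.mem_closedBall, dist_comm] at this
  exact this

/-- The vector from `v i` to the barycenter is the average of the m + 1 vectors from `v i` to the
vertices, one of which is zero. -/
theorem dist_bary_le (v : Fin (m + 1) → Simp n) (d : ℝ) (h : ∀ i j, dist (v i) (v j) ≤ d)
    (i : Fin (m + 1)) : dist (bary v) (v i) ≤ (1 - 1 / ((m : ℝ) + 1)) * d := by
  have hm : (0 : ℝ) < m + 1 := by positivity
  have h1 : (bary v).1 - (v i).1 = ∑ j ∈ Finset.univ.erase i, ((m : ℝ) + 1)⁻¹ • ((v j).1 - (v i).1) := by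
    have : (bary v).1 - (v i).1 = ∑ j, ((m : ℝ) + 1)⁻¹ • ((v j).1 - (v i).1) := by
      simp only [smul_sub, Finset.sum_sub_distrib, Finset.sum_const, Finset.card_univ,
        Fintype.card_fin, bary, aff_coe]
      congr 1
      · refine Finset.sum_congr rfl fun j _ => ?_
        congr 1
        simp [stdSimplex.barycenter]
      · rw [← Nat.cast_smul_eq_nsmul ℝ, smul_smul]
        push_cast
        rw [mul_inv_cancel₀ hm.ne', one_smul]
    rw [this, ← Finset.add_sum_erase _ _ (Finset.mem_univ i)]
    simp
  have h2 : dist (bary v) (v i) = ‖(bary v).1 - (v i).1‖ := by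
    rw [← dist_eq_norm]; rfl
  rw [h2, h1]
  refine (norm_sum_le_of_le (n := fun _ => ((m : ℝ) + 1)⁻¹ * d) _ fun j _ => ?_).trans ?_
  · rw [norm_smul, Real.norm_of_nonneg (by positivity)]
    refine mul_le_mul_of_nonneg_left ?_ (by positivity)
    rw [← dist_eq_norm]
    exact h j i
  · rw [Finset.sum_const, Finset.card_erase_of_mem (Finset.mem_univ _), Finset.card_univ,
      Fintype.card_fin, Nat.add_sub_cancel, nsmul_eq_mul]
    apply le_of_eq
    field_simp
    ring

/-- The simplices of the subgroup are contained in every ball containing the vertices of `v`, and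
have diameter at most `d`. -/
def fineChains (v : Fin k → Simp n) (m : ℕ) (d : ℝ) : AddSubgroup (AffChain n m) :=
  AddSubgroup.closure {x | ∃ w : Fin m → Simp n, x = of w ∧
    (∀ (y : Simp n) (e : ℝ), (∀ i, dist y (v i) ≤ e) → ∀ j, dist y (w j) ≤ e) ∧
    ∀ i j, dist (w i) (w j) ≤ d}

/-- An edge of the subdivision either contains the barycenter or lies in the subdivision of a facet.
The first kind is bounded by `dist_bary_le`, extended from the vertices of `v` to all vertices of
the subdivision by the ball condition; the second by induction, since the contraction factor
increases with the number of vertices. -/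
theorem sd_mem_fineChains : ∀ {m : ℕ} (v : Fin m → Simp n) (d : ℝ)
    (_ : ∀ i j, dist (v i) (v j) ≤ d), sd m (of v) ∈ fineChains v m ((1 - 1 / (m : ℝ)) * d)
  | 0, v, d, _ => AddSubgroup.subset_closure ⟨v, rfl, fun _ _ _ j => j.elim0, fun j => j.elim0⟩
  | m + 1, v, d, h => by
    have hd : 0 ≤ d := dist_nonneg.trans (h 0 0)
    rw [sd_of, bd_of, map_sum, map_sum]
    refine AddSubgroup.sum_mem _ fun i _ => ?_
    rw [map_zsmul, map_zsmul]
    refine AddSubgroup.zsmul_mem _ ?_ _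
    have hs := sd_mem_fineChains (v ∘ Fin.succAbove i) d fun a b => h _ _
    have hle : fineChains (v ∘ Fin.succAbove i) m ((1 - 1 / (m : ℝ)) * d) ≤
        (fineChains v (m + 1) ((1 - 1 / ((m + 1 : ℕ) : ℝ)) * d)).comap (cone (bary v)) := by
      rw [fineChains, AddSubgroup.closure_le]
      rintro _ ⟨w, rfl, hw1, hw2⟩
      refine AddSubgroup.mem_comap.2 (AddSubgroup.subset_closure ⟨_, cone_of _ _, ?_, ?_⟩)
      · intro y e hy
        refine Fin.cases ?_ fun j => ?_
        · exact dist_aff_le v y e hy _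
        · exact hw1 y e (fun i => hy _) j
      · have hb : ∀ j, dist (bary v) (w j) ≤ (1 - 1 / ((m + 1 : ℕ) : ℝ)) * d := by
          push_cast
          exact hw1 _ _ fun i => dist_bary_le v d h _
        intro a b
        induction a using Fin.cases with
        | zero =>
          induction b using Fin.cases with
          | zero =>
            simp only [Fin.cons_zero, dist_self]
            refine mul_nonneg (sub_nonneg.2 ?_) hd
            rw [div_le_one (by positivity)]
            push_cast
            linarith [(Nat.cast_nonneg m : (0 : ℝ) ≤ m)]
          | succ b => simpa using hb b
        | succ a =>
          induction b using Fin.cases with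
          | zero => rw [dist_comm]; simpa using hb a
          | succ b =>
            simp only [Fin.cons_succ]
            refine (hw2 a b).trans (mul_le_mul_of_nonneg_right ?_ hd)
            have : 0 < m := a.pos
            have hm : (0 : ℝ) < m := by exact_mod_cast this
            have : 1 / ((m + 1 : ℕ) : ℝ) ≤ 1 / (m : ℝ) :=
              one_div_le_one_div_of_le hm (by push_cast; linarith)
            linarith
    exact hle hs

/-- Affine chains all of whose simplices have diameter at most `d`. -/
def meshChains (n m : ℕ) (d : ℝ) : AddSubgroup (AffChain n m) :=
  AddSubgroup.closure {x | ∃ w : Fin m → Simp n, x = of w ∧ ∀ i j, dist (w i) (w j) ≤ d}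

theorem sd_mem_meshChains {d : ℝ} {x : AffChain n m} (hx : x ∈ meshChains n m d) :
    sd m x ∈ meshChains n m ((1 - 1 / (m : ℝ)) * d) := by
  have : meshChains n m d ≤ (meshChains n m ((1 - 1 / (m : ℝ)) * d)).comap (sd m) := by
    rw [meshChains, AddSubgroup.closure_le]
    rintro _ ⟨w, rfl, hw⟩
    refine AddSubgroup.mem_comap.2 (AddSubgroup.closure_mono ?_ (sd_mem_fineChains w d hw))
    rintro _ ⟨w', rfl, -, h⟩
    exact ⟨w', rfl, h⟩
  exact this hx

theorem sd_iterate_mem_meshChains {d : ℝ} {x : AffChain n m} (hx : x ∈ meshChains n m d) (k : ℕ) :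
    (sd m)^[k] x ∈ meshChains n m ((1 - 1 / (m : ℝ)) ^ k * d) := by
  induction k with
  | zero => simpa using hx
  | succ k ih =>
    rw [Function.iterate_succ_apply', pow_succ', mul_assoc]
    exact sd_mem_meshChains ih

end
end SemiTop


namespace SemiTop
noncomputable section

/-! ### Small singular chains -/

open FreeAbelianGroup (of)

variable {Y Z : Type} [TopologicalSpace Y] [TopologicalSpace Z] {n m k : ℕ}

/-- The boundary of singular chains. -/
abbrev dChain (Y : Type) [TopologicalSpace Y] (n : ℕ) : (chains Y).X (n + 1) →+ (chains Y).X n :=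
  ((chains Y).d (n + 1) n).hom

/-- The singular chain obtained from an affine chain in a standard simplex and a singular
simplex. -/
def realize (σ : C(Simp n, Y)) : AffChain n (m + 1) →+ (chains Y).X m :=
  FreeAbelianGroup.lift fun v => gen (σ.comp (aff v))

theorem realize_of (σ : C(Simp n, Y)) (v : Fin (m + 1) → Simp n) :
    realize σ (of v) = gen (σ.comp (aff v)) :=
  FreeAbelianGroup.lift_apply_of _ _

theorem d_realize (σ : C(Simp n, Y)) (x : AffChain n (m + 2)) :
    dChain Y m (realize σ x) = realize σ (bd x) := by
  have : (dChain Y m).comp (realize σ) = (realize σ).comp bd := by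
    refine FreeAbelianGroup.lift_ext _ _ fun v => ?_
    rw [AddMonoidHom.comp_apply, realize_of, d_gen, AddMonoidHom.comp_apply, bd_of, map_sum]
    refine Finset.sum_congr rfl fun i _ => ?_
    rw [map_zsmul, realize_of, ContinuousMap.comp_assoc, aff_comp_face]
  exact DFunLike.congr_fun this x

theorem realize_affMap (σ : C(Simp k, Y)) (u : Fin (n + 1) → Simp k) (x : AffChain n (m + 1)) :
    realize σ (affMap u x) = realize (σ.comp (aff u)) x := by
  have : (realize σ).comp (affMap u) = realize (m := m) (σ.comp (aff u)) := by
    refine FreeAbelianGroup.lift_ext _ _ fun v => ?_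
    rw [AddMonoidHom.comp_apply, realize_of, affMap_of, realize_of, ← aff_comp,
      ContinuousMap.comp_assoc]
  exact DFunLike.congr_fun this x

/-- The affine simplex of all vertices. -/
def idSimplex (n : ℕ) : AffChain n (n + 1) := of stdSimplex.vertex

theorem realize_idSimplex (σ : C(Simp n, Y)) : realize σ (idSimplex n) = gen σ := by
  rw [idSimplex, realize_of, aff_id, ContinuousMap.comp_id]

theorem affMap_idSimplex (v : Fin (n + 1) → Simp k) : affMap v (idSimplex n) = of v := by
  rw [idSimplex, affMap_of]
  exact congrArg of (funext fun i => aff_vertex v i)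

/-- Barycentric subdivision of singular chains. -/
def subdiv : (chains Y).X n →+ (chains Y).X n :=
  liftChains fun σ => realize σ (sd (n + 1) (idSimplex n))

theorem subdiv_gen (σ : C(Simp n, Y)) :
    subdiv (gen σ) = realize σ (sd (n + 1) (idSimplex n)) := liftChains_gen _ _

/-- The homotopy from the identity to barycentric subdivision. -/
def subdivHomotopy : (chains Y).X n →+ (chains Y).X (n + 1) :=
  liftChains fun σ => realize σ (sdHomotopy (n + 1) (idSimplex n))

theorem subdivHomotopy_gen (σ : C(Simp n, Y)) :
    subdivHomotopy (gen σ) = realize σ (sdHomotopy (n + 1) (idSimplex n)) := liftChains_gen _ _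

theorem subdiv_realize (σ : C(Simp n, Y)) (x : AffChain n (m + 1)) :
    subdiv (realize σ x) = realize σ (sd (m + 1) x) := by
  have : subdiv.comp (realize σ) = (realize σ).comp (sd (m + 1)) := by
    refine FreeAbelianGroup.lift_ext _ _ fun v => ?_
    rw [AddMonoidHom.comp_apply, AddMonoidHom.comp_apply, realize_of, subdiv_gen,
      ← realize_affMap, affMap_sd, affMap_idSimplex]
  exact DFunLike.congr_fun this x

theorem subdivHomotopy_realize (σ : C(Simp n, Y)) (x : AffChain n (m + 1)) :
    subdivHomotopy (realize σ x) = realize σ (sdHomotopy (m + 1) x) := by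
  have : subdivHomotopy.comp (realize σ) = (realize σ).comp (sdHomotopy (m + 1)) := by
    refine FreeAbelianGroup.lift_ext _ _ fun v => ?_
    rw [AddMonoidHom.comp_apply, AddMonoidHom.comp_apply, realize_of, subdivHomotopy_gen,
      ← realize_affMap, affMap_sdHomotopy, affMap_idSimplex]
  exact DFunLike.congr_fun this x

theorem d_subdivHomotopy (z : (chains Y).X (n + 1)) :
    dChain Y (n + 1) (subdivHomotopy z) = z - subdiv z - subdivHomotopy (dChain Y n z) := by
  have : (dChain Y (n + 1)).comp subdivHomotopy =
      AddMonoidHom.id _ - subdiv - subdivHomotopy.comp (dChain Y n) := by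
    refine chains_hom_ext fun σ => ?_
    simp only [AddMonoidHom.comp_apply, AddMonoidHom.sub_apply, AddMonoidHom.id_apply]
    rw [← realize_idSimplex σ, subdivHomotopy_realize, d_realize, bd_sdHomotopy, map_sub, map_sub,
      subdiv_realize, d_realize, subdivHomotopy_realize]
  exact DFunLike.congr_fun this z

/-- The homotopies between successive subdivisions of a cycle telescope. -/
theorem exists_d_eq_sub_subdiv_iterate (z : (chains Y).X (n + 1)) (hz : dChain Y n z = 0) (k : ℕ) :
    ∃ x, dChain Y (n + 1) x = z - subdiv^[k] z := by
  induction k with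
  | zero => exact ⟨0, by simp⟩
  | succ k ih =>
    obtain ⟨x, hx⟩ := ih
    have hd : dChain Y n (subdiv^[k] z) = 0 := by
      have h1 : subdiv^[k] z = z - dChain Y (n + 1) x := by rw [hx]; abel
      have h2 : dChain Y n (dChain Y (n + 1) x) = 0 := by
        have := (chains Y).d_comp_d (n + 2) (n + 1) n
        exact congrArg (fun g => g.hom x) this
      rw [h1, map_sub, hz, h2, sub_zero]
    refine ⟨x + subdivHomotopy (subdiv^[k] z), ?_⟩
    rw [map_add, hx, d_subdivHomotopy, hd, map_zero, Function.iterate_succ_apply']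
    abel

/-- Singular chains made of simplices each contained in a member of a family of sets. -/
def smallChains {ι : Type} (U : ι → Set Y) (n : ℕ) : AddSubgroup ((chains Y).X n) :=
  AddSubgroup.closure {x | ∃ (τ : C(Simp n, Y)) (i : ι), x = gen τ ∧ ∀ t, τ t ∈ U i}

/-- The quotient map by the span of the simplices kills every simplex, hence is zero. -/
theorem closure_gen (Y : Type) [TopologicalSpace Y] (n : ℕ) :
    AddSubgroup.closure (Set.range (gen (Y := Y) (n := n))) = ⊤ := by
  set S := AddSubgroup.closure (Set.range (gen (Y := Y) (n := n)))
  have h : QuotientAddGroup.mk' S = 0 := by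
    refine chains_hom_ext fun σ => ?_
    exact (QuotientAddGroup.eq_zero_iff _).2 (AddSubgroup.subset_closure ⟨σ, rfl⟩)
  rw [eq_top_iff]
  intro x _
  exact (QuotientAddGroup.eq_zero_iff x).1 (DFunLike.congr_fun h x)

theorem realize_mem_smallChains {ι : Type} {U : ι → Set Y} (σ : C(Simp n, Y)) {δ : ℝ}
    (hδ : ∀ x, ∃ i, Metric.ball x δ ⊆ σ ⁻¹' U i) {d : ℝ} (hd : d < δ) {x : AffChain n (m + 1)}
    (hx : x ∈ meshChains n (m + 1) d) : realize σ x ∈ smallChains U m := by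
  have : meshChains n (m + 1) d ≤ (smallChains U m).comap (realize σ) := by
    rw [meshChains, AddSubgroup.closure_le]
    rintro _ ⟨w, rfl, hw⟩
    obtain ⟨i, hi⟩ := hδ (w 0)
    refine AddSubgroup.mem_comap.2 (AddSubgroup.subset_closure ⟨_, i, realize_of _ _, fun t => ?_⟩)
    refine hi ?_
    rw [Metric.mem_ball, dist_comm]
    exact (dist_aff_le w (w 0) d (fun j => hw 0 j) t).trans_lt hd
  exact this hx

/-- Iterated barycentric subdivision makes singular chains small. -/
theorem exists_subdiv_iterate_mem_smallChains {ι : Type} {U : ι → Set Y} (hU : ∀ i, IsOpen (U i))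
    (hcov : ⋃ i, U i = Set.univ) (z : (chains Y).X n) :
    ∃ k₀, ∀ k ≥ k₀, subdiv^[k] z ∈ smallChains U n := by
  have hz : z ∈ AddSubgroup.closure (Set.range (gen (Y := Y) (n := n))) := by
    rw [closure_gen]; trivial
  induction hz using AddSubgroup.closure_induction with
  | mem x hx =>
    obtain ⟨σ, rfl⟩ := hx
    have : CompactSpace (Simp n) := isCompact_iff_compactSpace.1 (isCompact_stdSimplex ℝ _)
    obtain ⟨δ, hδ, hδ'⟩ := lebesgue_number_lemma_of_metric (s := (Set.univ : Set (Simp n)))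
      (c := fun i => σ ⁻¹' U i) isCompact_univ (fun i => (hU i).preimage σ.continuous) (by
        rw [← Set.preimage_iUnion, hcov]; simp)
    -- Points of the standard simplex have sup norm at most 1, so 2 bounds all distances between
    -- vertices.
    have hbase : idSimplex n ∈ meshChains n (n + 1) 2 := by
      refine AddSubgroup.subset_closure ⟨_, rfl, fun i j => ?_⟩
      have h1 : ∀ x : Simp n, ‖x.1‖ ≤ 1 := fun x => by
        simpa using stdSimplex_subset_closedBall x.2
      have : dist (stdSimplex.vertex (S := ℝ) i : Simp n) (stdSimplex.vertex j) =
        ‖(stdSimplex.vertex (S := ℝ) i : Simp n).1 - (stdSimplex.vertex j : Simp n).1‖ := by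
        rw [← dist_eq_norm]; rfl
      rw [this]
      have h2 := h1 (stdSimplex.vertex i)
      have h3 := h1 (stdSimplex.vertex j)
      exact (norm_sub_le _ _).trans (by linarith)
    have hr0 : (0 : ℝ) ≤ 1 - 1 / ((n + 1 : ℕ) : ℝ) := by
      rw [sub_nonneg, div_le_one (by positivity)]
      push_cast
      linarith [(Nat.cast_nonneg n : (0 : ℝ) ≤ n)]
    have hr1 : 1 - 1 / ((n + 1 : ℕ) : ℝ) < 1 := by
      have : 0 < 1 / ((n + 1 : ℕ) : ℝ) := by positivity
      linarith
    have htend := (tendsto_pow_atTop_nhds_zero_of_lt_one hr0 hr1).mul_const 2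
    rw [zero_mul] at htend
    obtain ⟨k₀, hk₀⟩ := Filter.eventually_atTop.1 (htend.eventually (gt_mem_nhds hδ))
    refine ⟨k₀, fun k hk => ?_⟩
    have hit : subdiv^[k] (gen σ) = realize σ ((sd (n + 1))^[k] (idSimplex n)) := by
      clear hk
      induction k with
      | zero => exact (realize_idSimplex σ).symm
      | succ k ih =>
        rw [Function.iterate_succ_apply', ih, subdiv_realize, Function.iterate_succ_apply']
    rw [hit]
    exact realize_mem_smallChains σ (fun x => hδ' x trivial) (hk₀ k hk)
      (sd_iterate_mem_meshChains hbase k)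
  | zero => exact ⟨0, fun k _ => by rw [iterate_map_zero]; exact zero_mem _⟩
  | add x y _ _ hx hy =>
    obtain ⟨k₁, h₁⟩ := hx
    obtain ⟨k₂, h₂⟩ := hy
    refine ⟨max k₁ k₂, fun k hk => ?_⟩
    rw [iterate_map_add]
    exact add_mem (h₁ k ((le_max_left _ _).trans hk)) (h₂ k ((le_max_right _ _).trans hk))
  | neg x _ hx =>
    obtain ⟨k₁, h₁⟩ := hx
    refine ⟨k₁, fun k hk => ?_⟩
    rw [iterate_map_neg]
    exact neg_mem (h₁ k hk)

/-- Additivity of homology: two pairs of maps that agree crosswise on the members of an open cover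
by two sets have the same difference in positive degrees. -/
theorem push_add_push_eq {U V : Set Y} (hU : IsOpen U) (hV : IsOpen V) (hUV : U ∪ V = Set.univ)
    {f₁ f₂ f₃ f₄ : C(Y, Z)} (h₁₃ : Set.EqOn f₁ f₃ U) (h₂₄ : Set.EqOn f₂ f₄ U)
    (h₁₂ : Set.EqOn f₁ f₂ V) (h₃₄ : Set.EqOn f₃ f₄ V) (c : H (n + 1) Y) :
    push (n + 1) f₁ c + push (n + 1) f₄ c = push (n + 1) f₂ c + push (n + 1) f₃ c := by
  obtain ⟨z, rfl⟩ := homClass_surjective c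
  have hz := d_iCycles z
  set w := ((chains Y).iCycles (n + 1)).hom z with hw
  let F : C(Y, Z) → (i : ℕ) → (chains Y).X i →+ (chains Z).X i := fun f i => ((chainsMap f).f i).hom
  -- The alternating combination of the four chain maps vanishes on every simplex contained in `U`
  -- or in `V`. Since a cycle is homologous to a sum of such simplices, its image under `D` is a
  -- boundary.
  let D : (i : ℕ) → (chains Y).X i →+ (chains Z).X i := fun i => F f₁ i + F f₄ i - F f₂ i - F f₃ i
  have hFd : ∀ (f : C(Y, Z)) (x : (chains Y).X (n + 2)),
      F f (n + 1) (dChain Y (n + 1) x) = dChain Z (n + 1) (F f (n + 2) x) := fun f x =>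
    (congrArg (fun g => g.hom x) ((chainsMap f).comm (n + 2) (n + 1))).symm
  have hsmall : smallChains (fun b : Bool => bif b then U else V) (n + 1) ≤ (D (n + 1)).ker := by
    rw [smallChains, AddSubgroup.closure_le]
    rintro _ ⟨τ, i, rfl, hτ⟩
    rw [SetLike.mem_coe, AddMonoidHom.mem_ker]
    simp only [D, F, AddMonoidHom.sub_apply, AddMonoidHom.add_apply]
    rw [chainsMap_gen, chainsMap_gen, chainsMap_gen, chainsMap_gen]
    cases i with
    | true =>
      have e1 : f₁.comp τ = f₃.comp τ := ContinuousMap.ext fun t => h₁₃ (hτ t)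
      have e2 : f₂.comp τ = f₄.comp τ := ContinuousMap.ext fun t => h₂₄ (hτ t)
      rw [e1, e2]; abel
    | false =>
      have e1 : f₁.comp τ = f₂.comp τ := ContinuousMap.ext fun t => h₁₂ (hτ t)
      have e2 : f₃.comp τ = f₄.comp τ := ContinuousMap.ext fun t => h₃₄ (hτ t)
      rw [e1, e2]; abel
  obtain ⟨k, hk⟩ := exists_subdiv_iterate_mem_smallChains
    (U := fun b : Bool => bif b then U else V) (by rintro (_ | _) <;> assumption)
    (by rw [← hUV, Set.union_eq_iUnion]) w
  obtain ⟨x, hx⟩ := exists_d_eq_sub_subdiv_iterate w hz k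
  have hDw : D (n + 1) w = dChain Z (n + 1) (D (n + 2) x) := by
    have h1 : w = dChain Y (n + 1) x + subdiv^[k] w := by rw [hx]; abel
    have h2 : D (n + 1) (subdiv^[k] w) = 0 := hsmall (hk k le_rfl)
    rw [h1, map_add, h2, add_zero]
    simp only [D, AddMonoidHom.sub_apply, AddMonoidHom.add_apply, hFd, map_sub, map_add]
  simp only [push_homClass]
  rw [← sub_eq_zero, ← map_add, ← map_add, ← map_sub]
  refine homClass_eq_zero_of_boundary _ (D (n + 2) x) ?_
  refine Eq.trans ?_ hDw
  rw [map_sub, map_add, map_add]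
  simp only [iCycles_cyclesMap]
  simp only [D, F, AddMonoidHom.sub_apply, AddMonoidHom.add_apply, ← hw]
  abel

end
end SemiTop


namespace SemiTop
noncomputable section

/-! ### Critical values of holomorphic functions -/

/-- By the Lindelöf property, countability of the image is a local question on `s`. -/
theorem countable_image_of_nhdsWithin {α β : Type*} [TopologicalSpace α]
    [SecondCountableTopology α] {f : α → β} {s : Set α}
    (h : ∀ x ∈ s, ∃ t ∈ 𝓝[s] x, (f '' (t ∩ s)).Countable) : (f '' s).Countable := by
  choose! t ht ht' using h
  obtain ⟨c, hcs, hc, hsc⟩ := TopologicalSpace.countable_cover_nhdsWithin ht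
  refine (hc.biUnion fun x hx => ht' x (hcs hx)).mono ?_
  rintro _ ⟨y, hy, rfl⟩
  obtain ⟨x, hx, hyx⟩ := Set.mem_iUnion₂.1 (hsc hy)
  exact Set.mem_iUnion₂.2 ⟨x, hx, ⟨y, ⟨hyx, hy⟩, rfl⟩⟩

/-! ### Restriction of holomorphic functions to complex lines. -/

section Line

variable {E : Type} [NormedAddCommGroup E] [NormedSpace ℂ E]

/-- The derivative of `g` in the direction `v`. -/
def dirDeriv (v : E) (g : E → ℂ) : E → ℂ := fun x => fderiv ℂ g x v

theorem analyticOnNhd_dirDeriv {g : E → ℂ} {U : Set E} (hg : AnalyticOnNhd ℂ g U) (v : E) :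
    AnalyticOnNhd ℂ (dirDeriv v g) U := fun x hx =>
  ((ContinuousLinearMap.apply ℂ ℂ v).analyticAt _).comp (hg.fderiv x hx)

theorem analyticOnNhd_dirDeriv_iterate {g : E → ℂ} {U : Set E} (hg : AnalyticOnNhd ℂ g U) (v : E)
    (j : ℕ) : AnalyticOnNhd ℂ ((dirDeriv v)^[j] g) U := by
  induction j with
  | zero => exact hg
  | succ j ih => rw [Function.iterate_succ_apply']; exact analyticOnNhd_dirDeriv ih v

theorem analyticOnNhd_line {g : E → ℂ} {U : Set E} (hg : AnalyticOnNhd ℂ g U) (x v : E) :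
    AnalyticOnNhd ℂ (fun t : ℂ => g (x + t • v)) {t | x + t • v ∈ U} := fun t ht =>
  AnalyticAt.fun_comp (g := g) (f := fun t : ℂ => x + t • v) (hg _ ht) (by fun_prop)

theorem iteratedDeriv_line {g : E → ℂ} {U : Set E} (hU : IsOpen U) (hg : AnalyticOnNhd ℂ g U)
    (x v : E) (j : ℕ) : ∀ t : ℂ, x + t • v ∈ U →
      iteratedDeriv j (fun t : ℂ => g (x + t • v)) t = (dirDeriv v)^[j] g (x + t • v) := by
  induction j with
  | zero => intro t _; simp
  | succ j ih =>
    intro t ht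
    have hc : Continuous fun t : ℂ => x + t • v := by fun_prop
    have hev : iteratedDeriv j (fun t : ℂ => g (x + t • v)) =ᶠ[𝓝 t]
        fun t => (dirDeriv v)^[j] g (x + t • v) :=
      Filter.eventually_of_mem ((hU.preimage hc).mem_nhds ht) fun t ht => ih t ht
    rw [iteratedDeriv_succ, hev.deriv_eq, Function.iterate_succ_apply']
    have h1 : HasDerivAt (fun t : ℂ => x + t • v) v t := by
      simpa using ((hasDerivAt_id t).smul_const v).const_add x
    exact ((analyticOnNhd_dirDeriv_iterate hg v j _ ht).differentiableAt.hasFDerivAt.comp_hasDerivAt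
      t h1).deriv

/-- If a holomorphic function is not locally constant at a critical point then some iterated
directional derivative vanishes there to first order; the direction can be chosen in a
fixed dense set. -/
theorem exists_dirDeriv_ne_zero {g : E → ℂ} {U : Set E} (hU : IsOpen U)
    (hg : AnalyticOnNhd ℂ g U) {x : E} (hx : x ∈ U) (hcrit : fderiv ℂ g x = 0)
    (hne : ¬ ∀ᶠ y in 𝓝 x, g y = g x) {S : Set E} (hS : Dense S) :
    ∃ v ∈ S, ∃ j : ℕ, (dirDeriv v)^[j + 1] g x = 0 ∧ (dirDeriv v)^[j + 2] g x ≠ 0 := by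
  obtain ⟨ε, hε, hball⟩ := Metric.isOpen_iff.1 hU x hx
  obtain ⟨y, hy, hyx⟩ : ∃ y ∈ Metric.ball x ε, g y ≠ g x := by
    by_contra! h
    exact hne (Filter.eventually_of_mem (Metric.ball_mem_nhds x hε) h)
  -- The direction from x to a nearby point where `g` differs from `g x` can be perturbed into `S`,
  -- because these directions form an open set.
  have hopen : IsOpen {v : E | x + v ∈ Metric.ball x ε ∩ {y | g y ≠ g x}} := by
    have h1 : IsOpen (Metric.ball x ε ∩ {y | g y ≠ g x}) :=
      (hg.continuousOn.mono hball).isOpen_inter_preimage Metric.isOpen_ball isOpen_ne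
    exact h1.preimage (continuous_const.add continuous_id)
  obtain ⟨v, hv, hvS⟩ := hS.inter_open_nonempty _ hopen ⟨y - x, by
    rw [Set.mem_ofPred_eq, add_sub_cancel]; exact ⟨hy, hyx⟩⟩
  refine ⟨v, hvS, ?_⟩
  set u : ℂ → ℂ := fun t => g (x + t • v) with hu
  set Ω : Set ℂ := {t | x + t • v ∈ Metric.ball x ε} with hΩ
  have huΩ : AnalyticOnNhd ℂ u Ω := analyticOnNhd_line (hg.mono hball) x v
  have hconv : Convex ℝ Ω := by
    intro s hs t ht a b ha hb hab
    have h2 := Metric.mem_ball.1 hs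
    have h3 := Metric.mem_ball.1 ht
    rw [dist_eq_norm, add_sub_cancel_left, norm_smul] at h2 h3
    rw [hΩ, Set.mem_ofPred_eq, Metric.mem_ball, dist_eq_norm, add_sub_cancel_left, norm_smul]
    have h4 : ‖a • s + b • t‖ ≤ a * ‖s‖ + b * ‖t‖ := by
      refine (norm_add_le _ _).trans ?_
      rw [norm_smul, norm_smul, Real.norm_of_nonneg ha, Real.norm_of_nonneg hb]
    calc ‖a • s + b • t‖ * ‖v‖ ≤ (a * ‖s‖ + b * ‖t‖) * ‖v‖ := by gcongr
      _ = a * (‖s‖ * ‖v‖) + b * (‖t‖ * ‖v‖) := by ring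
      _ < ε := by
        rcases ha.eq_or_lt with rfl | ha'
        · have : b = 1 := by linarith
          subst this; linarith
        · nlinarith
  have h0 : (0 : ℂ) ∈ Ω := by simp [hΩ, hε]
  have h1 : (1 : ℂ) ∈ Ω := by simpa [hΩ] using hv.1
  -- If all derivatives at 0 of the restriction `u` to the line vanished, `u` would be constant on
  -- the convex set `Ω`, which contains both 0 and 1.
  have hex : ∃ j : ℕ, (dirDeriv v)^[j + 1] g x ≠ 0 := by
    by_contra! hall
    have hps := (huΩ 0 h0).hasFPowerSeriesAt
    have hder : ∀ j, iteratedDeriv (j + 1) u 0 = 0 := fun j => by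
      have := iteratedDeriv_line hU hg x v (j + 1) 0 (by simpa using hx)
      rw [hu, this]
      simpa using hall j
    have hzero : ∀ᶠ t in 𝓝 (0 : ℂ), u t = u 0 := by
      have hc := hps.eventually_hasSum
      refine hc.mono fun t ht => ?_
      rw [zero_add] at ht
      refine ht.unique ?_
      convert hasSum_single 0 ?_ using 1
      · simp
      · intro j hj
        obtain ⟨j, rfl⟩ := Nat.exists_eq_succ_of_ne_zero hj
        simp [hder j]
    have := huΩ.eqOn_of_preconnected_of_eventuallyEq analyticOnNhd_const hconv.isPreconnected h0
      hzero h1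
    simp only [hu, one_smul, zero_smul, add_zero] at this
    exact hv.2 this
  classical
  have hmin := Nat.find_spec hex
  -- The first nonvanishing derivative has order at least two, since x is a critical point; this
  -- makes room for the vanishing derivative just before it.
  have hpos : Nat.find hex ≠ 0 := by
    intro h
    rw [h] at hmin
    apply hmin
    simp [dirDeriv, hcrit]
  obtain ⟨j, hj⟩ := Nat.exists_eq_succ_of_ne_zero hpos
  refine ⟨j, ?_, ?_⟩
  · exact not_not.1 (Nat.find_min hex (by omega : j < Nat.find hex))
  · rw [hj] at hmin; exact hmin

end Line

/-- The critical values of a holomorphic function on an open subset of a finite-dimensional space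
are countable. -/
theorem countable_criticalValues (m : ℕ) : ∀ (E : Type) [NormedAddCommGroup E] [NormedSpace ℂ E]
    [FiniteDimensional ℂ E], Module.finrank ℂ E = m → ∀ (U : Set E), IsOpen U → ∀ g : E → ℂ,
      AnalyticOnNhd ℂ g U → (g '' {x | x ∈ U ∧ fderiv ℂ g x = 0}).Countable := by
  induction m with
  | zero =>
    intro E _ _ _ hE U _ g _
    have : Subsingleton E := Module.finrank_zero_iff.1 hE
    exact (Set.Subsingleton.image Set.subsingleton_of_subsingleton g).countable
  | succ m ih =>
    intro E _ _ _ hE U hU g hg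
    have : SecondCountableTopology E :=
      have := FiniteDimensional.proper ℂ E; secondCountable_of_proper
    have : CompleteSpace E := FiniteDimensional.complete ℂ E
    obtain ⟨S, hSc, hSd⟩ := TopologicalSpace.exists_countable_dense E
    -- Critical points where `g` is not locally constant are covered by countably many sets `Z v j`.
    -- Each lies in the zero set of h, the (j+1)-st derivative along v, and h has nonzero derivative
    -- on it; so near each of its points `Z v j` lies in a smooth hypersurface, of dimension one
    -- less.
    let Z : E → ℕ → Set E := fun v j => {x | x ∈ U ∧ fderiv ℂ g x = 0 ∧
      (dirDeriv v)^[j + 1] g x = 0 ∧ (dirDeriv v)^[j + 2] g x ≠ 0}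
    have hsub : {x | x ∈ U ∧ fderiv ℂ g x = 0} ⊆
        {x | ∀ᶠ y in 𝓝 x, g y = g x} ∪ ⋃ v ∈ S, ⋃ j, Z v j := by
      rintro x ⟨hx, hcrit⟩
      by_cases hc : ∀ᶠ y in 𝓝 x, g y = g x
      · exact Or.inl hc
      · obtain ⟨v, hv, j, h1, h2⟩ := exists_dirDeriv_ne_zero hU hg hx hcrit hc hSd
        exact Or.inr (Set.mem_iUnion₂.2 ⟨v, hv, Set.mem_iUnion.2 ⟨j, hx, hcrit, h1, h2⟩⟩)
    refine Set.Countable.mono (Set.image_mono hsub) ?_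
    rw [Set.image_union, Set.image_iUnion₂]
    refine Set.Countable.union ?_ (hSc.biUnion fun v _ => ?_)
    · refine countable_image_of_nhdsWithin fun x hx => ⟨_, mem_nhdsWithin_of_mem_nhds hx, ?_⟩
      refine (Set.countable_singleton (g x)).mono ?_
      rintro _ ⟨y, ⟨hy, -⟩, rfl⟩
      exact hy
    rw [Set.image_iUnion]
    refine Set.countable_iUnion fun j => countable_image_of_nhdsWithin ?_
    rintro x ⟨hxU, hcrit, hx0, hx1⟩
    set h := (dirDeriv v)^[j + 1] g with hh
    have hhan : AnalyticOnNhd ℂ h U := analyticOnNhd_dirDeriv_iterate hg v (j + 1)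
    have hx1' : fderiv ℂ h x v ≠ 0 := by
      rw [Function.iterate_succ_apply'] at hx1; exact hx1
    have hstrict : HasStrictFDerivAt h (fderiv ℂ h x) x := (hhan x hxU).hasStrictFDerivAt
    have hrange : (fderiv ℂ h x).range = ⊤ := by
      refine LinearMap.range_eq_top.2 (LinearMap.surjective ?_)
      intro h0
      exact hx1' (by simpa using DFunLike.congr_fun h0 v)
    -- The hypersurface through x is parametrized by the kernel of the derivative of `h`. The
    -- induction hypothesis is applied to `g ∘ ψ`, so `ψ` has to be analytic and not merely
    -- differentiable at 0.
    set ψ : (fderiv ℂ h x).ker → E := hstrict.implicitFunction h _ hrange (h x) with hψ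
    have hψan : AnalyticAt ℂ ψ 0 := by
      have hcd := ImplicitFunctionData.contDiffAt_implicitFunction (n := ω)
        (φ := hstrict.implicitFunctionDataOfComplemented h _ hrange
          (fderiv ℂ h x).ker_closedComplemented_of_finiteDimensional_range)
        ((hhan x hxU).contDiffAt) (by
          dsimp [HasStrictFDerivAt.implicitFunctionDataOfComplemented]
          fun_prop) (by simp)
      have hpt : ImplicitFunctionData.prodFun
          (hstrict.implicitFunctionDataOfComplemented h _ hrange
          (fderiv ℂ h x).ker_closedComplemented_of_finiteDimensional_range)
          (hstrict.implicitFunctionDataOfComplemented h _ hrange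
          (fderiv ℂ h x).ker_closedComplemented_of_finiteDimensional_range).pt = (h x, 0) := by
        simp [HasStrictFDerivAt.implicitFunctionDataOfComplemented]
      rw [hpt] at hcd
      refine ContDiffAt.analyticAt ?_
      exact ContDiffAt.comp (x := (0 : (fderiv ℂ h x).ker))
        (f := fun k : (fderiv ℂ h x).ker => (h x, k)) hcd (by fun_prop)
    have hψ0 : ψ 0 = x := hstrict.implicitFunction_apply_image hrange
    have hnear : ∀ᶠ k in 𝓝 (0 : (fderiv ℂ h x).ker), AnalyticAt ℂ ψ k ∧ ψ k ∈ U :=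
      hψan.eventually_analyticAt.and
        (hψan.continuousAt.eventually (by rw [hψ0]; exact hU.mem_nhds hxU))
    obtain ⟨O, hO, hOopen, h0O⟩ := eventually_nhds_iff.1 hnear
    have hcrit' := ih (fderiv ℂ h x).ker (by
      have hr := (fderiv ℂ h x).toLinearMap.finrank_range_add_finrank_ker
      have hr' : Module.finrank ℂ (fderiv ℂ h x).toLinearMap.range = 1 := by
        have : (fderiv ℂ h x).toLinearMap.range = ⊤ := hrange
        rw [this, finrank_top, Module.finrank_self]
      have : Module.finrank ℂ (fderiv ℂ h x).toLinearMap.ker = m := by omega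
      exact this) O hOopen (g ∘ ψ) (fun k hk => (hg _ (hO k hk).2).comp (hO k hk).1)
    set Φ := hstrict.implicitToOpenPartialHomeomorph h _ hrange with hΦ
    have hev1 := hstrict.eq_implicitFunction hrange
    have hev2 : ∀ᶠ y in 𝓝 x, (Φ y).2 ∈ O := by
      have hcont : ContinuousAt Φ x :=
        Φ.continuousAt (hstrict.mem_implicitToOpenPartialHomeomorph_source hrange)
      have : Φ x = (h x, 0) := hstrict.implicitToOpenPartialHomeomorph_self hrange
      refine (continuous_snd.continuousAt.comp hcont).eventually ?_
      simp only [Function.comp, this]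
      exact hOopen.mem_nhds h0O
    refine ⟨_, mem_nhdsWithin_of_mem_nhds (hev1.and hev2), hcrit'.mono ?_⟩
    rintro _ ⟨y, ⟨⟨hy1, hy2⟩, hyU, hycrit, hy0, -⟩, rfl⟩
    have hyψ : ψ (Φ y).2 = y := by
      rw [← hh] at hy0
      rw [hψ, hx0, ← hy0]
      exact hy1
    -- A critical point of `g` on the hypersurface is critical for `g ∘ ψ`, by the chain rule.
    refine ⟨(Φ y).2, ⟨hy2, ?_⟩, by simp [hyψ]⟩
    rw [fderiv_comp _ (by rw [hyψ]; exact (hg y hyU).differentiableAt)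
      (hO _ hy2).1.differentiableAt, hyψ, hycrit, ContinuousLinearMap.zero_comp]

/-! ### Complements of countable sets of fibers -/

/-- The zeros of `u - d` are isolated: otherwise `u` would be constantly equal to `d` in `D`,
contrary to its value at `t₀`. -/
theorem countable_preimage_of_analytic {u : ℂ → ℂ} {Ω : Set ℂ}
    (hΩ' : IsPreconnected Ω) (hu : AnalyticOnNhd ℂ u Ω) {D : Set ℂ} (hD : D.Countable) {t₀ : ℂ}
    (ht₀ : t₀ ∈ Ω) (h₀ : u t₀ ∉ D) : {t | t ∈ Ω ∧ u t ∈ D}.Countable := by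
  have : {t | t ∈ Ω ∧ u t ∈ D} = ⋃ d ∈ D, {t | t ∈ Ω ∧ u t = d} := by
    ext t; simp
  rw [this]
  refine hD.biUnion fun d hd => ?_
  have hs : ∀ t ∈ {t | t ∈ Ω ∧ u t = d}, {t} ∈ 𝓝[{t | t ∈ Ω ∧ u t = d}] t := by
    rintro t ⟨ht, htd⟩
    have hsub : AnalyticAt ℂ (fun s => u s - d) t := (hu t ht).sub analyticAt_const
    rcases hsub.eventually_eq_zero_or_eventually_ne_zero with h | h
    · exfalso
      have := hu.eqOn_of_preconnected_of_eventuallyEq (g := fun _ => d) analyticOnNhd_const hΩ' ht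
        (h.mono fun s hs => sub_eq_zero.1 hs) ht₀
      exact h₀ (by rw [this]; exact hd)
    · rw [eventually_nhdsWithin_iff] at h
      rw [mem_nhdsWithin_iff_eventually]
      filter_upwards [h] with s hs hs'
      by_contra hne
      exact hs hne (sub_eq_zero.2 hs'.2)
  obtain ⟨c, -, hc, hsc⟩ := TopologicalSpace.countable_cover_nhdsWithin hs
  exact hc.mono fun t ht => by simpa using hsc ht

/-- The path is broken at a point `z t` on the perpendicular bisector of the segment from 0 to 1.
For distinct t, the segments from an endpoint to `z t` meet only in that endpoint, so only countably
many t are excluded by `s`. -/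
theorem joinedIn_diff_countable {Ω : Set ℂ} (hΩ : IsOpen Ω) (hconv : Convex ℝ Ω)
    {s : Set ℂ} (hs : s.Countable) (h0 : 0 ∈ Ω) (h1 : 1 ∈ Ω) (h0s : 0 ∉ s) (h1s : 1 ∉ s) :
    JoinedIn (Ω \ s) 0 1 := by
  let z : ℝ → ℂ := fun t => 2⁻¹ + t * Complex.I
  have hinj : ∀ e : ℂ, e = 0 ∨ e = 1 → e ∉ s →
      Set.Countable {t : ℝ | (segment ℝ e (z t) ∩ s).Nonempty} := by
    intro e he hes
    refine Set.countable_ofPred_nonempty_of_disjoint ?_ (fun t => Set.inter_subset_right) hs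
    intro t t' htt'
    refine Set.disjoint_left.2 ?_
    rintro w ⟨⟨a, b, ha, hb, hab, rfl⟩, hw⟩ ⟨⟨a', b', ha', hb', hab', hww⟩, -⟩
    have ha1 : a = 1 - b := by linarith
    have ha1' : a' = 1 - b' := by linarith
    subst ha1 ha1'
    have hre := congrArg Complex.re hww
    have him := congrArg Complex.im hww
    rcases he with rfl | rfl <;> simp [z] at hre him <;>
    · have hbb : b' = b := by linarith
      subst hbb
      rcases mul_eq_mul_left_iff.1 him with h | h
      · exact htt' h.symm
      · subst h
        apply hes
        simpa using hw
  have hη : ∀ᶠ t in 𝓝 (0 : ℝ), z t ∈ Ω := by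
    have hc : Continuous z := by fun_prop
    have hz : z 0 ∈ Ω := by
      have := hconv h0 h1 (a := 2⁻¹) (b := 2⁻¹) (by norm_num) (by norm_num) (by norm_num)
      simpa [z] using this
    exact hc.continuousAt.eventually (hΩ.mem_nhds hz)
  obtain ⟨V, hV, hVo, hV0⟩ := eventually_nhds_iff.1 hη
  obtain ⟨t, htV, ht⟩ := ((hinj 0 (Or.inl rfl) h0s).union
    (hinj 1 (Or.inr rfl) h1s)).dense_compl ℝ |>.inter_open_nonempty V hVo ⟨0, hV0⟩
  simp only [Set.compl_union, Set.mem_inter_iff, Set.mem_compl_iff, Set.mem_ofPred_eq,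
    Set.not_nonempty_iff_eq_empty] at ht
  have hseg : ∀ e ∈ Ω, segment ℝ e (z t) ∩ s = ∅ → JoinedIn (Ω \ s) e (z t) := fun e he hes => by
    refine JoinedIn.of_segment_subset fun w hw => ⟨hconv.segment_subset he (hV t htV) hw, fun h => ?_⟩
    exact (hes.subset ⟨hw, h⟩ : w ∈ (∅ : Set ℂ))
  exact (hseg 0 h0 ht.1).trans (hseg 1 h1 ht.2).symm

end
end SemiTop


namespace SemiTop
noncomputable section

/-! ### Submersions -/

/-- A chart in which `π` is a projection. -/
def HasSubmersionChart {B X : Type} [TopologicalSpace B] [TopologicalSpace X] (n : ℕ) (π : X → B)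
    (x : X) : Prop :=
  ∃ (P : Submodule ℂ (EuclideanSpace ℂ (Fin (n + 1)))) (Ξ : OpenPartialHomeomorph X (B × P)),
    x ∈ Ξ.source ∧ ∀ y ∈ Ξ.source, (Ξ y).1 = π y

theorem surjective_of_ne_zero {E : Type} [NormedAddCommGroup E] [NormedSpace ℂ E]
    (A : E →L[ℂ] ℂ) (hA : A ≠ 0) : Function.Surjective A :=
  LinearMap.surjective (f := A.toLinearMap) fun h => hA (by
    ext v; exact DFunLike.congr_fun h v)

section Submersion

variable {B : Type} [TopologicalSpace B] [ChartedSpace ℂ B]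
    {n : ℕ} {X : Type} [TopologicalSpace X]
    [ChartedSpace (EuclideanSpace ℂ (Fin (n + 1))) X]

/-- The expression of `π` in the preferred charts at `x` and `π x`. -/
def localExpr (n : ℕ) [ChartedSpace (EuclideanSpace ℂ (Fin (n + 1))) X] (π : X → B) (x : X) :
    EuclideanSpace ℂ (Fin (n + 1)) → ℂ :=
  fun u => chartAt ℂ (π x) (π ((chartAt (EuclideanSpace ℂ (Fin (n + 1))) x).symm u))

/-- The domain of `localExpr`. -/
def localDom (n : ℕ) [ChartedSpace (EuclideanSpace ℂ (Fin (n + 1))) X] (π : X → B) (x : X) :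
    Set (EuclideanSpace ℂ (Fin (n + 1))) :=
  (chartAt (EuclideanSpace ℂ (Fin (n + 1))) x).target ∩
    (chartAt (EuclideanSpace ℂ (Fin (n + 1))) x).symm ⁻¹' (π ⁻¹' (chartAt ℂ (π x)).source)

theorem isOpen_localDom {π : X → B} (hπ : Continuous π) (x : X) : IsOpen (localDom n π x) :=
  (chartAt (EuclideanSpace ℂ (Fin (n + 1))) x).isOpen_inter_preimage_symm
    ((chartAt ℂ (π x)).open_source.preimage hπ)

theorem mem_localDom (π : X → B) (x : X) :
    chartAt (EuclideanSpace ℂ (Fin (n + 1))) x x ∈ localDom n π x := by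
  refine ⟨mem_chart_target _ _, ?_⟩
  simp [mem_chart_source]

theorem mfderiv_eq_fderiv_localExpr {π : X → B}
    (hπ : ContMDiff 𝓘(ℂ, EuclideanSpace ℂ (Fin (n + 1))) 𝓘(ℂ) ω π) (x : X) :
    mfderiv 𝓘(ℂ, EuclideanSpace ℂ (Fin (n + 1))) 𝓘(ℂ) π x =
      fderiv ℂ (localExpr n π x) (chartAt (EuclideanSpace ℂ (Fin (n + 1))) x x) := by
  have hd : MDifferentiableAt 𝓘(ℂ, EuclideanSpace ℂ (Fin (n + 1))) 𝓘(ℂ) π x :=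
    (hπ x).mdifferentiableAt (by simp)
  refine hd.mfderiv.trans ?_
  have hr : Set.range 𝓘(ℂ, EuclideanSpace ℂ (Fin (n + 1))) = Set.univ := by simp
  rw [hr]
  exact congrFun (fderivWithin_univ (𝕜 := ℂ) (f := localExpr n π x)) _

variable [IsManifold 𝓘(ℂ) ω B] [IsManifold 𝓘(ℂ, EuclideanSpace ℂ (Fin (n + 1))) ω X]

theorem analyticOnNhd_localExpr {π : X → B}
    (hπ : ContMDiff 𝓘(ℂ, EuclideanSpace ℂ (Fin (n + 1))) 𝓘(ℂ) ω π) (x : X) :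
    AnalyticOnNhd ℂ (localExpr n π x) (localDom n π x) := by
  have hopen := isOpen_localDom (n := n) hπ.continuous x
  rw [← hopen.analyticOn_iff_analyticOnNhd]
  refine ContDiffOn.analyticOn ?_
  set c := chartAt (EuclideanSpace ℂ (Fin (n + 1))) x
  have h := (contMDiffOn_iff_of_mem_maximalAtlas'
    (I := 𝓘(ℂ, EuclideanSpace ℂ (Fin (n + 1)))) (I' := 𝓘(ℂ)) (n := ω) (e := c)
    (e' := chartAt ℂ (π x)) (f := π) (s := c.source ∩ π ⁻¹' (chartAt ℂ (π x)).source)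
    (IsManifold.chart_mem_maximalAtlas x) (IsManifold.chart_mem_maximalAtlas (π x))
    Set.inter_subset_left (fun y hy => hy.2)).1 hπ.contMDiffOn
  refine h.mono ?_
  rintro u ⟨hu1, hu2⟩
  exact ⟨c.symm u, ⟨c.map_target hu1, hu2⟩, by simp [c.right_inv hu1]⟩

theorem fderiv_localExpr_eq_zero {π : X → B}
    (hπ : ContMDiff 𝓘(ℂ, EuclideanSpace ℂ (Fin (n + 1))) 𝓘(ℂ) ω π) (x y : X)
    (hy : y ∈ (chartAt (EuclideanSpace ℂ (Fin (n + 1))) x).source)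
    (hy' : π y ∈ (chartAt ℂ (π x)).source)
    (h0 : ¬ Function.Surjective (mfderiv 𝓘(ℂ, EuclideanSpace ℂ (Fin (n + 1))) 𝓘(ℂ) π y)) :
    fderiv ℂ (localExpr n π x) (chartAt (EuclideanSpace ℂ (Fin (n + 1))) x y) = 0 := by
  set c := chartAt (EuclideanSpace ℂ (Fin (n + 1))) x with hc
  have hzero : mfderiv 𝓘(ℂ, EuclideanSpace ℂ (Fin (n + 1))) 𝓘(ℂ) π y = 0 := by
    by_contra hne
    exact h0 (surjective_of_ne_zero (E := EuclideanSpace ℂ (Fin (n + 1)))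
      (mfderiv 𝓘(ℂ, EuclideanSpace ℂ (Fin (n + 1))) 𝓘(ℂ) π y) hne)
  have hd : MDifferentiableAt 𝓘(ℂ, EuclideanSpace ℂ (Fin (n + 1))) 𝓘(ℂ) π y :=
    (hπ y).mdifferentiableAt (by simp)
  have hcs : MDifferentiableAt 𝓘(ℂ, EuclideanSpace ℂ (Fin (n + 1)))
      𝓘(ℂ, EuclideanSpace ℂ (Fin (n + 1))) c.symm (c y) :=
    mdifferentiableAt_atlas_symm (chart_mem_atlas _ x) (c.map_source hy)
  have hz : MDifferentiableAt 𝓘(ℂ) 𝓘(ℂ) (chartAt ℂ (π x)) (π y) :=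
    mdifferentiableAt_atlas (chart_mem_atlas _ _) hy'
  have hyy : c.symm (c y) = y := c.left_inv hy
  have h1 : HasMFDerivAt 𝓘(ℂ, EuclideanSpace ℂ (Fin (n + 1))) 𝓘(ℂ) π (c.symm (c y)) 0 := by
    rw [hyy, ← hzero]; exact hd.hasMFDerivAt
  have h2 := h1.comp (c y) hcs.hasMFDerivAt
  have hz' : MDifferentiableAt 𝓘(ℂ) 𝓘(ℂ) (chartAt ℂ (π x)) ((π ∘ c.symm) (c y)) := by
    rw [Function.comp, hyy]; exact hz
  have h4 := hz'.hasMFDerivAt.comp (c y) h2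
  have h5 : HasFDerivAt (localExpr n π x) (0 : EuclideanSpace ℂ (Fin (n + 1)) →L[ℂ] ℂ) (c y) := by
    rw [ContinuousLinearMap.zero_comp, ContinuousLinearMap.comp_zero] at h4
    exact h4.hasFDerivAt
  exact h5.fderiv

/-- The implicit function theorem for the local expression straightens π; the chart of the base then
turns the first component back into a point of `B`. -/
theorem hasSubmersionChart {π : X → B}
    (hπ : ContMDiff 𝓘(ℂ, EuclideanSpace ℂ (Fin (n + 1))) 𝓘(ℂ) ω π) (x : X)
    (hx : Function.Surjective (mfderiv 𝓘(ℂ, EuclideanSpace ℂ (Fin (n + 1))) 𝓘(ℂ) π x)) :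
    HasSubmersionChart n π x := by
  set c := chartAt (EuclideanSpace ℂ (Fin (n + 1))) x with hc
  set z := chartAt ℂ (π x) with hz
  have han := analyticOnNhd_localExpr hπ x _ (mem_localDom π x)
  have hstrict := han.hasStrictFDerivAt
  have hrange : (fderiv ℂ (localExpr n π x) (c x)).range = ⊤ := by
    refine LinearMap.range_eq_top.2 ?_
    rw [mfderiv_eq_fderiv_localExpr hπ x] at hx
    exact hx
  set Φ := hstrict.implicitToOpenPartialHomeomorph _ _ hrange with hΦ
  have hsrc : IsOpen (π ⁻¹' z.source) := z.open_source.preimage hπ.continuous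
  set Ξ := ((c.trans Φ).trans (z.symm.prod (OpenPartialHomeomorph.refl _))).restrOpen _ hsrc with hΞ
  have hΦ1 : ∀ y ∈ c.source, (Φ (c y)).1 = z (π y) := fun y hy => by
    have : (Φ (c y)).1 = localExpr n π x (c y) := rfl
    rw [this, localExpr, c.left_inv hy]
  refine ⟨_, Ξ, ?_, ?_⟩
  · have hxc : x ∈ c.source := mem_chart_source _ x
    have h1 : c x ∈ Φ.source := hstrict.mem_implicitToOpenPartialHomeomorph_source hrange
    have h2 : z (π x) ∈ z.target := mem_chart_target _ _
    have h3 : π x ∈ z.source := mem_chart_source _ _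
    simp only [hΞ, OpenPartialHomeomorph.restrOpen_source, OpenPartialHomeomorph.trans_source,
      OpenPartialHomeomorph.prod_source, Set.mem_inter_iff, Set.mem_preimage,
      OpenPartialHomeomorph.symm_source, Set.mem_prod, OpenPartialHomeomorph.coe_trans,
      Function.comp]
    exact ⟨⟨⟨hxc, h1⟩, by rw [hΦ1 x hxc]; exact h2, trivial⟩, h3⟩
  · intro y hy
    simp only [hΞ, OpenPartialHomeomorph.restrOpen_source, OpenPartialHomeomorph.trans_source,
      Set.mem_inter_iff, Set.mem_preimage] at hy
    have : (Ξ y).1 = z.symm (Φ (c y)).1 := rfl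
    rw [this, hΦ1 y hy.1.1.1, z.left_inv hy.2]

/-- Finitely many charts cover the compact space `X`, and in each of them the critical values are
countable. -/
theorem countable_singularValues [CompactSpace X] {π : X → B}
    (hπ : ContMDiff 𝓘(ℂ, EuclideanSpace ℂ (Fin (n + 1))) 𝓘(ℂ) ω π) :
    {b | ¬ SmoothFiber n π b}.Countable := by
  let W : X → Set X := fun x => (chartAt (EuclideanSpace ℂ (Fin (n + 1))) x).source ∩
    π ⁻¹' (chartAt ℂ (π x)).source
  have hW : ∀ x, W x ∈ 𝓝 x := fun x => Filter.inter_mem (chart_source_mem_nhds _ x)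
    (hπ.continuous.continuousAt (chart_source_mem_nhds _ _))
  obtain ⟨t, -, ht⟩ := isCompact_univ.elim_nhds_subcover W fun x _ => hW x
  have hcount : ∀ x ∈ t, ((chartAt ℂ (π x)).symm '' (localExpr n π x ''
      {u | u ∈ localDom n π x ∧ fderiv ℂ (localExpr n π x) u = 0})).Countable := fun x _ =>
    (countable_criticalValues _ _ rfl _ (isOpen_localDom hπ.continuous x) _
      (analyticOnNhd_localExpr hπ x)).image _
  refine (t.countable_toSet.biUnion hcount).mono ?_
  intro b hb
  simp only [SmoothFiber, Set.mem_ofPred_eq, not_forall] at hb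
  obtain ⟨y, rfl, hy⟩ := hb
  obtain ⟨x, hx, hyx⟩ := Set.mem_iUnion₂.1 (ht (Set.mem_univ y))
  refine Set.mem_iUnion₂.2 ⟨x, hx, _, ⟨chartAt (EuclideanSpace ℂ (Fin (n + 1))) x y, ⟨⟨?_, ?_⟩, ?_⟩,
    rfl⟩, ?_⟩
  · exact OpenPartialHomeomorph.map_source _ hyx.1
  · simpa [OpenPartialHomeomorph.left_inv _ hyx.1] using hyx.2
  · exact fderiv_localExpr_eq_zero hπ x y hyx.1 hyx.2 hy
  · rw [localExpr, OpenPartialHomeomorph.left_inv _ hyx.1, OpenPartialHomeomorph.left_inv _ hyx.2]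

end Submersion

/-! ### Lifting maps to neighboring fibers -/

section Lift

variable {B : Type} [TopologicalSpace B] [T2Space B] [CompactSpace B]
    {n : ℕ} {X : Type} [TopologicalSpace X] {π : X → B}
    {Q : Type} [TopologicalSpace Q] [CompactSpace Q] [T2Space Q]

/-- `g` extends the map `Γ` to a fiber of `π` to a family of maps to the fibers over `N`. -/
structure IsFiberwiseLift (π : X → B) (b₁ : B) (Γ : Q → X) (N : Set B) (M : Set Q)
    (g : B × Q → X) : Prop where
  continuousOn : ContinuousOn g (N ×ˢ M)
  proj : ∀ b ∈ N, ∀ q ∈ M, π (g (b, q)) = b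
  base : ∀ q ∈ M, g (b₁, q) = Γ q

/-- Over `C` the lift stays in one submersion chart, whose fiber coordinate lies in a vector space.
Tietze's theorem extends this coordinate from where it is prescribed, by `g` on `M ∩ C` and by `Γ`
over `b₁`, and shrinking the neighborhood of `b₁` keeps the extension inside the chart. -/
theorem exists_fiberwiseLift_union {b₁ : B} {Γ : Q → X} (hΓ : Continuous Γ)
    {N : Set B} (hN : N ∈ 𝓝 b₁) {M : Set Q} (hM : IsClosed M) {g : B × Q → X}
    (hg : IsFiberwiseLift π b₁ Γ N M g) {C : Set Q} (hC : IsClosed C)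
    {P : Submodule ℂ (EuclideanSpace ℂ (Fin (n + 1)))} {Ξ : OpenPartialHomeomorph X (B × P)}
    (hΞ : ∀ y ∈ Ξ.source, (Ξ y).1 = π y) (hΓC : ∀ q ∈ C, Γ q ∈ Ξ.source)
    (hΓb : ∀ q, π (Γ q) = b₁) :
    ∃ N' ∈ 𝓝 b₁, IsClosed N' ∧ N' ⊆ N ∧ ∃ g' : B × Q → X,
      IsFiberwiseLift π b₁ Γ N' (M ∪ C) g' ∧ ∀ b ∈ N', ∀ q ∈ M, g' (b, q) = g (b, q) := by
  classical
  have hb₁ : b₁ ∈ N := mem_of_mem_nhds hN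
  -- Tube lemma: over the compact set `M ∩ C`, the given lift remains in the chart for b close to
  -- `b₁`.
  have htube : ∀ᶠ b in 𝓝 b₁, ∀ q ∈ M ∩ C, b ∈ N → g (b, q) ∈ Ξ.source := by
    have hK : IsCompact (M ∩ C) := (hM.inter hC).isCompact
    have h1 : ∀ q ∈ M ∩ C, ∀ᶠ p : B × Q in 𝓝 (b₁, q), p.2 ∈ M ∩ C → p.1 ∈ N → g p ∈ Ξ.source := by
      intro q hq
      have h2 : ∀ᶠ p in 𝓝[N ×ˢ M] (b₁, q), g p ∈ Ξ.source := by
        refine (hg.continuousOn (b₁, q) ⟨hb₁, hq.1⟩).eventually ?_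
        rw [hg.base q hq.1]
        exact Ξ.open_source.mem_nhds (hΓC q hq.2)
      rw [eventually_nhdsWithin_iff] at h2
      exact h2.mono fun p hp hp1 hp2 => hp ⟨hp2, hp1.1⟩
    have h3 := hK.eventually_forall_of_forall_eventually
      (P := fun b q => q ∈ M ∩ C → b ∈ N → g (b, q) ∈ Ξ.source) h1
    exact h3.mono fun b hb q hq hbN => hb q hq hq hbN
  obtain ⟨N₁, hN₁, hN₁c, hN₁s⟩ := exists_mem_nhds_isClosed_subset (Filter.inter_mem hN htube)
  have hN₁N : N₁ ⊆ N := fun b hb => (hN₁s hb).1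
  have hN₁g : ∀ b ∈ N₁, ∀ q ∈ M ∩ C, g (b, q) ∈ Ξ.source := fun b hb q hq =>
    (hN₁s hb).2 q hq (hN₁s hb).1
  let gh : B × Q → X := fun p => if p.2 ∈ M then g p else Γ p.2
  let T₁ : Set (B × Q) := N₁ ×ˢ (M ∩ C)
  let T₂ : Set (B × Q) := {b₁} ×ˢ C
  have hT : IsClosed (T₁ ∪ T₂) := (hN₁c.prod (hM.inter hC)).union (isClosed_singleton.prod hC)
  have hgh1 : Set.EqOn gh g T₁ := fun p hp => by simp [gh, hp.2.1]
  have hgh2 : Set.EqOn gh (fun p => Γ p.2) T₂ := fun p hp => by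
    obtain ⟨b, q⟩ := p
    obtain rfl : b = b₁ := hp.1
    by_cases h : q ∈ M
    · simp [gh, h, hg.base q h]
    · simp [gh, h]
  have hghc : ContinuousOn gh (T₁ ∪ T₂) := by
    refine ContinuousOn.union_of_isClosed ?_ ?_ (hN₁c.prod (hM.inter hC))
      (isClosed_singleton.prod hC)
    · exact (hg.continuousOn.mono (Set.prod_mono hN₁N Set.inter_subset_left)).congr hgh1
    · exact (hΓ.comp continuous_snd).continuousOn.congr hgh2
  have hghs : Set.MapsTo gh (T₁ ∪ T₂) Ξ.source := by
    rintro p (hp | hp)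
    · rw [hgh1 hp]; exact hN₁g _ hp.1 _ hp.2
    · rw [hgh2 hp]; exact hΓC _ hp.2
  have hyc : ContinuousOn (fun p => (Ξ (gh p)).2) (T₁ ∪ T₂) :=
    continuous_snd.comp_continuousOn (Ξ.continuousOn.comp hghc hghs)
  have : TietzeExtension.{0} P := TietzeExtension.of_tvs ℂ
  obtain ⟨Y, hY⟩ := ContinuousMap.exists_restrict_eq hT
    (⟨_, continuousOn_iff_continuous_domRestrict.1 hyc⟩ : C((T₁ ∪ T₂ : Set (B × Q)), P))
  have hYe : ∀ p ∈ T₁ ∪ T₂, Y p = (Ξ (gh p)).2 := fun p hp =>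
    DFunLike.congr_fun hY ⟨p, hp⟩
  have hpt : ∀ p ∈ T₁ ∪ T₂, (p.1, Y p) = Ξ (gh p) := by
    intro p hp
    refine Prod.ext ?_ (hYe p hp)
    rw [hΞ _ (hghs hp)]
    rcases hp with hp | hp
    · rw [hgh1 hp]; exact (hg.proj _ (hN₁N hp.1) _ hp.2.1).symm
    · rw [hgh2 hp]; exact (show p.1 = b₁ from hp.1).trans (hΓb _).symm
  -- The tube lemma again, now for the Tietze extension, which over `b₁` takes values in the target
  -- of the chart.
  have htube2 : ∀ᶠ b in 𝓝 b₁, ∀ q ∈ C, (b, Y (b, q)) ∈ Ξ.target := by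
    refine hC.isCompact.eventually_forall_of_forall_eventually fun q hq => ?_
    have hcont : Continuous fun p : B × Q => (p.1, Y p) := by fun_prop
    refine hcont.continuousAt.eventually (Ξ.open_target.mem_nhds ?_)
    have hp : (b₁, q) ∈ T₁ ∪ T₂ := Or.inr ⟨rfl, hq⟩
    have := Ξ.map_source (hghs hp)
    rwa [← hpt _ hp] at this
  obtain ⟨N₂, hN₂, hN₂c, hN₂s⟩ := exists_mem_nhds_isClosed_subset (Filter.inter_mem hN₁ htube2)
  have hN₂1 : N₂ ⊆ N₁ := fun b hb => (hN₂s hb).1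
  let g' : B × Q → X := fun p => if p.2 ∈ M then g p else Ξ.symm (p.1, Y p)
  have hg'1 : ∀ b, ∀ q ∈ M, g' (b, q) = g (b, q) := fun b q hq => by simp [g', hq]
  have hg'2 : ∀ b ∈ N₂, ∀ q ∈ C, g' (b, q) = Ξ.symm (b, Y (b, q)) := fun b hb q hq => by
    by_cases h : q ∈ M
    · have hp : (b, q) ∈ T₁ := ⟨hN₂1 hb, h, hq⟩
      rw [hg'1 b q h, hpt (b, q) (Or.inl hp), Ξ.left_inv (hghs (Or.inl hp)), hgh1 hp]
    · simp [g', h]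
  refine ⟨N₂, hN₂, hN₂c, hN₂1.trans hN₁N, g', ⟨?_, ?_, ?_⟩, fun b _ q hq => hg'1 b q hq⟩
  · rw [Set.prod_union]
    refine ContinuousOn.union_of_isClosed ?_ ?_ (hN₂c.prod hM) (hN₂c.prod hC)
    · exact (hg.continuousOn.mono (Set.prod_mono (hN₂1.trans hN₁N) subset_rfl)).congr
        fun p hp => hg'1 _ _ hp.2
    · have hcont : Continuous fun p : B × Q => (p.1, Y p) := by fun_prop
      exact (Ξ.continuousOn_symm.comp hcont.continuousOn
        fun p hp => (hN₂s hp.1).2 _ hp.2).congr fun p hp => hg'2 _ hp.1 _ hp.2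
  · rintro b hb q (hq | hq)
    · rw [hg'1 b q hq]; exact hg.proj b (hN₁N (hN₂1 hb)) q hq
    · have ht := (hN₂s hb).2 q hq
      rw [hg'2 b hb q hq, ← hΞ _ (Ξ.map_target ht), Ξ.right_inv ht]
  · rintro q (hq | hq)
    · rw [hg'1 _ q hq, hg.base q hq]
    · have hp : (b₁, q) ∈ T₂ := ⟨rfl, hq⟩
      rw [hg'2 _ (mem_of_mem_nhds hN₂) q hq, hpt _ (Or.inr hp), Ξ.left_inv (hghs (Or.inr hp)),
        hgh2 hp]

/-- A map to a fiber consisting of submersion points, with a prescribed extension on a closed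
subset, extends to the neighboring fibers. -/
theorem exists_fiberwiseLift {b₁ : B} (hsub : ∀ x, π x = b₁ → HasSubmersionChart n π x)
    {Γ : Q → X} (hΓ : Continuous Γ) (hΓb : ∀ q, π (Γ q) = b₁)
    {N : Set B} (hN : N ∈ 𝓝 b₁) (hNc : IsClosed N) {M : Set Q} (hM : IsClosed M) {g : B × Q → X}
    (hg : IsFiberwiseLift π b₁ Γ N M g) :
    ∃ N' ∈ 𝓝 b₁, IsClosed N' ∧ N' ⊆ N ∧ ∃ g' : B × Q → X,
      IsFiberwiseLift π b₁ Γ N' Set.univ g' ∧ ∀ b ∈ N', ∀ q ∈ M, g' (b, q) = g (b, q) := by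
  choose P Ξ hΞx hΞ using fun q => hsub (Γ q) (hΓb q)
  have hC : ∀ q, ∃ C ∈ 𝓝 q, IsClosed C ∧ C ⊆ Γ ⁻¹' (Ξ q).source := fun q =>
    exists_mem_nhds_isClosed_subset (hΓ.continuousAt ((Ξ q).open_source.mem_nhds (hΞx q)))
  choose C hCn hCc hCs using hC
  obtain ⟨t, -, ht⟩ := isCompact_univ.elim_nhds_subcover C fun q _ => hCn q
  have key : ∀ t : Finset Q, ∃ N' ∈ 𝓝 b₁, IsClosed N' ∧ N' ⊆ N ∧ ∃ g' : B × Q → X,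
      IsFiberwiseLift π b₁ Γ N' (M ∪ ⋃ q ∈ t, C q) g' ∧
        ∀ b ∈ N', ∀ q ∈ M, g' (b, q) = g (b, q) := by
    intro t
    classical
    induction t using Finset.induction_on with
    | empty => exact ⟨N, hN, hNc, subset_rfl, g, by simpa using hg, fun _ _ _ _ => rfl⟩
    | insert q t _ ih =>
      obtain ⟨N₁, hN₁, hN₁c, hN₁N, g₁, hg₁, hg₁g⟩ := ih
      obtain ⟨N₂, hN₂, hN₂c, hN₂N, g₂, hg₂, hg₂g⟩ := exists_fiberwiseLift_union hΓ hN₁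
        (hM.union (isClosed_biUnion_finset fun q _ => hCc q)) hg₁ (hCc q) (hΞ q) (hCs q) hΓb
      refine ⟨N₂, hN₂, hN₂c, hN₂N.trans hN₁N, g₂, ?_, fun b hb q hq => ?_⟩
      · rwa [Finset.set_biUnion_insert, Set.union_comm (C q), ← Set.union_assoc]
      · rw [hg₂g b hb q (Or.inl hq), hg₁g b (hN₂N hb) q hq]
  obtain ⟨N', h1, h2, h3, g', h4, h5⟩ := key t
  refine ⟨N', h1, h2, h3, g', ?_, h5⟩
  have : M ∪ ⋃ q ∈ t, C q = Set.univ :=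
    Set.univ_subset_iff.1 (ht.trans Set.subset_union_right)
  rwa [this] at h4

end Lift

end
end SemiTop


namespace SemiTop
noncomputable section

/-! ### Connectedness of smooth fibers in the presence of a section -/

/-- If `S` split into two open pieces, their closures would cover the space and, by the local
hypothesis, be disjoint; so one of them would be everything. -/
theorem isPreconnected_of_dense_of_local {X : Type*} [TopologicalSpace X] [PreconnectedSpace X]
    {S : Set X} (hd : Dense S) (h : ∀ x, ∃ N ∈ 𝓝 x, IsPreconnected (N ∩ S)) :
    IsPreconnected S := by
  rw [isPreconnected_iff_subset_of_disjoint]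
  intro u v hu hv huv hdis
  have hcover : closure (S ∩ u) ∪ closure (S ∩ v) = Set.univ := by
    rw [← closure_union, ← Set.inter_union_distrib_left, Set.inter_eq_left.2 huv, hd.closure_eq]
  have hdisj : Disjoint (closure (S ∩ u)) (closure (S ∩ v)) := by
    rw [Set.disjoint_left]
    intro x hxu hxv
    obtain ⟨N, hN, hNS⟩ := h x
    obtain ⟨a, haN, haS, hau⟩ := mem_closure_iff_nhds.1 hxu N hN
    obtain ⟨b, hbN, hbS, hbv⟩ := mem_closure_iff_nhds.1 hxv N hN
    rw [isPreconnected_iff_subset_of_disjoint] at hNS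
    have hsub : N ∩ S ∩ (u ∩ v) = ∅ := by
      rw [← Set.subset_empty_iff, ← hdis]
      exact fun y hy => ⟨hy.1.2, hy.2⟩
    rcases hNS u v hu hv (fun y hy => huv hy.2) hsub with h1 | h1
    · exact hdis.subset ⟨hbS, h1 ⟨hbN, hbS⟩, hbv⟩
    · exact hdis.subset ⟨haS, hau, h1 ⟨haN, haS⟩⟩
  have hcompl : (closure (S ∩ u))ᶜ = closure (S ∩ v) := by
    ext y
    constructor
    · intro hy
      exact ((Set.ext_iff.1 hcover y).2 trivial).resolve_left hy
    · intro hy hy'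
      exact Set.disjoint_left.1 hdisj hy' hy
  have hclopen : IsClopen (closure (S ∩ u)) :=
    ⟨isClosed_closure, by rw [← isClosed_compl_iff, hcompl]; exact isClosed_closure⟩
  rcases isClopen_iff.1 hclopen with h1 | h1
  · right
    intro y hy
    refine (huv hy).resolve_left fun hyu => ?_
    exact h1.subset (subset_closure ⟨hy, hyu⟩)
  · left
    intro y hy
    refine (huv hy).resolve_right fun hyv => ?_
    have h2 : closure (S ∩ v) = ∅ := by rw [← hcompl, h1, Set.compl_univ]
    exact h2.subset (subset_closure ⟨hy, hyv⟩)

/-! ### Path components of nearby smooth fibers. -/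

section Plaques

variable {B : Type} [TopologicalSpace B] {n : ℕ} {X : Type} [TopologicalSpace X] {π : X → B}

/-- In a submersion chart the fibers are slices, and a product neighborhood meets each of them in a
ball; the same neighborhood serves all nearby fibers. -/
theorem exists_nhds_joinedIn_fiber {x : X} (hx : HasSubmersionChart n π x) :
    ∃ V ∈ 𝓝 x, ∀ y ∈ V, ∀ y' ∈ V, π y' = π y → JoinedIn (π ⁻¹' {π y}) y y' := by
  obtain ⟨P, Ξ, hxs, hΞ⟩ := hx
  have htar : Ξ.target ∈ 𝓝 (Ξ x) := Ξ.open_target.mem_nhds (Ξ.map_source hxs)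
  rw [nhds_prod_eq] at htar
  obtain ⟨N, hN, M, hM, hNM⟩ := Filter.mem_prod_iff.1 htar
  obtain ⟨ε, hε, hball⟩ := Metric.mem_nhds_iff.1 hM
  have hV : ∀ᶠ y in 𝓝 x, y ∈ Ξ.source ∧ Ξ y ∈ N ×ˢ Metric.ball (Ξ x).2 ε := by
    refine Filter.Eventually.and (Ξ.open_source.mem_nhds hxs) ?_
    refine (Ξ.continuousAt hxs).eventually ?_
    have := Filter.prod_mem_prod hN (Metric.ball_mem_nhds (Ξ x).2 hε)
    rwa [← nhds_prod_eq] at this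
  refine ⟨_, hV, ?_⟩
  rintro y ⟨hy, hyN⟩ y' ⟨hy', hyN'⟩ hyy
  have hpc : IsPathConnected (Metric.ball (Ξ x).2 ε) :=
    (convex_ball (Ξ x).2 ε).isPathConnected ⟨_, Metric.mem_ball_self hε⟩
  have htgt : ∀ p ∈ Metric.ball (Ξ x).2 ε, (π y, p) ∈ Ξ.target := fun p hp =>
    hNM ⟨by rw [← hΞ y hy]; exact hyN.1, hball hp⟩
  have hcont : ContinuousOn (fun p => Ξ.symm (π y, p)) (Metric.ball (Ξ x).2 ε) :=
    Ξ.continuousOn_symm.comp (by fun_prop) htgt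
  have hval : ∀ w ∈ Ξ.source, π w = π y → Ξ.symm (π y, (Ξ w).2) = w := fun w hw hwy => by
    rw [← hwy, ← hΞ w hw, Ξ.left_inv hw]
  refine ((hpc.image' hcont).joinedIn y ⟨_, hyN.2, hval y hy rfl⟩ y'
    ⟨_, hyN'.2, hval y' hy' hyy⟩).mono ?_
  rintro _ ⟨p, hp, rfl⟩
  show π (Ξ.symm (π y, p)) = π y
  rw [← hΞ _ (Ξ.map_target (htgt p hp)), Ξ.right_inv (htgt p hp)]

variable [T2Space B] {σ : B → X}

/-- The path component `P` of x and its complement in the fiber are both closed, hence are separated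
by disjoint open sets. Nearby fibers stay in the union of these sets because π is closed, and no
path in such a fiber crosses from one to the other. -/
theorem eventually_not_joinedIn_section [T2Space X] [CompactSpace X] (hπ : Continuous π)
    (hσ : Continuous σ) (hσπ : ∀ b, π (σ b) = b) {x : X}
    (hsub : ∀ y, π y = π x → HasSubmersionChart n π y)
    (hx : ¬ JoinedIn (π ⁻¹' {π x}) (σ (π x)) x) :
    ∀ᶠ y in 𝓝 x, ¬ JoinedIn (π ⁻¹' {π y}) (σ (π y)) y := by
  set F := π ⁻¹' {π x} with hF
  have hFc : IsClosed F := isClosed_singleton.preimage hπ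
  let P : Set X := {y | JoinedIn F x y}
  have hPF : P ⊆ F := fun y hy => hy.target_mem
  have hloc : ∀ y ∈ F, ∃ V ∈ 𝓝 y, ∀ y' ∈ V, y' ∈ F → JoinedIn F y y' := fun y hy => by
    obtain ⟨V, hV, hV'⟩ := exists_nhds_joinedIn_fiber (hsub y hy)
    refine ⟨V, hV, fun y' hy' hF' => ?_⟩
    have := hV' y (mem_of_mem_nhds hV) y' hy' (hF'.trans hy.symm)
    rwa [show π y = π x from hy] at this
  have hP : IsClosed P := by
    refine isClosed_of_closure_subset fun y hy => ?_
    have hyF : y ∈ F := hFc.closure_subset_iff.2 hPF hy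
    obtain ⟨V, hV, hV'⟩ := hloc y hyF
    obtain ⟨y', hy'V, hy'P⟩ := mem_closure_iff_nhds.1 hy V hV
    exact JoinedIn.trans hy'P (hV' y' hy'V (hPF hy'P)).symm
  have hR : IsClosed (F \ P) := by
    refine isClosed_of_closure_subset fun y hy => ?_
    have hyF : y ∈ F := hFc.closure_subset_iff.2 Set.sdiff_subset hy
    obtain ⟨V, hV, hV'⟩ := hloc y hyF
    obtain ⟨y', hy'V, hy'P⟩ := mem_closure_iff_nhds.1 hy V hV
    exact ⟨hyF, fun h => hy'P.2 (JoinedIn.trans h (hV' y' hy'V hy'P.1))⟩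
  obtain ⟨O₁, O₂, hO₁, hO₂, hPO, hRO, hdis⟩ := normal_separation hP hR Set.disjoint_sdiff_right
  have hK : IsClosed (π '' (O₁ ∪ O₂)ᶜ) :=
    ((hO₁.union hO₂).isClosed_compl.isCompact.image hπ).isClosed
  have hxK : π x ∉ π '' (O₁ ∪ O₂)ᶜ := by
    rintro ⟨y, hy, hyx⟩
    by_cases h : y ∈ P
    · exact hy (Or.inl (hPO h))
    · exact hy (Or.inr (hRO ⟨hyx, h⟩))
  have e1 : ∀ᶠ y in 𝓝 x, π y ∉ π '' (O₁ ∪ O₂)ᶜ :=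
    hπ.continuousAt.eventually (hK.isOpen_compl.mem_nhds hxK)
  have hxP : x ∈ P := JoinedIn.refl rfl
  have e2 : ∀ᶠ y in 𝓝 x, y ∈ O₁ := hO₁.mem_nhds (hPO hxP)
  have e3 : ∀ᶠ y in 𝓝 x, σ (π y) ∈ O₂ := by
    refine (hσ.comp hπ).continuousAt.eventually (hO₂.mem_nhds (hRO ⟨hσπ _, fun h => ?_⟩))
    exact hx (JoinedIn.symm h)
  filter_upwards [e1, e2, e3] with y h1 h2 h3 hj
  obtain ⟨γ, hγ⟩ := hj
  have hpre : IsPreconnected (Set.range γ) := isPreconnected_range γ.continuous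
  have hsubs : Set.range γ ⊆ O₁ ∪ O₂ := by
    rintro _ ⟨t, rfl⟩
    by_contra h
    exact h1 ⟨γ t, h, hγ t⟩
  have := hpre.subset_left_of_subset_union hO₁ hO₂ hdis hsubs
    ⟨y, ⟨1, γ.target⟩, h2⟩ ⟨0, γ.source⟩
  exact Set.disjoint_left.1 hdis this h3

/-- A path in the fiber spreads to the neighboring fibers; its ends are then corrected within
plaques. -/
theorem eventually_joinedIn_section [CompactSpace B] (hπ : Continuous π) (hσ : Continuous σ)
    (hσπ : ∀ b, π (σ b) = b) {x : X} (hsub : ∀ y, π y = π x → HasSubmersionChart n π y)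
    (hx : JoinedIn (π ⁻¹' {π x}) (σ (π x)) x) :
    ∀ᶠ y in 𝓝 x, JoinedIn (π ⁻¹' {π y}) (σ (π y)) y := by
  obtain ⟨γ, hγ⟩ := hx
  obtain ⟨N, hN, -, -, g, hg, -⟩ := exists_fiberwiseLift hsub γ.continuous hγ
    Filter.univ_mem isClosed_univ (isClosed_empty (X := unitInterval)) (g := fun p => γ p.2)
    ⟨by simp, by simp, by simp⟩
  obtain ⟨V₀, hV₀, hV₀'⟩ := exists_nhds_joinedIn_fiber (hsub (σ (π x)) (hσπ _))
  obtain ⟨V₁, hV₁, hV₁'⟩ := exists_nhds_joinedIn_fiber (hsub x rfl)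
  have hgc : ∀ t : unitInterval, ContinuousAt (fun b => g (b, t)) (π x) := fun t => by
    have h1 : ContinuousAt g (π x, t) := hg.continuousOn.continuousAt
      (prod_mem_nhds hN Filter.univ_mem)
    exact ContinuousAt.comp (f := fun b => (b, t)) h1 (by fun_prop)
  have e0 : ∀ᶠ b in 𝓝 (π x), g (b, 0) ∈ V₀ :=
    (hgc 0).eventually (by
      simp only [hg.base 0 trivial, γ.source]; exact hV₀)
  have e1 : ∀ᶠ b in 𝓝 (π x), g (b, 1) ∈ V₁ :=
    (hgc 1).eventually (by
      simp only [hg.base 1 trivial, γ.target]; exact hV₁)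
  have e2 : ∀ᶠ b in 𝓝 (π x), σ b ∈ V₀ := hσ.continuousAt.eventually hV₀
  have e3 := hπ.continuousAt.eventually (e0.and (e1.and (e2.and hN)))
  filter_upwards [e3, hV₁] with y hy hyV
  obtain ⟨h0, h1, h2, h3⟩ := hy
  have hp : ∀ t, π (g (π y, t)) = π y := fun t => hg.proj _ h3 t trivial
  have j1 := hV₀' _ h2 _ h0 (by rw [hp, hσπ])
  rw [hσπ] at j1
  have j2 : JoinedIn (π ⁻¹' {π y}) (g (π y, 0)) (g (π y, 1)) :=
    ⟨⟨⟨fun t => g (π y, t), (hg.continuousOn.comp_continuous (by fun_prop)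
      fun t => ⟨h3, trivial⟩)⟩, rfl, rfl⟩, fun t => hp t⟩
  have j3 := hV₁' _ h1 _ hyV (by rw [hp])
  rw [hp] at j3
  exact (j1.trans j2).trans j3

end Plaques

/-! ### Connectedness of the union of the smooth fibers. -/

section Connected

variable {B : Type} [TopologicalSpace B] [ChartedSpace ℂ B]
    {n : ℕ} {X : Type} [TopologicalSpace X]
    [ChartedSpace (EuclideanSpace ℂ (Fin (n + 1))) X] {π : X → B}

/-- The preimage of a coordinate ball. -/
def coordBall (n : ℕ) [ChartedSpace (EuclideanSpace ℂ (Fin (n + 1))) X] (x : X) (ε : ℝ) : Set X :=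
  (chartAt (EuclideanSpace ℂ (Fin (n + 1))) x).source ∩
    chartAt (EuclideanSpace ℂ (Fin (n + 1))) x ⁻¹'
      Metric.ball (chartAt (EuclideanSpace ℂ (Fin (n + 1))) x x) ε

theorem coordBall_mem_nhds (x : X) {ε : ℝ} (hε : 0 < ε) : coordBall n x ε ∈ 𝓝 x :=
  Filter.inter_mem (chart_source_mem_nhds _ x)
    (((chartAt (EuclideanSpace ℂ (Fin (n + 1))) x).continuousAt (mem_chart_source _ x))
      (Metric.ball_mem_nhds _ hε))

theorem exists_coordBall_subset (hπ : Continuous π) (x : X) {O : Set X} (hO : O ∈ 𝓝 x) :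
    ∃ ε > 0, Metric.ball (chartAt (EuclideanSpace ℂ (Fin (n + 1))) x x) ε ⊆ localDom n π x ∧
      coordBall n x ε ⊆ O := by
  set c := chartAt (EuclideanSpace ℂ (Fin (n + 1))) x with hc
  have h1 : localDom n π x ∈ 𝓝 (c x) := (isOpen_localDom hπ x).mem_nhds (mem_localDom π x)
  have h2 : c.symm ⁻¹' O ∈ 𝓝 (c x) :=
    c.continuousAt_symm (mem_chart_target _ _) (by rwa [c.left_inv (mem_chart_source _ x)])
  obtain ⟨ε, hε, hb⟩ := Metric.mem_nhds_iff.1 (Filter.inter_mem h1 h2)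
  refine ⟨ε, hε, fun u hu => (hb hu).1, fun y hy => ?_⟩
  have := (hb hy.2).2
  rwa [Set.mem_preimage, c.left_inv hy.1] at this

variable [IsManifold 𝓘(ℂ) ω B] [IsManifold 𝓘(ℂ, EuclideanSpace ℂ (Fin (n + 1))) ω X]

/-- If `π` is not locally constant, then the fibers over a cocountable set are dense. -/
theorem dense_preimage_of_countable [PreconnectedSpace X]
    (hπ : ContMDiff 𝓘(ℂ, EuclideanSpace ℂ (Fin (n + 1))) 𝓘(ℂ) ω π) {D : Set B} (hD : D.Countable)
    {x₀ : X} (hx₀ : ¬ ∀ᶠ y in 𝓝 x₀, π y = π x₀) : Dense (π ⁻¹' Dᶜ) := by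
  -- The set of points where π is locally constant is open and, by the identity theorem on
  -- coordinate balls, closed; so it is empty.
  let L : Set X := {x | ∀ᶠ y in 𝓝 x, π y = π x}
  have hconst : ∀ (x : X) (ε : ℝ), 0 < ε →
      Metric.ball (chartAt (EuclideanSpace ℂ (Fin (n + 1))) x x) ε ⊆ localDom n π x →
      (∃ a, ∀ u ∈ Metric.ball (chartAt (EuclideanSpace ℂ (Fin (n + 1))) x x) ε,
        localExpr n π x u = a) → ∀ᶠ y in 𝓝 x, π y = π x := by
    rintro x ε hε hb ⟨a, ha⟩
    filter_upwards [coordBall_mem_nhds (n := n) x hε] with y hy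
    have h1 := ha _ hy.2
    have h2 := ha _ (Metric.mem_ball_self hε)
    have h3 := (hb hy.2).2
    rw [localExpr, OpenPartialHomeomorph.left_inv _ hy.1] at h1
    rw [localExpr, OpenPartialHomeomorph.left_inv _ (mem_chart_source _ x)] at h2
    rw [Set.mem_preimage, OpenPartialHomeomorph.left_inv _ hy.1] at h3
    exact (chartAt ℂ (π x)).injOn h3 (mem_chart_source _ _) (h1.trans h2.symm)
  have hLo : IsOpen L := isOpen_iff_mem_nhds.2 fun x hx => by
    filter_upwards [eventually_eventually_nhds.2 hx, hx] with y hy hyx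
    exact hy.mono fun w hw => hw.trans hyx.symm
  have hLc : IsClosed L := by
    refine isClosed_of_closure_subset fun x hx => ?_
    obtain ⟨ε, hε, hb, -⟩ := exists_coordBall_subset (n := n) hπ.continuous x Filter.univ_mem
    obtain ⟨y, hy, hyL⟩ := mem_closure_iff_nhds.1 hx _ (coordBall_mem_nhds (n := n) x hε)
    set c := chartAt (EuclideanSpace ℂ (Fin (n + 1))) x with hc
    refine hconst x ε hε hb ⟨localExpr n π x (c y), ?_⟩
    refine ((analyticOnNhd_localExpr hπ x).mono hb).eqOn_of_preconnected_of_eventuallyEq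
      analyticOnNhd_const (convex_ball _ _).isPreconnected hy.2 ?_
    have h1 : ∀ᶠ u in 𝓝 (c y), π (c.symm u) = π y := by
      have := c.continuousAt_symm (c.map_source hy.1)
      rw [ContinuousAt, c.left_inv hy.1] at this
      exact this.eventually hyL
    refine h1.mono fun u hu => ?_
    simp only [localExpr]
    rw [hu, c.left_inv hy.1]
  have hLempty : L = ∅ := by
    refine (isClopen_iff.1 ⟨hLc, hLo⟩).resolve_right fun h => hx₀ ?_
    have : x₀ ∈ L := by rw [h]; trivial
    exact this
  intro x
  by_contra hx
  rw [mem_closure_iff_nhds] at hx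
  push Not at hx
  obtain ⟨O, hO, hOD⟩ := hx
  obtain ⟨ε, hε, hb, hbO⟩ := exists_coordBall_subset (n := n) hπ.continuous x hO
  set c := chartAt (EuclideanSpace ℂ (Fin (n + 1))) x with hc
  -- A connected ball mapped into a countable subset of the plane has a single image point, which
  -- would put x in `L`.
  have himg : localExpr n π x '' Metric.ball (c x) ε ⊆ chartAt ℂ (π x) '' D := by
    rintro _ ⟨u, hu, rfl⟩
    have hut := (hb hu).1
    refine ⟨π (c.symm u), ?_, rfl⟩
    by_contra hn
    have : c.symm u ∈ O ∩ π ⁻¹' Dᶜ :=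
      ⟨hbO ⟨c.map_target hut, by rw [Set.mem_preimage, ← hc, c.right_inv hut]; exact hu⟩, hn⟩
    rw [hOD] at this
    exact this
  have hsub := (hD.image (chartAt ℂ (π x))).isTotallyDisconnected _ himg
    ((convex_ball (c x) ε).isPreconnected.image _
      ((analyticOnNhd_localExpr hπ x).mono hb).continuousOn)
  have hxL : x ∈ L := hconst x ε hε hb ⟨localExpr n π x (c x), fun u hu =>
    hsub ⟨u, hu, rfl⟩ ⟨_, Metric.mem_ball_self hε, rfl⟩⟩
  rw [hLempty] at hxL
  exact hxL

/-- Two points of the ball span a complex line. On it the parameters lying over `D` are countable,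
and they can be avoided by a path. -/
theorem isPreconnected_coordBall_inter
    (hπ : ContMDiff 𝓘(ℂ, EuclideanSpace ℂ (Fin (n + 1))) 𝓘(ℂ) ω π) {D : Set B} (hD : D.Countable)
    (x : X) {ε : ℝ}
    (hb : Metric.ball (chartAt (EuclideanSpace ℂ (Fin (n + 1))) x x) ε ⊆ localDom n π x) :
    IsPreconnected (coordBall n x ε ∩ π ⁻¹' Dᶜ) := by
  set c := chartAt (EuclideanSpace ℂ (Fin (n + 1))) x with hc
  set z := chartAt ℂ (π x) with hz
  refine isPreconnected_of_forall_pair fun p ⟨hp, hpD⟩ q ⟨hq, hqD⟩ => ?_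
  set v := c q - c p with hv
  set Ω : Set ℂ := {t | c p + t • v ∈ Metric.ball (c x) ε} with hΩ
  have hline : Continuous fun t : ℂ => c p + t • v := by fun_prop
  have hΩo : IsOpen Ω := Metric.isOpen_ball.preimage hline
  have hΩc : Convex ℝ Ω := by
    intro s hs t ht a b ha hb hab
    have := convex_ball (c x) ε hs ht ha hb hab
    rw [hΩ, Set.mem_ofPred_eq]
    convert this using 1
    have hb' : b = 1 - a := by linarith
    subst hb'
    rw [smul_add, smul_add, ← smul_assoc, ← smul_assoc, add_smul]
    module
  have h0 : (0 : ℂ) ∈ Ω := by simpa [hΩ] using Metric.mem_ball.1 hp.2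
  have h1 : (1 : ℂ) ∈ Ω := by
    have : c p + (1 : ℂ) • v = c q := by rw [hv, one_smul]; abel
    rw [hΩ, Set.mem_ofPred_eq, this]
    exact hq.2
  let D' : Set ℂ := z '' (D ∩ z.source)
  have hD' : D'.Countable := (hD.mono Set.inter_subset_left).image _
  let u : ℂ → ℂ := fun t => localExpr n π x (c p + t • v)
  have hu : AnalyticOnNhd ℂ u Ω :=
    analyticOnNhd_line ((analyticOnNhd_localExpr hπ x).mono hb) (c p) v
  have hgood : ∀ y ∈ coordBall n x ε, (localExpr n π x (c y) ∈ D' ↔ π y ∈ D) := by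
    intro y hy
    have hys : π y ∈ z.source := by
      have := (hb hy.2).2
      rwa [Set.mem_preimage, Set.mem_preimage, c.left_inv hy.1] at this
    have : localExpr n π x (c y) = z (π y) := by rw [localExpr, c.left_inv hy.1]
    rw [this]
    constructor
    · rintro ⟨b, ⟨hbD, hbs⟩, hbz⟩
      rwa [← z.injOn hbs hys hbz]
    · exact fun h => ⟨_, ⟨h, hys⟩, rfl⟩
  have hcs : ∀ t ∈ Ω, c.symm (c p + t • v) ∈ coordBall n x ε := fun t ht =>
    ⟨c.map_target (hb ht).1, by
      rw [Set.mem_preimage, ← hc, c.right_inv (hb ht).1]; exact ht⟩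
  have hu0 : u 0 ∉ D' := by
    simp only [u, zero_smul, add_zero]
    rw [hgood p hp]; exact hpD
  have hu1 : u 1 ∉ D' := by
    have : c p + (1 : ℂ) • v = c q := by rw [hv, one_smul]; abel
    simp only [u, this]
    rw [hgood q hq]; exact hqD
  have hcount := countable_preimage_of_analytic hΩc.isPreconnected hu hD' h0 hu0
  obtain ⟨γ, hγ⟩ := joinedIn_diff_countable hΩo hΩc hcount h0 h1 (fun h => hu0 h.2)
    (fun h => hu1 h.2)
  refine ⟨Set.range fun s => c.symm (c p + γ s • v), ?_, ⟨0, ?_⟩, ⟨1, ?_⟩, ?_⟩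
  · rintro _ ⟨s, rfl⟩
    have hs := hγ s
    have hm := hcs _ hs.1
    refine ⟨hm, fun hbad => hs.2 ⟨hs.1, ?_⟩⟩
    have := (hgood _ hm).2 hbad
    rwa [c.right_inv (hb hs.1).1] at this
  · simp [c.left_inv hp.1]
  · simp [hv, c.left_inv hq.1]
  · refine isPreconnected_range ?_
    exact c.continuousOn_symm.comp_continuous (hline.comp γ.continuous) fun s => (hb (hγ s).1).1

/-- If `π` has a continuous section then its smooth fibers are path connected. -/
theorem joinedIn_smoothFiber [T2Space B] [CompactSpace B] [T2Space X] [CompactSpace X]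
    [PreconnectedSpace X]
    (hπ : ContMDiff 𝓘(ℂ, EuclideanSpace ℂ (Fin (n + 1))) 𝓘(ℂ) ω π)
    {σ : B → X} (hσ : Continuous σ) (hσπ : ∀ b, π (σ b) = b) {b₀ : B}
    (hb₀ : SmoothFiber n π b₀) {x : X} (hx : π x = b₀) :
    JoinedIn (π ⁻¹' {b₀}) (σ b₀) x := by
  have hD := countable_singularValues hπ
  have hne : ¬ ∀ᶠ y in 𝓝 x, π y = π x := by
    intro hev
    have h1 : mfderiv 𝓘(ℂ, EuclideanSpace ℂ (Fin (n + 1))) 𝓘(ℂ) π x = 0 := by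
      have := Filter.EventuallyEq.mfderiv_eq (I := 𝓘(ℂ, EuclideanSpace ℂ (Fin (n + 1))))
        (I' := 𝓘(ℂ)) (f₁ := π) (f := fun _ => π x) hev
      rw [this]
      exact mfderiv_const
    obtain ⟨v, hv⟩ := hb₀ x hx (show ℂ from 1)
    rw [h1] at hv
    exact zero_ne_one (α := ℂ) hv
  set S := π ⁻¹' {b | ¬ SmoothFiber n π b}ᶜ with hS
  have hpre : IsPreconnected S := by
    refine isPreconnected_of_dense_of_local (dense_preimage_of_countable hπ hD hne) fun y => ?_
    obtain ⟨ε, hε, hb, -⟩ := exists_coordBall_subset (n := n) hπ.continuous y Filter.univ_mem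
    exact ⟨_, coordBall_mem_nhds y hε, isPreconnected_coordBall_inter hπ hD y hb⟩
  have hmemS : ∀ {y}, y ∈ S ↔ SmoothFiber n π (π y) := fun {y} => by simp [hS]
  have hsub : ∀ y ∈ S, ∀ w, π w = π y → HasSubmersionChart n π w := fun y hy w hw =>
    hasSubmersionChart hπ w (hmemS.1 hy w hw)
  -- Smooth fibers consist of submersion points, so the interiors of the joined and of the
  -- non-joined points cover the connected set `S`; the section itself lies in `A`.
  let A : Set X := {y | ∀ᶠ w in 𝓝 y, JoinedIn (π ⁻¹' {π w}) (σ (π w)) w}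
  let A' : Set X := {y | ∀ᶠ w in 𝓝 y, ¬ JoinedIn (π ⁻¹' {π w}) (σ (π w)) w}
  have hAo : IsOpen A := isOpen_iff_mem_nhds.2 fun y hy => eventually_eventually_nhds.2 hy
  have hAo' : IsOpen A' := isOpen_iff_mem_nhds.2 fun y hy => eventually_eventually_nhds.2 hy
  have hcov : S ⊆ A ∪ A' := fun y hy => by
    by_cases h : JoinedIn (π ⁻¹' {π y}) (σ (π y)) y
    · exact Or.inl (eventually_joinedIn_section hπ.continuous hσ hσπ (hsub y hy) h)
    · exact Or.inr (eventually_not_joinedIn_section hπ.continuous hσ hσπ (hsub y hy) h)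
  have hdis : Disjoint A A' := Set.disjoint_left.2 fun y hy hy' =>
    (show ∀ᶠ w in 𝓝 y, ¬ JoinedIn (π ⁻¹' {π w}) (σ (π w)) w from hy').self_of_nhds
      (show ∀ᶠ w in 𝓝 y, JoinedIn (π ⁻¹' {π w}) (σ (π w)) w from hy).self_of_nhds
  have hσS : σ b₀ ∈ S := hmemS.2 (by rw [hσπ]; exact hb₀)
  have hσA : σ b₀ ∈ A := by
    refine eventually_joinedIn_section hπ.continuous hσ hσπ (hsub _ hσS) ?_
    rw [hσπ]
    exact JoinedIn.refl (hσπ b₀)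
  have hSA := hpre.subset_left_of_subset_union hAo hAo' hdis hcov ⟨_, hσS, hσA⟩
  have hxA := hSA (hmemS.2 (by rw [hx]; exact hb₀))
  have := (show ∀ᶠ w in 𝓝 x, JoinedIn (π ⁻¹' {π w}) (σ (π w)) w from hxA).self_of_nhds
  rwa [hx] at this

end Connected

end
end SemiTop


namespace SemiTop
noncomputable section

/-! ### Jets in coordinates -/

section JetCoordinates

variable {B X : Type} [TopologicalSpace B] [ChartedSpace ℂ B] [TopologicalSpace X] {n : ℕ}
  [ChartedSpace (EuclideanSpace ℂ (Fin (n + 1))) X] {π : X → B} {K : Type}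

theorem euclidean_norm_le_of_forall {m : ℕ} {v : EuclideanSpace ℂ (Fin m)} {C : ℝ}
    (h : ∀ i, ‖v i‖ ≤ C) : ‖v‖ ≤ m * C := by
  have h1 : v = ∑ i, EuclideanSpace.single i (v i) := by
    ext k
    simp [Finset.sum_apply]
  calc ‖v‖ = ‖∑ i, EuclideanSpace.single i (v i)‖ := by rw [← h1]
    _ ≤ ∑ i, ‖EuclideanSpace.single i (v i)‖ := norm_sum_le _ _
    _ ≤ ∑ _i : Fin m, C := Finset.sum_le_sum fun i _ => by simpa using h i
    _ = m * C := by simp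

theorem FiberCoordinates.tendsto_z {b : B} {x : X} (φ : FiberCoordinates n π b x) :
    Filter.Tendsto φ.z (𝓝 b) (𝓝 0) := by
  have := φ.z.continuousAt φ.base_mem
  rwa [ContinuousAt, φ.z_base] at this

/-- In the coordinates `φ`, the family `s` agrees with the local section of `j` up to
`o(|z| ^ N)`, uniformly in the parameter. -/
def AdmissibleJet.IsClose (j : AdmissibleJet n π)
    (φ : FiberCoordinates n π j.base (j.sec j.base)) (s : K → B → X) : Prop :=
  ∀ ε > (0 : ℝ), ∀ᶠ b in 𝓝 j.base, ∀ ξ, s ξ b ∈ φ.w.source ∧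
    ‖φ.w (s ξ b) - φ.w (j.sec b)‖ ≤ ε * ‖φ.z b‖ ^ j.order

theorem AdmissibleJet.eventually_sec_mem (j : AdmissibleJet n π)
    (φ : FiberCoordinates n π j.base (j.sec j.base)) :
    ∀ᶠ b in 𝓝 j.base, j.sec b ∈ φ.w.source :=
  j.analytic.continuousAt.eventually (φ.w.open_source.mem_nhds φ.point_mem)

theorem AdmissibleJet.IsGivenBy.eventually_norm_le {j : AdmissibleJet n π}
    {φ : FiberCoordinates n π j.base (j.sec j.base)} {ρ : Fin n → ℂ[X]} (h : j.IsGivenBy φ ρ)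
    (i : Fin n) {ε : ℝ} (hε : 0 < ε) :
    ∀ᶠ b in 𝓝 j.base,
      ‖φ.w (j.sec b) i.succ - (ρ i).eval (φ.z b)‖ ≤ ε * ‖φ.z b‖ ^ j.order := by
  obtain ⟨C, hC, hb⟩ := (h i).2.exists_pos
  have h1 : ∀ᶠ b in 𝓝 j.base, ‖φ.z b‖ < ε / C :=
    φ.tendsto_z.norm.eventually_lt_const (by rw [norm_zero]; positivity)
  filter_upwards [hb.bound, h1] with b hb hz
  refine hb.trans ?_
  rw [norm_pow, pow_succ, mul_comm (‖φ.z b‖ ^ _), ← mul_assoc]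
  gcongr
  rw [mul_comm]
  exact ((lt_div_iff₀ hC).1 hz).le

/-- Replacing the polynomials by the local section costs a second error of the same order, and the
zeroth coordinates agree because both sides are sections. -/
theorem Induces.exists_isClose {s : K → B → X} {j : AdmissibleJet n π}
    (hs : ∀ ξ b, π (s ξ b) = b) (h : Induces s j) :
    ∃ φ : FiberCoordinates n π j.base (j.sec j.base), j.IsClose φ s := by
  obtain ⟨φ, ρ, hρ, U, hUo, hbU, -, hU, hsmall⟩ := h
  refine ⟨φ, fun ε hε => ?_⟩
  -- Each coordinate carries two errors ε', and `euclidean_norm_le_of_forall` costs the factor n +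
  -- 1.
  set ε' : ℝ := ε / (2 * (n + 1)) with hε'
  have hε'0 : 0 < ε' := by positivity
  have h1 : ∀ᶠ b in 𝓝 j.base, ∀ i, ∀ ξ,
      ‖φ.w (s ξ b) i.succ - (ρ i).eval (φ.z b)‖ ≤ ε' * ‖φ.z b‖ ^ j.order :=
    Filter.eventually_all.2 fun i => hsmall i ε' hε'0
  have h2 : ∀ᶠ b in 𝓝 j.base, ∀ i,
      ‖φ.w (j.sec b) i.succ - (ρ i).eval (φ.z b)‖ ≤ ε' * ‖φ.z b‖ ^ j.order :=
    Filter.eventually_all.2 fun i => hρ.eventually_norm_le i hε'0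
  filter_upwards [h1, h2, hUo.mem_nhds hbU, j.eventually_sec_mem φ, j.is_section]
    with b hb1 hb2 hbU hsec hπsec ξ
  refine ⟨hU ξ b hbU, ?_⟩
  have h3 : ∀ i, ‖(φ.w (s ξ b) - φ.w (j.sec b)) i‖ ≤ 2 * ε' * ‖φ.z b‖ ^ j.order := by
    intro i
    refine Fin.cases ?_ (fun i => ?_) i
    · rw [PiLp.sub_apply, φ.w_zero _ (hU ξ b hbU), φ.w_zero _ hsec, hs, hπsec, sub_self, norm_zero]
      positivity
    · rw [PiLp.sub_apply, ← sub_sub_sub_cancel_right _ _ ((ρ i).eval (φ.z b))]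
      refine (norm_sub_le _ _).trans ?_
      linarith [hb1 i ξ, hb2 i]
  refine (euclidean_norm_le_of_forall h3).trans (le_of_eq ?_)
  rw [hε']
  push_cast
  field_simp

theorem AdmissibleJet.IsClose.induces {s : K → B → X} {j : AdmissibleJet n π}
    {φ : FiberCoordinates n π j.base (j.sec j.base)} {ρ : Fin n → ℂ[X]} (hρ : j.IsGivenBy φ ρ)
    (h : j.IsClose φ s) : Induces s j := by
  have h0 : ∀ᶠ b in 𝓝 j.base, b ∈ φ.z.source ∧ ∀ ξ, s ξ b ∈ φ.w.source := by
    filter_upwards [h 1 one_pos, φ.z.open_source.mem_nhds φ.base_mem] with b hb hz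
    exact ⟨hz, fun ξ => (hb ξ).1⟩
  obtain ⟨U, hU, hUo, hbU⟩ := eventually_nhds_iff.1 h0
  refine ⟨φ, ρ, hρ, U, hUo, hbU, fun b hb => (hU b hb).1, fun ξ b hb => (hU b hb).2 ξ, ?_⟩
  intro i ε hε
  filter_upwards [h (ε / 2) (half_pos hε), hρ.eventually_norm_le i (half_pos hε)] with b hb1 hb2 ξ
  have h3 := (PiLp.norm_apply_le (φ.w (s ξ b) - φ.w (j.sec b)) i.succ).trans (hb1 ξ).2
  rw [PiLp.sub_apply] at h3
  rw [← sub_add_sub_cancel _ (φ.w (j.sec b) i.succ)]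
  refine (norm_add_le _ _).trans ?_
  linarith

theorem contDiffAt_transition {E M : Type*} [NormedAddCommGroup E] [NormedSpace ℂ E]
    [TopologicalSpace M] [ChartedSpace E M] {e e' : OpenPartialHomeomorph M E}
    [IsManifold 𝓘(ℂ, E) ω M]
    (he : e ∈ IsManifold.maximalAtlas 𝓘(ℂ, E) ω M)
    (he' : e' ∈ IsManifold.maximalAtlas 𝓘(ℂ, E) ω M) {x : M} (hx : x ∈ e.source)
    (hx' : x ∈ e'.source) : ContDiffAt ℂ 1 (e' ∘ e.symm) (e x) := by
  have h1 : ContMDiffAt 𝓘(ℂ, E) 𝓘(ℂ, E) ω e.symm (e x) :=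
    (contMDiffOn_symm_of_mem_maximalAtlas he).contMDiffAt
      (e.open_target.mem_nhds (e.map_source hx))
  have h2 : ContMDiffAt 𝓘(ℂ, E) 𝓘(ℂ, E) ω e' (e.symm (e x)) := by
    rw [e.left_inv hx]
    exact (contMDiffOn_of_mem_maximalAtlas he').contMDiffAt (e'.open_source.mem_nhds hx')
  exact ((h2.comp (e x) h1).contDiffAt).of_le le_top

theorem exists_lipschitz_transition {E M : Type*} [NormedAddCommGroup E] [NormedSpace ℂ E]
    [TopologicalSpace M] [ChartedSpace E M] [IsManifold 𝓘(ℂ, E) ω M]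
    {e e' : OpenPartialHomeomorph M E}
    (he : e ∈ IsManifold.maximalAtlas 𝓘(ℂ, E) ω M)
    (he' : e' ∈ IsManifold.maximalAtlas 𝓘(ℂ, E) ω M) {x : M} (hx : x ∈ e.source)
    (hx' : x ∈ e'.source) :
    ∃ C > (0 : ℝ), ∃ t ∈ 𝓝 (e x), ∀ y ∈ e.source, ∀ y' ∈ e.source, e y ∈ t → e y' ∈ t →
      y ∈ e'.source ∧ ‖e' y - e' y'‖ ≤ C * ‖e y - e y'‖ := by
  obtain ⟨C, t, ht, hL⟩ := (contDiffAt_transition he he' hx hx').exists_lipschitzOnWith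
  have h1 : e.symm ⁻¹' e'.source ∈ 𝓝 (e x) := by
    refine (e.continuousAt_symm (e.map_source hx)).preimage_mem_nhds ?_
    rw [e.left_inv hx]
    exact e'.open_source.mem_nhds hx'
  refine ⟨C + 1, by positivity, t ∩ e.symm ⁻¹' e'.source, Filter.inter_mem ht h1, ?_⟩
  intro y hy y' hy' hyt hyt'
  have h2 := hyt.2
  rw [Set.mem_preimage, e.left_inv hy] at h2
  refine ⟨h2, ?_⟩
  have h3 := hL.norm_sub_le hyt.1 hyt'.1
  simp only [Function.comp_apply, e.left_inv hy, e.left_inv hy'] at h3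
  exact h3.trans (by gcongr; linarith)

/-- Coordinate changes are locally Lipschitz, upstairs for the fiber coordinates and downstairs for
comparing the powers of |z|. This makes the choice of coordinates in `Induces` harmless. -/
theorem AdmissibleJet.IsClose.congr_coordinates [IsManifold 𝓘(ℂ) ω B]
    [IsManifold 𝓘(ℂ, EuclideanSpace ℂ (Fin (n + 1))) ω X] {s : K → B → X}
    {j : AdmissibleJet n π} {φ φ' : FiberCoordinates n π j.base (j.sec j.base)}
    (h : j.IsClose φ s) : j.IsClose φ' s := by
  obtain ⟨C, hC, t, ht, hL⟩ := exists_lipschitz_transition φ.w_mem φ'.w_mem φ.point_mem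
    φ'.point_mem
  obtain ⟨C', hC', t', ht', hL'⟩ := exists_lipschitz_transition φ'.z_mem φ.z_mem φ'.base_mem
    φ.base_mem
  intro ε hε
  have h1 : ∀ᶠ b in 𝓝 j.base, ‖φ.z b‖ ≤ C' * ‖φ'.z b‖ := by
    filter_upwards [φ'.z.continuousAt φ'.base_mem ht', φ'.z.open_source.mem_nhds φ'.base_mem]
      with b hb hbs
    have := (hL' b hbs j.base φ'.base_mem hb (mem_of_mem_nhds ht')).2
    simpa [φ.z_base, φ'.z_base] using this
  obtain ⟨η, hη, hball⟩ := Metric.mem_nhds_iff.1 ht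
  have h2 : ∀ᶠ b in 𝓝 j.base, φ.w (j.sec b) ∈ Metric.ball (φ.w (j.sec j.base)) (η / 2) :=
    (ContinuousAt.comp (f := j.sec) (x := j.base) (φ.w.continuousAt φ.point_mem)
      j.analytic.continuousAt) (Metric.ball_mem_nhds _ (half_pos hη))
  have h3 : ∀ᶠ b in 𝓝 j.base, ‖φ.z b‖ < 1 :=
    φ.tendsto_z.norm.eventually_lt_const (by simp)
  -- The bound η / 4, with |z| < 1, keeps the family in the ball of radius η where the Lipschitz
  -- estimate holds; the first entry gives the desired constant.
  set ε' : ℝ := min (ε / (C * C' ^ j.order)) (η / 4) with hε'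
  have hε'0 : 0 < ε' := lt_min (by positivity) (by positivity)
  filter_upwards [h ε' hε'0, h1, h2, h3, j.eventually_sec_mem φ] with b hb hz hsec hz1 hsecm ξ
  obtain ⟨hm, hle⟩ := hb ξ
  have h4 : ‖φ.w (s ξ b) - φ.w (j.sec b)‖ ≤ η / 4 := by
    refine hle.trans ?_
    calc ε' * ‖φ.z b‖ ^ j.order ≤ ε' * 1 := by
          gcongr
          exact pow_le_one₀ (norm_nonneg _) hz1.le
      _ ≤ η / 4 := by rw [mul_one]; exact min_le_right _ _
  have h5 : φ.w (j.sec b) ∈ t := hball (Metric.ball_subset_ball (half_le_self hη.le) hsec)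
  have h6 : φ.w (s ξ b) ∈ t := by
    refine hball ?_
    rw [mem_ball_iff_norm] at hsec ⊢
    rw [← sub_add_sub_cancel _ (φ.w (j.sec b))]
    refine (norm_add_le _ _).trans_lt ?_
    linarith
  obtain ⟨h7, h8⟩ := hL _ hm _ hsecm h6 h5
  refine ⟨h7, h8.trans ?_⟩
  calc C * ‖φ.w (s ξ b) - φ.w (j.sec b)‖ ≤ C * (ε' * ‖φ.z b‖ ^ j.order) := by gcongr
    _ ≤ C * (ε / (C * C' ^ j.order) * (C' * ‖φ'.z b‖) ^ j.order) := by
        gcongr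
        exact min_le_left _ _
    _ = ε * ‖φ'.z b‖ ^ j.order := by
        rw [mul_pow]
        field_simp

theorem induces_iff_isClose [IsManifold 𝓘(ℂ) ω B]
    [IsManifold 𝓘(ℂ, EuclideanSpace ℂ (Fin (n + 1))) ω X] {s : K → B → X}
    {j : AdmissibleJet n π} {φ : FiberCoordinates n π j.base (j.sec j.base)} {ρ : Fin n → ℂ[X]}
    (hρ : j.IsGivenBy φ ρ) (hs : ∀ ξ b, π (s ξ b) = b) : Induces s j ↔ j.IsClose φ s := by
  refine ⟨fun h => ?_, fun h => h.induces hρ⟩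
  obtain ⟨φ', h'⟩ := h.exists_isClose hs
  exact h'.congr_coordinates

/-- Whether a family induces a jet depends only on the germ of the family near the base point,
and is inherited by reparametrized families. -/
theorem Induces.congr {L : Type} {s : K → B → X} {s' : L → B → X} {j : AdmissibleJet n π}
    (h : Induces s j) (θ : L → K) (hss' : ∀ᶠ b in 𝓝 j.base, ∀ l, s' l b = s (θ l) b) :
    Induces s' j := by
  obtain ⟨φ, ρ, hρ, U, hUo, hbU, hUz, hU, hsmall⟩ := h
  obtain ⟨U', hU', hUo', hbU'⟩ := eventually_nhds_iff.1 hss'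
  refine ⟨φ, ρ, hρ, U ∩ U', hUo.inter hUo', ⟨hbU, hbU'⟩, fun b hb => hUz hb.1,
    fun l b hb => ?_, fun i ε hε => ?_⟩
  · rw [hU' b hb.2 l]
    exact hU _ b hb.1
  · filter_upwards [hsmall i ε hε, hss'] with b hb hb' l
    rw [hb' l]
    exact hb _

end JetCoordinates

end
end SemiTop


namespace SemiTop
noncomputable section

/-! ### Tubular coordinates along a local section -/

section Tubes

variable {B X : Type} [TopologicalSpace B] [TopologicalSpace X]

/-- A closed coordinate disc around `b₀` together with a trivialization `x ↦ (π x, V x)` of `π` near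
a local section `b ↦ Θ (b, 0)` over this disc, with inverse `Θ`. -/
structure Tube (π : X → B) (b₀ : B) (E : Type) [NormedAddCommGroup E] [NormedSpace ℝ E] where
  z : OpenPartialHomeomorph B ℂ
  δ : ℝ
  δ_pos : 0 < δ
  closedBall_subset : Metric.closedBall 0 δ ⊆ z.target
  base_mem : b₀ ∈ z.source
  z_base : z b₀ = 0
  W : Set X
  isOpen_W : IsOpen W
  dom : Set E
  zero_mem : (0 : E) ∈ dom
  smul_mem : ∀ v ∈ dom, ∀ t ∈ Set.Icc (0 : ℝ) 1, t • v ∈ dom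
  V : X → E
  continuousOn_V : ContinuousOn V W
  V_mem : ∀ x ∈ W, V x ∈ dom
  Θ : B × E → X
  continuousOn_Θ : ContinuousOn Θ ((z.source ∩ z ⁻¹' Metric.closedBall 0 δ) ×ˢ dom)
  proj_Θ : ∀ b ∈ z.source ∩ z ⁻¹' Metric.closedBall 0 δ, ∀ v ∈ dom, π (Θ (b, v)) = b
  Θ_mem : ∀ b ∈ z.source ∩ z ⁻¹' Metric.closedBall 0 δ, ∀ v ∈ dom, Θ (b, v) ∈ W
  V_Θ : ∀ b ∈ z.source ∩ z ⁻¹' Metric.closedBall 0 δ, ∀ v ∈ dom, V (Θ (b, v)) = v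
  Θ_V : ∀ x ∈ W, π x ∈ z.source ∩ z ⁻¹' Metric.closedBall 0 δ → Θ (π x, V x) = x

namespace Tube

variable {π : X → B} {b₀ : B} {E : Type} [NormedAddCommGroup E] [NormedSpace ℝ E]
  (T : Tube π b₀ E)

/-- The closed coordinate disc. -/
def disc : Set B := T.z.source ∩ T.z ⁻¹' Metric.closedBall 0 T.δ

/-- The local section along which the tube is centered. -/
def e (b : B) : X := T.Θ (b, 0)

open Classical in
/-- The distance from `b₀` in the coordinate disc, constant outside it. -/
def ζ (b : B) : ℝ := if b ∈ T.z.source then min ‖T.z b‖ T.δ else T.δ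

/-- The direction of `z b`. -/
def u (b : B) : ℂ := T.z b / ‖T.z b‖

theorem ζ_nonneg (b : B) : 0 ≤ T.ζ b := by
  unfold ζ
  split_ifs
  · exact le_min (norm_nonneg _) T.δ_pos.le
  · exact T.δ_pos.le

theorem mem_disc_of_lt {b : B} (h : T.ζ b < T.δ) : b ∈ T.disc ∧ T.ζ b = ‖T.z b‖ := by
  unfold ζ at h ⊢
  split_ifs at h ⊢ with hb
  · have h1 : ‖T.z b‖ < T.δ := by
      by_contra hcon
      rw [min_eq_right (not_lt.1 hcon)] at h
      exact lt_irrefl _ h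
    exact ⟨⟨hb, by simpa using h1.le⟩, min_eq_left h1.le⟩
  · exact absurd h (lt_irrefl _)

theorem ζ_of_notMem {b : B} (h : b ∉ T.disc) : T.ζ b = T.δ := by
  by_contra hcon
  unfold ζ at hcon
  split_ifs at hcon with hb
  · refine h ⟨hb, ?_⟩
    by_contra h1
    simp only [Set.mem_preimage, mem_closedBall_zero_iff, not_le] at h1
    exact hcon (min_eq_right h1.le)
  · exact hcon rfl

@[simp]
theorem ζ_base : T.ζ b₀ = 0 := by
  simp [ζ, T.base_mem, T.z_base, T.δ_pos.le]

theorem eq_base_of_ζ {b : B} (h : T.ζ b = 0) : b = b₀ := by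
  obtain ⟨h1, h2⟩ := T.mem_disc_of_lt (h.trans_lt T.δ_pos)
  refine T.z.injOn h1.1 T.base_mem ?_
  rw [T.z_base, ← norm_eq_zero, ← h2, h]

theorem isCompact_disc : IsCompact T.disc := by
  have h := ((ProperSpace.isCompact_closedBall (0 : ℂ) T.δ).image_of_continuousOn
    (T.z.continuousOn_symm.mono T.closedBall_subset))
  rwa [T.z.symm_image_eq_source_inter_preimage T.closedBall_subset] at h

/-- The disc is compact, hence closed, so `ζ` is constant near every point outside the chart. -/
theorem continuous_ζ [T2Space B] : Continuous T.ζ := by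
  rw [continuous_iff_continuousAt]
  intro b
  by_cases hb : b ∈ T.z.source
  · have h1 : ContinuousAt (fun b => min ‖T.z b‖ T.δ) b :=
      (T.z.continuousAt hb).norm.min continuousAt_const
    refine h1.congr ?_
    filter_upwards [T.z.open_source.mem_nhds hb] with b' hb'
    simp [ζ, hb']
  · have h1 : T.discᶜ ∈ 𝓝 b :=
      T.isCompact_disc.isClosed.isOpen_compl.mem_nhds fun h => hb h.1
    refine (continuousAt_const (y := T.δ)).congr ?_
    filter_upwards [h1] with b' hb'
    exact (T.ζ_of_notMem hb').symm

theorem norm_u {b : B} (h : 0 < T.ζ b) (h' : T.ζ b < T.δ) : ‖T.u b‖ = 1 := by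
  rw [(T.mem_disc_of_lt h').2] at h
  simp [u, div_self h.ne']

theorem continuousOn_u : ContinuousOn T.u {b | 0 < T.ζ b ∧ T.ζ b < T.δ} := by
  intro b hb
  obtain ⟨h1, h2⟩ := T.mem_disc_of_lt hb.2
  have h3 := T.z.continuousAt h1.1
  refine (h3.div (Complex.continuous_ofReal.continuousAt.comp h3.norm) ?_).continuousWithinAt
  have := hb.1
  rw [h2] at this
  simpa using this.ne'

theorem e_mem {b : B} (h : b ∈ T.disc) : T.e b ∈ T.W := T.Θ_mem b h 0 T.zero_mem

theorem V_e {b : B} (h : b ∈ T.disc) : T.V (T.e b) = 0 := T.V_Θ b h 0 T.zero_mem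

theorem continuousOn_e : ContinuousOn T.e T.disc :=
  T.continuousOn_Θ.comp (continuousOn_id.prodMk continuousOn_const) fun _ hb => ⟨hb, T.zero_mem⟩

/-- The ramp `0` on `t ≤ 1/2`, `1` on `t ≥ 1`, linear in between. -/
def ramp (t : ℝ) : ℝ := max 0 (min 1 (2 * t - 1))

theorem continuous_ramp : Continuous ramp := by
  unfold ramp
  fun_prop

theorem ramp_mem (t : ℝ) : ramp t ∈ Set.Icc (0 : ℝ) 1 :=
  ⟨le_max_left _ _, max_le zero_le_one (min_le_left _ _)⟩

theorem ramp_of_le {t : ℝ} (h : t ≤ 1 / 2) : ramp t = 0 :=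
  max_eq_left ((min_le_right _ _).trans (by linarith))

theorem ramp_of_ge {t : ℝ} (h : 1 ≤ t) : ramp t = 1 := by
  unfold ramp
  rw [min_eq_left (by linarith), max_eq_right zero_le_one]

open Classical in
/-- Pushes a section towards the local section `e` over the disc of radius `r`. -/
def squeeze (s r : ℝ) (σ : B → X) (b : B) : X :=
  if T.ζ b ≤ r then T.Θ (b, (s + (1 - s) * ramp (2 * (T.ζ b / r) - 1)) • T.V (σ b)) else σ b

/-- The sections that stay in the tube over the disc of radius `r`. -/
structure IsAdmissible (r : ℝ) (σ : B → X) : Prop where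
  pos : 0 < r
  lt : r < T.δ
  mem : ∀ b, T.ζ b ≤ r → σ b ∈ T.W

variable {T}

theorem IsAdmissible.mem_disc {r : ℝ} {σ : B → X} (h : T.IsAdmissible r σ) {b : B}
    (hb : T.ζ b ≤ r) : b ∈ T.disc :=
  (T.mem_disc_of_lt (hb.trans_lt h.lt)).1

theorem mix_mem {s t : ℝ} (hs : s ∈ Set.Icc (0 : ℝ) 1) :
    s + (1 - s) * ramp t ∈ Set.Icc (0 : ℝ) 1 := by
  obtain ⟨h1, h2⟩ := ramp_mem t
  obtain ⟨h3, h4⟩ := hs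
  constructor
  · nlinarith
  · nlinarith

theorem IsAdmissible.squeeze_one {r : ℝ} {σ : B → X} (h : T.IsAdmissible r σ)
    (hσ : ∀ b, π (σ b) = b) : T.squeeze 1 r σ = σ := by
  funext b
  unfold squeeze
  split_ifs with hb
  · have h1 := T.Θ_V (σ b) (h.mem b hb) (by rw [hσ]; exact h.mem_disc hb)
    rw [hσ] at h1
    simpa using h1
  · rfl

/-- The ramp in `squeeze` vanishes up to `ζ = 3r/4`. The margin beyond `r/2`, where bubbles end,
provides the overlap needed for additivity of homology. -/
theorem IsAdmissible.squeeze_eq_e {r : ℝ} {σ : B → X} (h : T.IsAdmissible r σ) {b : B}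
    (hb : T.ζ b ≤ 3 / 4 * r) : T.squeeze 0 r σ b = T.e b := by
  unfold squeeze
  have h0 := h.pos
  rw [if_pos (hb.trans (by linarith)), ramp_of_le, e]
  · simp
  · have := (div_le_iff₀ h0).2 hb
    linarith

theorem squeeze_eq_self {s r : ℝ} {σ : B → X} {b : B} (hb : r < T.ζ b) :
    T.squeeze s r σ b = σ b := if_neg (not_le.2 hb)

theorem IsAdmissible.proj_squeeze {s r : ℝ} {σ : B → X} (h : T.IsAdmissible r σ)
    (hs : s ∈ Set.Icc (0 : ℝ) 1) (hσ : ∀ b, π (σ b) = b) (b : B) :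
    π (T.squeeze s r σ b) = b := by
  unfold squeeze
  split_ifs with hb
  · exact T.proj_Θ _ (h.mem_disc hb) _ (T.smul_mem _ (T.V_mem _ (h.mem b hb)) _ (mix_mem hs))
  · exact hσ b

/-- Since the fiber coordinate does not grow, squeezing preserves the jet at `b₀`, uniformly in
families. -/
theorem IsAdmissible.V_squeeze {s r : ℝ} {σ : B → X} (h : T.IsAdmissible r σ)
    (hs : s ∈ Set.Icc (0 : ℝ) 1) {b : B} (hb : σ b ∈ T.W) :
    T.squeeze s r σ b ∈ T.W ∧ ‖T.V (T.squeeze s r σ b)‖ ≤ ‖T.V (σ b)‖ := by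
  unfold squeeze
  split_ifs with hbr
  · have h1 := T.smul_mem _ (T.V_mem _ hb) _ (mix_mem (t := 2 * (T.ζ b / r) - 1) hs)
    refine ⟨T.Θ_mem _ (h.mem_disc hbr) _ h1, ?_⟩
    rw [T.V_Θ _ (h.mem_disc hbr) _ h1, norm_smul, Real.norm_of_nonneg (mix_mem hs).1]
    exact mul_le_of_le_one_left (norm_nonneg _) (mix_mem hs).2
  · exact ⟨hb, le_rfl⟩

theorem continuous_squeeze [T2Space B] {K : Type*} [TopologicalSpace K] {s r : K → ℝ}
    {σ : K → B → X} (hs : Continuous s) (hsI : ∀ ξ, s ξ ∈ Set.Icc (0 : ℝ) 1) (hr : Continuous r)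
    (hσ : Continuous fun q : K × B => σ q.1 q.2) (hσπ : ∀ ξ b, π (σ ξ b) = b)
    (h : ∀ ξ, T.IsAdmissible (r ξ) (σ ξ)) :
    Continuous fun q : K × B => T.squeeze (s q.1) (r q.1) (σ q.1) q.2 := by
  unfold squeeze
  refine continuous_if_le (T.continuous_ζ.comp continuous_snd) (hr.comp continuous_fst) ?_
    hσ.continuousOn ?_
  · refine T.continuousOn_Θ.comp (f := fun q : K × B => (q.2, (s q.1 + (1 - s q.1) *
      ramp (2 * (T.ζ q.2 / r q.1) - 1)) • T.V (σ q.1 q.2))) ?_ ?_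
    · refine continuous_snd.continuousOn.prodMk (ContinuousOn.smul ?_ ?_)
      · refine Continuous.continuousOn ?_
        have h1 : Continuous fun q : K × B => T.ζ q.2 / r q.1 :=
          (T.continuous_ζ.comp continuous_snd).div (hr.comp continuous_fst)
            fun q => (h q.1).pos.ne'
        have h2 := continuous_ramp.comp ((continuous_const (y := (2 : ℝ))).mul h1 |>.sub
          (continuous_const (y := (1 : ℝ))))
        have h3 := hs.comp (continuous_fst (X := K) (Y := B))
        exact h3.add ((continuous_const.sub h3).mul h2)
      · exact T.continuousOn_V.comp hσ.continuousOn fun q hq => (h q.1).mem _ hq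
    · intro q hq
      exact ⟨(h q.1).mem_disc hq, T.smul_mem _ (T.V_mem _ ((h q.1).mem _ hq)) _
        (mix_mem (hsI _))⟩
  · intro q hq
    have h1 := T.Θ_V (σ q.1 q.2) ((h q.1).mem _ hq.le)
      (by rw [hσπ]; exact (h q.1).mem_disc hq.le)
    rw [hσπ] at h1
    rw [hq, div_self (h q.1).pos.ne', ramp_of_ge (by norm_num)]
    simpa using h1

variable (T) in
/-- A family of discs `G (b, ·)` in the fibers over the coordinate disc, which map the center and
the boundary circle to `e b`. -/
structure Bubble where
  G : B × ℂ → X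
  continuousOn_G : ContinuousOn G (T.disc ×ˢ Metric.closedBall 0 1)
  proj_G : ∀ b ∈ T.disc, ∀ w ∈ Metric.closedBall (0 : ℂ) 1, π (G (b, w)) = b
  G_zero : ∀ b ∈ T.disc, G (b, 0) = T.e b
  G_one : ∀ b ∈ T.disc, ∀ w : ℂ, ‖w‖ = 1 → G (b, w) = T.e b

open Classical in
/-- Replaces a section over the annulus `a / 8 ≤ |z| ≤ a` by the discs `G`, with radial
profile `k`. -/
def Bubble.insert (Γ : T.Bubble) (a : ℝ) (k : ℝ → ℝ) (τ : B → X) (b : B) : X :=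
  if a / 8 ≤ T.ζ b ∧ T.ζ b ≤ a then Γ.G (b, (k (T.ζ b / a) : ℂ) * T.u b) else τ b

/-- The radial profiles that define continuous insertions. -/
structure IsProfile (k : ℝ → ℝ) : Prop where
  mem : ∀ t, k t ∈ Set.Icc (0 : ℝ) 1
  inner : k (1 / 8) = 0 ∨ k (1 / 8) = 1
  outer : k 1 = 0 ∨ k 1 = 1

namespace Bubble

variable (Γ : T.Bubble)

theorem G_eq_e {b : B} (h0 : 0 < T.ζ b) (h1 : T.ζ b < T.δ) {x : ℝ} (hx : x = 0 ∨ x = 1) :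
    Γ.G (b, (x : ℂ) * T.u b) = T.e b := by
  obtain ⟨hd, -⟩ := T.mem_disc_of_lt h1
  rcases hx with rfl | rfl
  · simpa using Γ.G_zero b hd
  · refine Γ.G_one b hd _ ?_
    rw [Complex.ofReal_one, one_mul]
    exact T.norm_u h0 h1

theorem mul_u_mem {b : B} (h0 : 0 < T.ζ b) (h1 : T.ζ b < T.δ) {x : ℝ}
    (hx : x ∈ Set.Icc (0 : ℝ) 1) : (x : ℂ) * T.u b ∈ Metric.closedBall (0 : ℂ) 1 := by
  rw [mem_closedBall_zero_iff, norm_mul, T.norm_u h0 h1, mul_one, Complex.norm_real,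
    Real.norm_of_nonneg hx.1]
  exact hx.2

theorem insert_of_lt {a : ℝ} {k : ℝ → ℝ} {τ : B → X} {b : B} (h : T.ζ b < a / 8) :
    Γ.insert a k τ b = τ b := if_neg fun h' => not_le.2 h h'.1

theorem insert_of_gt {a : ℝ} {k : ℝ → ℝ} {τ : B → X} {b : B} (h : a < T.ζ b) :
    Γ.insert a k τ b = τ b := if_neg fun h' => not_le.2 h h'.2

theorem proj_insert {a : ℝ} (ha : 0 < a) (haδ : a < T.δ) {k : ℝ → ℝ} (hk : IsProfile k)
    {τ : B → X} (hτ : ∀ b, π (τ b) = b) (b : B) : π (Γ.insert a k τ b) = b := by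
  unfold insert
  split_ifs with h
  · have h0 : 0 < T.ζ b := lt_of_lt_of_le (by positivity) h.1
    have h1 : T.ζ b < T.δ := h.2.trans_lt haδ
    exact Γ.proj_G b (T.mem_disc_of_lt h1).1 _ (mul_u_mem h0 h1 (hk.mem _))
  · exact hτ b

open Classical in
/-- The insertion of the discs `G`, taken over the points `θ b`. -/
def insertAlong (θ : B → B) (a : ℝ) (k : ℝ → ℝ) (τ : B → X) (b : B) : X :=
  if a / 8 ≤ T.ζ b ∧ T.ζ b ≤ a then Γ.G (θ b, (k (T.ζ b / a) : ℂ) * T.u b) else τ b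

/-- At both ends of the annulus the profile is 0 or 1, where `G` takes the value of `e`; the
direction `u` is continuous on the annulus since `ζ` is positive there. The points `θ b` allow a
bubble to be slid into the single fiber over `b₀`. -/
theorem continuous_insertAlong [T2Space B] {K : Type*} [TopologicalSpace K] {a : K → ℝ}
    {θ : K → B → B} {k : K → ℝ → ℝ} {τ : K → B → X} (ha : Continuous a) (ha0 : ∀ ξ, 0 < a ξ)
    (haδ : ∀ ξ, a ξ < T.δ) (hθ : Continuous fun q : K × B => θ q.1 q.2)
    (hθd : ∀ ξ b, T.ζ b ≤ a ξ → θ ξ b ∈ T.disc) (hk : Continuous fun q : K × ℝ => k q.1 q.2)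
    (hkp : ∀ ξ, IsProfile (k ξ)) (hτ : Continuous fun q : K × B => τ q.1 q.2)
    (hτe : ∀ ξ b, T.ζ b ≤ a ξ → τ ξ b = T.e (θ ξ b)) :
    Continuous fun q : K × B => Γ.insertAlong (θ q.1) (a q.1) (k q.1) (τ q.1) q.2 := by
  classical
  have hζ : Continuous fun q : K × B => T.ζ q.2 := T.continuous_ζ.comp continuous_snd
  have ha' : Continuous fun q : K × B => a q.1 := ha.comp continuous_fst
  have heq : ∀ q : K × B, Γ.insertAlong (θ q.1) (a q.1) (k q.1) (τ q.1) q.2 =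
      if max (a q.1 / 8 - T.ζ q.2) (T.ζ q.2 - a q.1) ≤ 0 then
        Γ.G (θ q.1 q.2, (k q.1 (T.ζ q.2 / a q.1) : ℂ) * T.u q.2) else τ q.1 q.2 := by
    intro q
    refine if_congr ?_ rfl rfl
    rw [max_le_iff, sub_nonpos, sub_nonpos]
  simp_rw [heq]
  have hdom : ∀ q : K × B, max (a q.1 / 8 - T.ζ q.2) (T.ζ q.2 - a q.1) ≤ 0 →
      0 < T.ζ q.2 ∧ T.ζ q.2 ≤ a q.1 := by
    intro q hq
    rw [max_le_iff, sub_nonpos, sub_nonpos] at hq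
    have := ha0 q.1
    exact ⟨lt_of_lt_of_le (by positivity) hq.1, hq.2⟩
  refine continuous_if_le (((ha'.div_const 8).sub hζ).max (hζ.sub ha')) continuous_const ?_
    hτ.continuousOn ?_
  · refine Γ.continuousOn_G.comp
      (f := fun q : K × B => (θ q.1 q.2, (k q.1 (T.ζ q.2 / a q.1) : ℂ) * T.u q.2)) ?_ ?_
    · refine hθ.continuousOn.prodMk (ContinuousOn.mul ?_ ?_)
      · have h1 : Continuous fun q : K × B => (q.1, T.ζ q.2 / a q.1) :=
          continuous_fst.prodMk (hζ.div ha' fun q => (ha0 q.1).ne')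
        exact (Complex.continuous_ofReal.comp (hk.comp h1)).continuousOn
      · exact T.continuousOn_u.comp continuous_snd.continuousOn fun q hq =>
          ⟨(hdom q hq).1, (hdom q hq).2.trans_lt (haδ _)⟩
    · intro q hq
      exact ⟨hθd _ _ (hdom q hq).2,
        mul_u_mem (hdom q hq).1 ((hdom q hq).2.trans_lt (haδ _)) ((hkp q.1).mem _)⟩
  · intro q hq
    obtain ⟨h1, h2⟩ := hdom q hq.le
    have hval : k q.1 (T.ζ q.2 / a q.1) = 0 ∨ k q.1 (T.ζ q.2 / a q.1) = 1 := by
      rcases max_choice (a q.1 / 8 - T.ζ q.2) (T.ζ q.2 - a q.1) with h | h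
      · rw [h, sub_eq_zero] at hq
        have : T.ζ q.2 / a q.1 = 1 / 8 := by
          rw [← hq]
          have := (ha0 q.1).ne'
          field_simp
        rw [this]
        exact (hkp q.1).inner
      · rw [h, sub_eq_zero] at hq
        rw [hq, div_self (ha0 q.1).ne']
        exact (hkp q.1).outer
    rw [hτe q.1 q.2 h2]
    rcases hval with hv | hv
    · rw [hv, Complex.ofReal_zero, zero_mul]
      exact Γ.G_zero _ (hθd _ _ h2)
    · rw [hv, Complex.ofReal_one, one_mul]
      exact Γ.G_one _ (hθd _ _ h2) _ (T.norm_u h1 (h2.trans_lt (haδ _)))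

theorem continuous_insert [T2Space B] {K : Type*} [TopologicalSpace K] {a : K → ℝ}
    {k : K → ℝ → ℝ} {τ : K → B → X} (ha : Continuous a) (ha0 : ∀ ξ, 0 < a ξ)
    (haδ : ∀ ξ, a ξ < T.δ) (hk : Continuous fun q : K × ℝ => k q.1 q.2)
    (hkp : ∀ ξ, IsProfile (k ξ)) (hτ : Continuous fun q : K × B => τ q.1 q.2)
    (hτe : ∀ ξ b, T.ζ b ≤ a ξ → τ ξ b = T.e b) :
    Continuous fun q : K × B => Γ.insert (a q.1) (k q.1) (τ q.1) q.2 :=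
  Γ.continuous_insertAlong (θ := fun _ b => b) ha ha0 haδ continuous_snd
    (fun ξ _ hb => (T.mem_disc_of_lt (hb.trans_lt (haδ ξ))).1) hk hkp hτ hτe

end Bubble

end Tube

end Tubes

end
end SemiTop


namespace SemiTop
noncomputable section

/-! ### Operators on sections constrained by jets -/

section Steps

variable {B X : Type} [TopologicalSpace B] [TopologicalSpace X] {π : X → B} {b₀ : B} {E : Type}
  [NormedAddCommGroup E] [NormedSpace ℝ E] {T : Tube π b₀ E}

namespace Tube

theorem base_mem_disc {b₀ : B} (T : Tube π b₀ E) : b₀ ∈ T.disc :=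
  (T.mem_disc_of_lt (T.ζ_base.trans_lt T.δ_pos)).1

/-- Squeezes `σ` to `e` over the disc of radius `r / 2`, and inserts a bubble there. -/
def Bubble.attach (Γ : T.Bubble) (r : ℝ) (k : ℝ → ℝ) (σ : B → X) :
    B → X :=
  Γ.insert (r / 2) k (T.squeeze 0 r σ)

/-- A profile that steps from the value `c₀` on `t ≤ 1/2` to the value `c₁` on `t ≥ 1`. -/
structure IsStep (h : ℝ → ℝ) (c₀ c₁ : ℝ) : Prop where
  continuous : Continuous h
  mem : ∀ t, h t ∈ Set.Icc (0 : ℝ) 1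
  low : ∀ t ≤ 1 / 2, h t = c₀
  high : ∀ t ≥ 1, h t = c₁
  left : c₀ = 0 ∨ c₀ = 1
  right : c₁ = 0 ∨ c₁ = 1

theorem isStep_ramp : IsStep ramp 0 1 :=
  ⟨continuous_ramp, ramp_mem, fun _ => ramp_of_le, fun _ => ramp_of_ge, Or.inl rfl, Or.inr rfl⟩

/-- Traversing the disc from its boundary to its center gives the opposite bubble. -/
theorem isStep_one_sub_ramp : IsStep (fun t => 1 - ramp t) 1 0 where
  continuous := continuous_const.sub continuous_ramp
  mem t := ⟨sub_nonneg.2 (ramp_mem t).2, sub_le_self _ (ramp_mem t).1⟩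
  low t ht := by rw [ramp_of_le ht, sub_zero]
  high t ht := by rw [ramp_of_ge ht, sub_self]
  left := Or.inr rfl
  right := Or.inl rfl

variable {h h' : ℝ → ℝ} {c₀ c₁ : ℝ}

theorem IsStep.isProfile (hh : IsStep h c₀ c₁) : IsProfile h where
  mem := hh.mem
  inner := by rw [hh.low _ (by norm_num)]; exact hh.left
  outer := by rw [hh.high _ le_rfl]; exact hh.right

/-- The profile that runs through `h'` and then through `h`. -/
def double (h h' : ℝ → ℝ) (t : ℝ) : ℝ := if t ≤ 1 / 4 then h' (4 * t) else h t

theorem IsStep.continuous_double (hh : IsStep h c₀ c₁) (hh' : IsStep h' c₁ c₀) :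
    Continuous (double h h') := by
  refine Continuous.if_le (hh'.continuous.comp (continuous_const.mul continuous_id)) hh.continuous
    continuous_id continuous_const ?_
  rintro t rfl
  change h' (4 * (1 / 4)) = h (1 / 4)
  rw [hh'.high _ (by norm_num), hh.low _ (by norm_num)]

theorem IsStep.double_mem (hh : IsStep h c₀ c₁) (hh' : IsStep h' c₁ c₀) (t : ℝ) :
    double h h' t ∈ Set.Icc (0 : ℝ) 1 := by
  unfold double
  split_ifs
  · exact hh'.mem _
  · exact hh.mem _

/-- At 1/8 and at 1 the doubled profile equals `c₁`, so the affine homotopy to the constant `c₁`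
fixes the ends. The inner end 1/8 of the annulus is where the rescaled step `h'(4t)` begins. -/
theorem IsStep.isProfile_mix (hh : IsStep h c₀ c₁) (hh' : IsStep h' c₁ c₀) {s : ℝ}
    (hs : s ∈ Set.Icc (0 : ℝ) 1) : IsProfile fun t => (1 - s) * double h h' t + s * c₁ where
  mem t := by
    obtain ⟨h1, h2⟩ := hh.double_mem hh' t
    obtain ⟨h3, h4⟩ := hs
    rcases hh.right with rfl | rfl
    · exact ⟨by nlinarith, by nlinarith⟩
    · exact ⟨by nlinarith, by nlinarith⟩
  inner := by
    have : double h h' (1 / 8) = c₁ := by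
      rw [double, if_pos (by norm_num), hh'.low _ (by norm_num)]
    rw [this, ← add_mul, sub_add_cancel, one_mul]
    exact hh.right
  outer := by
    have : double h h' 1 = c₁ := by
      rw [double, if_neg (by norm_num), hh.high _ le_rfl]
    rw [this, ← add_mul, sub_add_cancel, one_mul]
    exact hh.right

variable (Γ : T.Bubble)

theorem Bubble.insert_const {a : ℝ} (ha : 0 < a) (haδ : a < T.δ) {c : ℝ} (hc : c = 0 ∨ c = 1)
    {τ : B → X} (hτ : ∀ b, T.ζ b ≤ a → τ b = T.e b) : Γ.insert a (fun _ => c) τ = τ := by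
  funext b
  unfold Bubble.insert
  split_ifs with hb
  · rw [Γ.G_eq_e (lt_of_lt_of_le (by positivity) hb.1) (hb.2.trans_lt haδ) hc, hτ b hb.2]
  · rfl

/-- The profile is still at its initial value for `ζ ≤ r/4`, half of the outer radius of the bubble;
this leaves room for a second bubble inside. -/
theorem Bubble.attach_eq_e (hh : IsStep h c₀ c₁) {r : ℝ} {σ : B → X} (hr : T.IsAdmissible r σ)
    {b : B} (hb : T.ζ b ≤ r / 4) : Γ.attach r h σ b = T.e b := by
  have h0 := hr.pos
  have h1 := hr.lt
  unfold Bubble.attach Bubble.insert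
  split_ifs with hc
  · rw [hh.low]
    · exact Γ.G_eq_e (by linarith [hc.1]) (by linarith) hh.left
    · rw [div_le_iff₀ (by positivity)]
      linarith
  · exact hr.squeeze_eq_e (by linarith)

theorem Bubble.isAdmissible_attach (hh : IsStep h c₀ c₁) {r : ℝ} {σ : B → X}
    (hr : T.IsAdmissible r σ) : T.IsAdmissible (r / 4) (Γ.attach r h σ) where
  pos := by linarith [hr.pos]
  lt := by linarith [hr.pos, hr.lt]
  mem b hb := by
    rw [Γ.attach_eq_e hh hr hb]
    exact T.e_mem (hr.mem_disc (by linarith [hr.pos]))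

/-- The second bubble, of outer radius `r/8`, sits where the first has not started. The factor 4 in
`double` is the ratio of `r/2` to `r/8`. -/
theorem Bubble.attach_attach (hh : IsStep h c₀ c₁) (hh' : IsStep h' c₁ c₀) {r : ℝ} {σ : B → X}
    (hr : T.IsAdmissible r σ) :
    Γ.attach (r / 4) h' (Γ.attach r h σ) =
      Γ.insert (r / 2) (double h h') (T.squeeze 0 r σ) := by
  have h0 := hr.pos
  have h1 := hr.lt
  have hsq : T.squeeze 0 (r / 4) (Γ.attach r h σ) = Γ.attach r h σ := by
    funext b
    unfold squeeze
    split_ifs with hb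
    · rw [Γ.attach_eq_e hh hr hb, T.V_e (hr.mem_disc (by linarith)), smul_zero, e]
    · rfl
  funext b
  rw [Bubble.attach, hsq]
  have h4 : r / 4 / 2 = r / 8 := by ring
  rw [h4]
  by_cases hb1 : T.ζ b < r / 64
  · rw [Γ.insert_of_lt (by linarith), Γ.attach_eq_e hh hr (by linarith),
      Γ.insert_of_lt (by linarith), hr.squeeze_eq_e (by linarith)]
  rw [not_lt] at hb1
  have hζ0 : 0 < T.ζ b := by linarith
  by_cases hb2 : T.ζ b ≤ r / 8
  · have hl : Γ.insert (r / 8) h' (Γ.attach r h σ) b =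
        Γ.G (b, (h' (T.ζ b / (r / 8)) : ℂ) * T.u b) := if_pos ⟨by linarith, hb2⟩
    rw [hl]
    by_cases hb3 : T.ζ b < r / 16
    · rw [Γ.insert_of_lt (by linarith), hr.squeeze_eq_e (by linarith), hh'.low]
      · exact Γ.G_eq_e hζ0 (by linarith) hh.right
      · rw [div_le_iff₀ (by positivity)]
        linarith
    · rw [not_lt] at hb3
      have hr2 : Γ.insert (r / 2) (double h h') (T.squeeze 0 r σ) b =
        Γ.G (b, (double h h' (T.ζ b / (r / 2)) : ℂ) * T.u b) :=
        if_pos ⟨by linarith, by linarith⟩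
      rw [hr2, double, if_pos]
      · congr 5
        field_simp
        norm_num
      · rw [div_le_iff₀ (by positivity)]
        linarith
  · rw [not_le] at hb2
    rw [Γ.insert_of_gt hb2]
    unfold Bubble.attach Bubble.insert
    have hd : double h h' (T.ζ b / (r / 2)) = h (T.ζ b / (r / 2)) := by
      rw [double, if_neg]
      rw [not_le, lt_div_iff₀ (by positivity)]
      linarith
    rw [hd]

end Tube

end Steps

/-! ### Families inducing the jets, the radius of a section, and operators on sections. -/

section Operators

variable {B X : Type} [TopologicalSpace B] [ChartedSpace ℂ B] [TopologicalSpace X] {n : ℕ}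
  [ChartedSpace (EuclideanSpace ℂ (Fin (n + 1))) X] {π : X → B} {J : Type}

/-- The continuous families of sections constrained by `S`, of arbitrary class. -/
structure IsJetFamily (S : J → AdmissibleJet n π) {K : Type} [TopologicalSpace K]
    (s : K → B → X) : Prop where
  continuous : Continuous fun q : K × B => s q.1 q.2
  proj : ∀ ξ b, π (s ξ b) = b
  induces : ∀ j, Induces s (S j)

/-- A homotopy of operators which takes families of sections to families of sections. -/
def IsJetOperator (S : J → AdmissibleJet n π) (F : unitInterval → (B → X) → B → X) : Prop :=
  ∀ (K : Type) [TopologicalSpace K] [CompactSpace K] (s : K → B → X), IsJetFamily S s →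
    IsJetFamily S fun q : K × unitInterval => F q.2 (s q.1)

variable {S : J → AdmissibleJet n π}

theorem IsJetFamily.comp {K L : Type} [TopologicalSpace K] [TopologicalSpace L] {s : K → B → X}
    (h : IsJetFamily S s) {θ : L → K} (hθ : Continuous θ) : IsJetFamily S fun l => s (θ l) where
  continuous := h.continuous.comp
    ((hθ.comp continuous_fst).prodMk (continuous_snd (X := L) (Y := B)))
  proj _ b := h.proj _ b
  induces j := (h.induces j).congr θ (Filter.Eventually.of_forall fun _ _ => rfl)

variable {E : Type} [NormedAddCommGroup E] [NormedSpace ℝ E] {j₀ : J}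

namespace Tube

/-- The tube describes the jet `S j₀`, and its disc contains no other base points. -/
structure IsAdapted (S : J → AdmissibleJet n π) (j₀ : J) (T : Tube π (S j₀).base E) : Prop where
  induces_iff : ∀ {K : Type} (s : K → B → X), (∀ ξ b, π (s ξ b) = b) →
    (Induces s (S j₀) ↔ ∀ ε > (0 : ℝ), ∀ᶠ b in 𝓝 (S j₀).base, ∀ ξ, s ξ b ∈ T.W ∧
      ‖T.V (s ξ b)‖ ≤ ε * ‖T.z b‖ ^ (S j₀).order)
  separates : ∀ j, j ≠ j₀ → (S j).base ∉ T.disc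

/-- A bump function at the center of the tube, used to measure how long a section stays
in the tube. -/
structure IsGauge {b₀ : B} (T : Tube π b₀ E) (m : X → ℝ) : Prop where
  continuous : Continuous m
  nonneg : ∀ x, 0 ≤ m x
  eq_zero : ∀ x, x ∉ T.W → m x = 0
  center : m (T.e b₀) = T.δ

/-- A radius such that the section `σ` stays in the tube over the disc of this radius. -/
def rad {b₀ : B} (T : Tube π b₀ E) (m : X → ℝ) (σ : B → X) : ℝ :=
  sInf ((fun b => T.ζ b + m (σ b)) '' Set.univ) / 2

variable {T : Tube π (S j₀).base E}

theorem IsAdapted.apply_base (hT : T.IsAdapted S j₀) {K : Type} [TopologicalSpace K]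
    {s : K → B → X} (hs : IsJetFamily S s) (ξ : K) : s ξ (S j₀).base = T.e (S j₀).base := by
  have h1 := (hT.induces_iff s hs.proj).1 (hs.induces j₀)
  have h2 : T.V (s ξ (S j₀).base) = 0 := by
    rw [← norm_le_zero_iff]
    -- For a jet of order 0 the power is `0 ^ 0 = 1`, so the value at the base point is only
    -- controlled by letting ε tend to 0.
    refine le_of_forall_pos_le_add fun ε hε => ?_
    refine ((h1 ε hε).self_of_nhds ξ).2.trans ?_
    rw [T.z_base, norm_zero, zero_add]
    refine mul_le_of_le_one_right hε.le ?_
    exact pow_le_one₀ le_rfl zero_le_one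
  have h3 := T.Θ_V (s ξ (S j₀).base) ((h1 1 one_pos).self_of_nhds ξ).1
    (by rw [hs.proj]; exact T.base_mem_disc)
  rw [h2, hs.proj] at h3
  exact h3.symm

theorem IsAdapted.squeeze [T2Space B] (hT : T.IsAdapted S j₀) {K : Type} [TopologicalSpace K]
    {σ : K → B → X} (hσ : IsJetFamily S σ) {s r : K → ℝ} (hs : Continuous s)
    (hsI : ∀ ξ, s ξ ∈ Set.Icc (0 : ℝ) 1) (hr : Continuous r) {r₀ : ℝ} (hr₀ : ∀ ξ, r ξ ≤ r₀)
    (hr₀δ : r₀ < T.δ) (h : ∀ ξ, T.IsAdmissible (r ξ) (σ ξ)) :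
    IsJetFamily S fun ξ => T.squeeze (s ξ) (r ξ) (σ ξ) where
  continuous := continuous_squeeze hs hsI hr hσ.continuous hσ.proj h
  proj ξ b := (h ξ).proj_squeeze (hsI ξ) (hσ.proj ξ) b
  induces j := by
    by_cases hj : j = j₀
    · subst hj
      rw [hT.induces_iff _ fun ξ b => (h ξ).proj_squeeze (hsI ξ) (hσ.proj ξ) b]
      intro ε hε
      filter_upwards [(hT.induces_iff σ hσ.proj).1 (hσ.induces j) ε hε] with b hb ξ
      obtain ⟨h1, h2⟩ := (h ξ).V_squeeze (hsI ξ) (hb ξ).1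
      exact ⟨h1, h2.trans (hb ξ).2⟩
    · refine (hσ.induces j).congr id ?_
      have h1 : ∀ᶠ b in 𝓝 (S j).base, r₀ < T.ζ b :=
        T.continuous_ζ.continuousAt.eventually_const_lt
          (by rw [T.ζ_of_notMem (hT.separates j hj)]; exact hr₀δ)
      filter_upwards [h1] with b hb ξ
      exact squeeze_eq_self ((hr₀ ξ).trans_lt hb)

theorem IsAdapted.insert [T2Space B] (hT : T.IsAdapted S j₀) (Γ : T.Bubble) {K : Type}
    [TopologicalSpace K] [CompactSpace K] {τ : K → B → X} (hτ : IsJetFamily S τ) {a : K → ℝ}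
    {k : K → ℝ → ℝ} (ha : Continuous a) (ha0 : ∀ ξ, 0 < a ξ) {a₀ : ℝ} (haa₀ : ∀ ξ, a ξ ≤ a₀)
    (ha₀ : a₀ < T.δ) (hk : Continuous fun q : K × ℝ => k q.1 q.2) (hkp : ∀ ξ, IsProfile (k ξ))
    (hτe : ∀ ξ b, T.ζ b ≤ a ξ → τ ξ b = T.e b) :
    IsJetFamily S fun ξ => Γ.insert (a ξ) (k ξ) (τ ξ) where
  continuous := Γ.continuous_insert ha ha0 (fun ξ => (haa₀ ξ).trans_lt ha₀) hk hkp hτ.continuous hτe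
  proj ξ b := Γ.proj_insert (ha0 ξ) ((haa₀ ξ).trans_lt ha₀) (hkp ξ) (hτ.proj ξ) b
  induces j := by
    refine (hτ.induces j).congr id ?_
    by_cases hj : j = j₀
    · subst hj
      -- Compactness of the parameter space gives a neighborhood of `b₀` that no insertion of the
      -- family touches.
      obtain ⟨a₁, ha₁, hle⟩ : ∃ a₁ > 0, ∀ ξ, a₁ ≤ a ξ := by
        rcases isEmpty_or_nonempty K with hK | hK
        · exact ⟨1, one_pos, fun ξ => hK.elim ξ⟩
        · obtain ⟨ξ, -, hξ⟩ := isCompact_univ.exists_isMinOn Set.univ_nonempty ha.continuousOn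
          exact ⟨a ξ, ha0 ξ, fun ξ' => hξ (Set.mem_univ ξ')⟩
      have h1 : ∀ᶠ b in 𝓝 (S j).base, T.ζ b < a₁ / 8 :=
        T.continuous_ζ.continuousAt.eventually_lt_const (by rw [T.ζ_base]; positivity)
      filter_upwards [h1] with b hb ξ
      exact Γ.insert_of_lt (hb.trans_le (by linarith [hle ξ]))
    · have h1 : ∀ᶠ b in 𝓝 (S j).base, a₀ < T.ζ b :=
        T.continuous_ζ.continuousAt.eventually_const_lt
          (by rw [T.ζ_of_notMem (hT.separates j hj)]; exact ha₀)
      filter_upwards [h1] with b hb ξ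
      exact Γ.insert_of_gt ((haa₀ ξ).trans_lt hb)

theorem IsAdapted.attach [T2Space B] (hT : T.IsAdapted S j₀) (Γ : T.Bubble) {K : Type}
    [TopologicalSpace K] [CompactSpace K] {σ : K → B → X} (hσ : IsJetFamily S σ) {r : K → ℝ}
    {k : ℝ → ℝ} (hr : Continuous r) (hk : Continuous k) (hkp : IsProfile k) {r₀ : ℝ}
    (hr₀ : ∀ ξ, r ξ ≤ r₀) (hr₀δ : r₀ < T.δ) (h : ∀ ξ, T.IsAdmissible (r ξ) (σ ξ)) :
    IsJetFamily S fun ξ => Γ.attach (r ξ) k (σ ξ) := by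
  refine hT.insert Γ (a₀ := r₀) (hT.squeeze hσ continuous_const (fun _ => ⟨le_rfl, zero_le_one⟩) hr
    hr₀ hr₀δ h) (hr.div_const 2) (fun ξ => half_pos (h ξ).pos)
    (fun ξ => (half_le_self (h ξ).pos.le).trans (hr₀ ξ)) hr₀δ (hk.comp continuous_snd)
    (fun _ => hkp) fun ξ b hb => (h ξ).squeeze_eq_e (by linarith [(h ξ).pos])

theorem two_mul_rad_le {m : X → ℝ} (hm : T.IsGauge m) (σ : B → X) (b : B) :
    2 * T.rad m σ ≤ T.ζ b + m (σ b) := by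
  have : sInf ((fun b => T.ζ b + m (σ b)) '' Set.univ) ≤ T.ζ b + m (σ b) := by
    refine csInf_le ⟨0, ?_⟩ ⟨b, trivial, rfl⟩
    rintro _ ⟨b', -, rfl⟩
    exact add_nonneg (T.ζ_nonneg _) (hm.nonneg _)
  unfold rad
  linarith

theorem IsAdapted.rad_le (hT : T.IsAdapted S j₀) {m : X → ℝ} (hm : T.IsGauge m) {K : Type}
    [TopologicalSpace K] {σ : K → B → X} (hσ : IsJetFamily S σ) (ξ : K) :
    T.rad m (σ ξ) ≤ T.δ / 2 := by
  have := two_mul_rad_le hm (σ ξ) (S j₀).base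
  rw [hT.apply_base hσ, hm.center, T.ζ_base] at this
  linarith

section Radius

variable [CompactSpace B] {m : X → ℝ}

theorem continuous_rad [T2Space B] (hm : T.IsGauge m) {K : Type} [TopologicalSpace K]
    {σ : K → B → X} (hσ : Continuous fun q : K × B => σ q.1 q.2) :
    Continuous fun ξ => T.rad m (σ ξ) := by
  refine Continuous.div_const ?_ 2
  refine isCompact_univ.continuous_sInf (f := fun ξ b => T.ζ b + m (σ ξ b)) ?_
  exact (T.continuous_ζ.comp continuous_snd).add (hm.continuous.comp hσ)

/-- The infimum of `ζ + m ∘ σ` is positive because `ζ` vanishes only at `b₀`, where `m` is `δ`.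
Outside the tube `m` vanishes, so `ζ` is at least twice the radius there. -/
theorem IsAdapted.isAdmissible_rad [T2Space B] (hT : T.IsAdapted S j₀) (hm : T.IsGauge m)
    {K : Type} [TopologicalSpace K] {σ : K → B → X} (hσ : IsJetFamily S σ) (ξ : K) :
    T.IsAdmissible (T.rad m (σ ξ)) (σ ξ) := by
  have hpos : 0 < T.rad m (σ ξ) := by
    have hcont : Continuous fun b => T.ζ b + m (σ ξ b) :=
      T.continuous_ζ.add (hm.continuous.comp (hσ.continuous.comp (Continuous.prodMk_right ξ)))
    obtain ⟨b, -, hb⟩ := (isCompact_univ.image hcont).sInf_mem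
      (Set.Nonempty.image _ ⟨(S j₀).base, trivial⟩)
    unfold rad
    rw [← hb]
    refine half_pos ?_
    refine (add_nonneg (T.ζ_nonneg b) (hm.nonneg _)).lt_of_ne fun h0 => ?_
    have h1 : T.ζ b = 0 := by linarith [T.ζ_nonneg b, hm.nonneg (σ ξ b)]
    have h2 : m (σ ξ b) = 0 := by linarith [T.ζ_nonneg b, hm.nonneg (σ ξ b)]
    rw [T.eq_base_of_ζ h1, hT.apply_base hσ, hm.center] at h2
    exact T.δ_pos.ne' h2
  refine ⟨hpos, ?_, fun b hb => ?_⟩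
  · linarith [hT.rad_le hm hσ ξ, T.δ_pos]
  · by_contra hW
    have := two_mul_rad_le hm (σ ξ) b
    rw [hm.eq_zero _ hW] at this
    linarith

end Radius

variable {h h' : ℝ → ℝ} {c₀ c₁ : ℝ}

section JetOperators

variable [T2Space B] [CompactSpace B] {m : X → ℝ}

theorem IsAdapted.isJetFamily_attach (hT : T.IsAdapted S j₀) (Γ : T.Bubble) (hm : T.IsGauge m)
    (hh : IsStep h c₀ c₁) {K : Type} [TopologicalSpace K] [CompactSpace K] {σ : K → B → X}
    (hσ : IsJetFamily S σ) : IsJetFamily S fun ξ => Γ.attach (T.rad m (σ ξ)) h (σ ξ) :=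
  hT.attach Γ hσ (continuous_rad hm hσ.continuous) hh.continuous hh.isProfile
    (hT.rad_le hm hσ) (half_lt_self T.δ_pos) (hT.isAdmissible_rad hm hσ)

/-- The second attachment uses the radius of the modified section, whereas `Bubble.attach_attach`
needs a quarter of the original one. Both are admissible for the modified section, hence so is every
radius between them. -/
theorem IsAdapted.isJetOperator_radius (hT : T.IsAdapted S j₀) (Γ : T.Bubble)
    (hm : T.IsGauge m) (hh : IsStep h c₀ c₁) (hh' : IsStep h' c₁ c₀) :
    IsJetOperator S fun t σ => Γ.attach
      ((1 - (t : ℝ)) * T.rad m (Γ.attach (T.rad m σ) h σ) + t * (T.rad m σ / 4)) h'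
      (Γ.attach (T.rad m σ) h σ) := by
  intro K _ _ σ hσ
  have h1 := hT.isJetFamily_attach Γ hm hh hσ
  have h2 := h1.comp (continuous_fst (X := K) (Y := unitInterval))
  have hle : ∀ q : K × unitInterval, (1 - (q.2 : ℝ)) * T.rad m (Γ.attach (T.rad m (σ q.1)) h (σ q.1)) +
      q.2 * (T.rad m (σ q.1) / 4) ≤
      max (T.rad m (Γ.attach (T.rad m (σ q.1)) h (σ q.1))) (T.rad m (σ q.1) / 4) := by
    rintro ⟨ξ, t, ht0, ht1⟩
    have e1 := le_max_left (T.rad m (Γ.attach (T.rad m (σ ξ)) h (σ ξ))) (T.rad m (σ ξ) / 4)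
    have e2 := le_max_right (T.rad m (Γ.attach (T.rad m (σ ξ)) h (σ ξ))) (T.rad m (σ ξ) / 4)
    dsimp only
    nlinarith
  have hc1 : Continuous fun q : K × unitInterval => T.rad m (Γ.attach (T.rad m (σ q.1)) h (σ q.1)) :=
    continuous_rad hm h2.continuous
  have hc2 : Continuous fun q : K × unitInterval => T.rad m (σ q.1) :=
    (continuous_rad hm hσ.continuous).comp continuous_fst
  have hc3 : Continuous fun q : K × unitInterval => (q.2 : ℝ) :=
    continuous_subtype_val.comp continuous_snd
  refine hT.attach Γ (r₀ := T.δ / 2) h2 (((continuous_const.sub hc3).mul hc1).add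
    (hc3.mul (hc2.div_const 4))) hh'.continuous hh'.isProfile (fun q => (hle q).trans ?_)
    (half_lt_self T.δ_pos) fun q => ?_
  · refine max_le (hT.rad_le hm h1 q.1) ?_
    linarith [hT.rad_le hm hσ q.1, (hT.isAdmissible_rad hm hσ q.1).pos]
  · have a1 := hT.isAdmissible_rad hm h1 q.1
    have a2 := Γ.isAdmissible_attach hh (hT.isAdmissible_rad hm hσ q.1)
    refine ⟨?_, (hle q).trans_lt (max_lt a1.lt a2.lt), fun b hb => ?_⟩
    · have p1 := a1.pos
      have p2 := a2.pos
      have t0 := q.2.2.1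
      have t1 := q.2.2.2
      rcases t1.eq_or_lt with ht | ht
      · rw [ht]
        linarith
      · have := mul_pos (sub_pos.2 ht) p1
        have := mul_nonneg t0 p2.le
        linarith
    · rcases le_max_iff.1 (hb.trans (hle q)) with hb' | hb'
      · exact a1.mem b hb'
      · exact a2.mem b hb'

theorem IsAdapted.isJetOperator_profile (hT : T.IsAdapted S j₀) (Γ : T.Bubble)
    (hm : T.IsGauge m) (hh : IsStep h c₀ c₁) (hh' : IsStep h' c₁ c₀) :
    IsJetOperator S fun t σ => Γ.insert (T.rad m σ / 2)
      (fun x => (1 - (t : ℝ)) * double h h' x + t * c₁) (T.squeeze 0 (T.rad m σ) σ) := by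
  intro K _ _ σ hσ
  have h1 : IsJetFamily S fun ξ => T.squeeze 0 (T.rad m (σ ξ)) (σ ξ) :=
    hT.squeeze hσ continuous_const (fun _ => ⟨le_rfl, zero_le_one⟩)
      (continuous_rad hm hσ.continuous) (hT.rad_le hm hσ) (half_lt_self T.δ_pos)
      (hT.isAdmissible_rad hm hσ)
  have hc2 : Continuous fun q : K × unitInterval => T.rad m (σ q.1) :=
    (continuous_rad hm hσ.continuous).comp continuous_fst
  refine hT.insert Γ (a₀ := T.δ / 2) (h1.comp (continuous_fst (X := K) (Y := unitInterval)))
    (hc2.div_const 2) (fun q => half_pos (hT.isAdmissible_rad hm hσ q.1).pos) (fun q => ?_)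
    (half_lt_self T.δ_pos) ?_ (fun q => hh.isProfile_mix hh' q.2.2) fun q b hb =>
      (hT.isAdmissible_rad hm hσ q.1).squeeze_eq_e
        (by linarith [(hT.isAdmissible_rad hm hσ q.1).pos])
  · linarith [hT.rad_le hm hσ q.1, (hT.isAdmissible_rad hm hσ q.1).pos]
  · have hc3 : Continuous fun q : (K × unitInterval) × ℝ => (q.1.2 : ℝ) :=
      continuous_subtype_val.comp (continuous_snd.comp continuous_fst)
    exact ((continuous_const.sub hc3).mul ((hh.continuous_double hh').comp continuous_snd)).add
      (hc3.mul continuous_const)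

theorem IsAdapted.isJetOperator_squeeze (hT : T.IsAdapted S j₀) (hm : T.IsGauge m) :
    IsJetOperator S fun t σ => T.squeeze t (T.rad m σ) σ := by
  intro K _ _ σ hσ
  exact hT.squeeze (hσ.comp (continuous_fst (X := K) (Y := unitInterval)))
    (continuous_subtype_val.comp continuous_snd) (fun q => q.2.2)
    ((continuous_rad hm hσ.continuous).comp continuous_fst) (fun q => hT.rad_le hm hσ q.1)
    (half_lt_self T.δ_pos) fun q => hT.isAdmissible_rad hm hσ q.1

end JetOperators

end Tube

end Operators

end
end SemiTop


namespace SemiTop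
noncomputable section

/-! ### Continuous maps and homotopies between spaces of sections -/

section SectionSpaces

variable {B X : Type} [TopologicalSpace B] [ChartedSpace ℂ B] [TopologicalSpace X] {n : ℕ}
  [ChartedSpace (EuclideanSpace ℂ (Fin (n + 1))) X] {π : X → B} {J : Type}
  {S : J → AdmissibleJet n π} {c : H 2 B} {α α' : H 2 X}

theorem SectStop.ext_coe {σ τ : SectStop π c α S} (h : (⇑σ.toMap : B → X) = τ.toMap) : σ = τ := by
  have h' := DFunLike.coe_injective h
  cases σ
  cases τ
  congr

theorem isFamily_iff {K : Type} [TopologicalSpace K] {s : K → SectStop π c α S} :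
    IsFamily s ↔ IsJetFamily S fun ξ => (s ξ).toMap :=
  ⟨fun h => ⟨h.1, fun ξ b => (s ξ).is_section b, h.2⟩, fun h => ⟨h.continuous, h.induces⟩⟩

theorem SectStop.isJetFamily (σ : SectStop π c α S) :
    IsJetFamily S fun _ : Unit => σ.toMap where
  continuous := σ.toMap.continuous.comp continuous_snd
  proj _ b := σ.is_section b
  induces := σ.induces

theorem IsFamily.continuous {K : Type} [TopologicalSpace K] [CompactSpace K] [T2Space K]
    {s : K → SectStop π c α S} (h : IsFamily s) : Continuous s := by
  rw [continuous_iff_coinduced_le]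
  exact le_iSup₂ (f := fun (K : CompHaus.{0}) (s : {s : K → SectStop π c α S // IsFamily s}) =>
    TopologicalSpace.coinduced s.1 inferInstance) (CompHaus.of K) ⟨s, h⟩

theorem continuous_of_families {Y : Type*} [TopologicalSpace Y] {F : SectStop π c α S → Y}
    (h : ∀ (K : Type) [TopologicalSpace K] [CompactSpace K] [T2Space K]
      (s : K → SectStop π c α S), IsFamily s → Continuous (F ∘ s)) : Continuous F := by
  refine continuous_iSup_dom.2 fun K => continuous_iSup_dom.2 fun s => ?_
  exact continuous_coinduced_dom.2 (h K s.1 s.2)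

namespace IsJetOperator

variable {F : unitInterval → (B → X) → B → X}

/-- The value of a jet operator on a section. -/
def map (hF : IsJetOperator S F) (σ : SectStop π c α S) (t : unitInterval) : C(B, X) where
  toFun := F t σ.toMap
  continuous_toFun := (hF Unit _ σ.isJetFamily).continuous.comp
    (Continuous.prodMk_right (((), t) : Unit × unitInterval))

theorem push_map_eq (hF : IsJetOperator S F) (σ : SectStop π c α S) (t t' : unitInterval) :
    push 2 (hF.map σ t) c = push 2 (hF.map σ t') c := by
  have hI : PathConnectedSpace unitInterval := isPathConnected_iff_pathConnectedSpace.1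
    ((convex_Icc (0 : ℝ) 1).isPathConnected (Set.nonempty_Icc.2 zero_le_one))
  refine push_eq_of_homotopic ⟨⟨⟨fun q => F (PathConnectedSpace.somePath t t' q.1) σ.toMap q.2,
    ?_⟩, ?_, ?_⟩⟩ c
  · exact (hF Unit _ σ.isJetFamily).continuous.comp (((continuous_const (y := ())).prodMk
      ((PathConnectedSpace.somePath t t').continuous.comp continuous_fst)).prodMk continuous_snd)
  · intro b
    simp [map]
  · intro b
    simp [map]

/-- The value of a jet operator on a section, as a section constrained by the jets. -/
def single (hF : IsJetOperator S F) (σ : SectStop π c α S) (t : unitInterval)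
    (hcl : push 2 (hF.map σ t) c = α') : SectStop π c α' S where
  toMap := hF.map σ t
  is_section b := (hF Unit _ σ.isJetFamily).proj ((), t) b
  class_eq := hcl
  induces j := ((hF Unit _ σ.isJetFamily).comp (continuous_const (y := ((), t)))).induces j

/-- A jet operator as a homotopy between spaces of sections. -/
def sect (hF : IsJetOperator S F) (hcl : ∀ (σ : SectStop π c α S) t, push 2 (hF.map σ t) c = α')
    (σ : SectStop π c α S) (t : unitInterval) : SectStop π c α' S :=
  hF.single σ t (hcl σ t)

theorem continuous_sect (hF : IsJetOperator S F)
    (hcl : ∀ (σ : SectStop π c α S) t, push 2 (hF.map σ t) c = α') :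
    Continuous fun q : SectStop π c α S × unitInterval => hF.sect hcl q.1 q.2 := by
  have hfam : ∀ (K : Type) [TopologicalSpace K] [CompactSpace K] [T2Space K]
      (s : K → SectStop π c α S), IsFamily s →
      Continuous fun q : K × unitInterval => hF.sect hcl (s q.1) q.2 := fun K _ _ _ s hs =>
    (isFamily_iff.2 (hF K _ (isFamily_iff.1 hs))).continuous
  have hone : ∀ σ, Continuous fun t => hF.sect hcl σ t := fun σ =>
    (hfam Unit (fun _ => σ) (isFamily_iff.2 σ.isJetFamily)).comp (Continuous.prodMk_right ())
  -- Families test continuity on the space of sections but not on its product with the interval.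
  -- Currying removes the interval, and its local compactness allows the return.
  have hcurry : Continuous fun σ => (⟨fun t => hF.sect hcl σ t, hone σ⟩ :
      C(unitInterval, SectStop π c α' S)) := by
    refine continuous_of_families fun K _ _ _ s hs => ?_
    exact ContinuousMap.continuous_of_continuous_uncurry _ (hfam K s hs)
  exact ContinuousMap.continuous_uncurry_of_continuous ⟨_, hcurry⟩

theorem exists_continuousMap (hF : IsJetOperator S F)
    (hcl : ∀ (σ : SectStop π c α S) t, push 2 (hF.map σ t) c = α') :
    ∃ Q : C(SectStop π c α S, SectStop π c α' S), ∀ σ, ⇑(Q σ).toMap = F 0 σ.toMap :=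
  ⟨⟨fun σ => hF.sect hcl σ 0, (hF.continuous_sect hcl).comp (Continuous.prodMk_left 0)⟩,
    fun _ => rfl⟩

/-- The class is constant along the homotopy, so knowing it at time 1 places the whole homotopy in
the right space. -/
theorem exists_homotopic (hF : IsJetOperator S F)
    (Q₁ : C(SectStop π c α S, SectStop π c α' S)) (h₁ : ∀ σ, ⇑(Q₁ σ).toMap = F 1 σ.toMap) :
    ∃ Q₀ : C(SectStop π c α S, SectStop π c α' S), (∀ σ, ⇑(Q₀ σ).toMap = F 0 σ.toMap) ∧
      Q₀.Homotopic Q₁ := by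
  have hcl : ∀ (σ : SectStop π c α S) t, push 2 (hF.map σ t) c = α' := by
    intro σ t
    rw [hF.push_map_eq σ t 1, ← (Q₁ σ).class_eq]
    congr 2
    exact DFunLike.coe_injective (h₁ σ).symm
  refine ⟨⟨fun σ => hF.sect hcl σ 0,
    (hF.continuous_sect hcl).comp (Continuous.prodMk_left 0)⟩, fun _ => rfl,
    ⟨⟨⟨fun q => hF.sect hcl q.2 q.1, (hF.continuous_sect hcl).comp continuous_swap⟩,
      fun _ => rfl, fun σ => SectStop.ext_coe (h₁ σ).symm⟩⟩⟩

end IsJetOperator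

namespace Tube

variable {E : Type} [NormedAddCommGroup E] [NormedSpace ℝ E] {j₀ : J}
  {T : Tube π (S j₀).base E} [T2Space B] [CompactSpace B] {m : X → ℝ} {h h' : ℝ → ℝ} {c₀ c₁ : ℝ}

theorem IsAdapted.isJetOperator_attach (hT : T.IsAdapted S j₀) (Γ : T.Bubble)
    (hm : T.IsGauge m) (hh : IsStep h c₀ c₁) :
    IsJetOperator S fun _ σ => Γ.attach (T.rad m σ) h σ := fun K _ _ _ hσ =>
  (hT.isJetFamily_attach Γ hm hh hσ).comp (continuous_fst (X := K) (Y := unitInterval))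

/-- Attaching two opposite bubbles is homotopic to the identity. -/
theorem IsAdapted.exists_attach_attach_homotopic_id (hT : T.IsAdapted S j₀) (Γ : T.Bubble)
    (hm : T.IsGauge m) (hh : IsStep h c₀ c₁) (hh' : IsStep h' c₁ c₀) (c : H 2 B) (α : H 2 X) :
    ∃ Q : C(SectStop π c α S, SectStop π c α S),
      (∀ σ, ⇑(Q σ).toMap = Γ.attach (T.rad m (Γ.attach (T.rad m σ.toMap) h σ.toMap)) h'
        (Γ.attach (T.rad m σ.toMap) h σ.toMap)) ∧ Q.Homotopic (ContinuousMap.id _) := by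
  have hadm : ∀ σ : SectStop π c α S, T.IsAdmissible (T.rad m σ.toMap) σ.toMap := fun σ =>
    hT.isAdmissible_rad hm σ.isJetFamily ()
  -- The homotopies are built backwards from the identity: `Q₃` squeezes, `Q₂` inserts the doubled
  -- profile, and `Q₁` attaches twice after adjusting the second radius.
  obtain ⟨Q₃, hQ₃, h₃⟩ := (hT.isJetOperator_squeeze hm).exists_homotopic
    (ContinuousMap.id (SectStop π c α S)) fun σ => by
      simpa using ((hadm σ).squeeze_one σ.is_section).symm
  obtain ⟨Q₂, hQ₂, h₂⟩ := (hT.isJetOperator_profile Γ hm hh hh').exists_homotopic Q₃ fun σ => by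
    rw [hQ₃ σ]
    simp only [Set.Icc.coe_one, sub_self, zero_mul, one_mul, zero_add, Set.Icc.coe_zero]
    refine (Γ.insert_const (half_pos (hadm σ).pos) ?_ hh.right
      fun b hb => (hadm σ).squeeze_eq_e (by linarith [(hadm σ).pos])).symm
    linarith [(hadm σ).pos, (hadm σ).lt]
  obtain ⟨Q₁, hQ₁, h₁⟩ := (hT.isJetOperator_radius Γ hm hh hh').exists_homotopic Q₂ fun σ => by
    rw [hQ₂ σ]
    simp only [Set.Icc.coe_one, sub_self, zero_mul, one_mul, zero_add,
      Set.Icc.coe_zero, sub_zero, add_zero]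
    exact (Γ.attach_attach hh hh' (hadm σ)).symm
  refine ⟨Q₁, fun σ => ?_, (h₁.trans h₂).trans h₃⟩
  rw [hQ₁ σ]
  simp

/-- If attaching a bubble changes the classes of sections by `β`, it is a homotopy equivalence. -/
theorem IsAdapted.nonempty_homotopyEquiv (hT : T.IsAdapted S j₀) (Γ : T.Bubble)
    (hm : T.IsGauge m) {c : H 2 B} {β : H 2 X}
    (hclass : ∀ (γ : H 2 X) (σ : SectStop π c γ S) (τ : C(B, X)),
      ⇑τ = Γ.attach (T.rad m σ.toMap) ramp σ.toMap → push 2 τ c = γ + β) (α : H 2 X) :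
    Nonempty (ContinuousMap.HomotopyEquiv (SectStop π c α S) (SectStop π c (α + β) S)) := by
  have hup := hT.isJetOperator_attach Γ hm isStep_ramp
  have hdown := hT.isJetOperator_attach Γ hm isStep_one_sub_ramp
  obtain ⟨P, hP, hPid⟩ := hT.exists_attach_attach_homotopic_id Γ hm isStep_ramp
    isStep_one_sub_ramp c α
  obtain ⟨R, hR, hRid⟩ := hT.exists_attach_attach_homotopic_id Γ hm isStep_one_sub_ramp
    isStep_ramp c (α + β)
  obtain ⟨Φ, hΦ⟩ := hup.exists_continuousMap (c := c) (α := α) (α' := α + β)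
    fun σ t => hclass α σ _ rfl
  obtain ⟨Ψ, hΨ⟩ := hdown.exists_continuousMap (c := c) (α := α + β) (α' := α) fun σ t => by
    -- Attaching the positive bubble to the result of `hdown` gives `R σ`, of class α + β. As it
    -- adds β, the intermediate section has class α.
    have h1 := hclass _ (hdown.single σ t rfl) (R σ).toMap (hR σ)
    rw [(R σ).class_eq] at h1
    exact (add_right_cancel h1).symm
  refine ⟨⟨Φ, Ψ, ?_, ?_⟩⟩
  · have : Ψ.comp Φ = P := by
      ext1 σ
      refine SectStop.ext_coe ?_
      rw [ContinuousMap.comp_apply, hΨ, hΦ, hP]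
    rw [this]
    exact hPid
  · have : Φ.comp Ψ = R := by
      ext1 σ
      refine SectStop.ext_coe ?_
      rw [ContinuousMap.comp_apply, hΦ, hΨ, hR]
    rw [this]
    exact hRid

end Tube

end SectionSpaces

end
end SemiTop


namespace SemiTop
noncomputable section

/-! ### Construction of tubes and bubbles -/

/-- A Urysohn function for the center and the complement of the tube, rescaled by `δ`. -/
theorem Tube.exists_gauge {B X : Type} [TopologicalSpace B] [TopologicalSpace X] {π : X → B}
    [T2Space X] [CompactSpace X] {b₀ : B} {E : Type}
    [NormedAddCommGroup E] [NormedSpace ℝ E] (T : Tube π b₀ E) : ∃ m : X → ℝ, T.IsGauge m := by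
  obtain ⟨f, hf0, hf1, hf⟩ := exists_continuous_zero_one_of_isClosed
    (s := T.Wᶜ) (t := {T.e b₀}) T.isOpen_W.isClosed_compl isClosed_singleton
    (Set.disjoint_singleton_right.2 fun h => h (T.e_mem T.base_mem_disc))
  refine ⟨fun x => T.δ * f x, continuous_const.mul f.continuous,
    fun x => mul_nonneg T.δ_pos.le (hf x).1, fun x hx => ?_, ?_⟩
  · simp [hf0 hx]
  · simp [hf1 rfl]

section Construction

variable {B X : Type} [TopologicalSpace B] [ChartedSpace ℂ B] [IsManifold 𝓘(ℂ) ω B]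
  [TopologicalSpace X] {n : ℕ} [ChartedSpace (EuclideanSpace ℂ (Fin (n + 1))) X]
  [IsManifold 𝓘(ℂ, EuclideanSpace ℂ (Fin (n + 1))) ω X] {π : X → B}

theorem AdmissibleJet.eventually_continuousAt (j : AdmissibleJet n π) :
    ∀ᶠ b in 𝓝 j.base, ContinuousAt j.sec b := by
  have h := (contMDiffAt_iff_contMDiffAt_nhds (by simp)).1 j.analytic
  filter_upwards [h] with b hb
  exact hb.continuousAt

/-- The tube around the local section of a jet, in given coordinates. -/
theorem FiberCoordinates.exists_tube (hπ : Continuous π) {j : AdmissibleJet n π}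
    (φ : FiberCoordinates n π j.base (j.sec j.base)) {O : Set B} (hO : O ∈ 𝓝 j.base) :
    ∃ T : Tube π j.base (EuclideanSpace ℂ (Fin (n + 1))), T.z = φ.z ∧ T.disc ⊆ O ∧
      (∀ b ∈ T.disc, T.e b = j.sec b) ∧ ∀ (K : Type) (s : K → B → X), (∀ ξ b, π (s ξ b) = b) →
      (j.IsClose φ s ↔ ∀ ε > (0 : ℝ), ∀ᶠ b in 𝓝 j.base, ∀ ξ, s ξ b ∈ T.W ∧
        ‖T.V (s ξ b)‖ ≤ ε * ‖T.z b‖ ^ j.order) := by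
  obtain ⟨η, hη, hball⟩ := Metric.isOpen_iff.1 φ.w.open_target (φ.w (j.sec j.base))
    (φ.w.map_source φ.point_mem)
  rw [φ.w_point] at hball
  have hwsec : ∀ᶠ b in 𝓝 j.base, ‖φ.w (j.sec b)‖ < η / 2 := by
    have h1 : ContinuousAt (fun b => φ.w (j.sec b)) j.base :=
      ContinuousAt.comp (f := j.sec) (x := j.base) (φ.w.continuousAt φ.point_mem)
        j.analytic.continuousAt
    exact h1.norm.eventually_lt_const (by simpa [φ.w_point] using hη)
  have hev : ∀ᶠ b in 𝓝 j.base, b ∈ O ∧ b ∈ φ.z.source ∧ ContinuousAt j.sec b ∧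
      j.sec b ∈ φ.w.source ∧ π (j.sec b) = b ∧ ‖φ.w (j.sec b)‖ < η / 2 := by
    filter_upwards [hO, φ.z.open_source.mem_nhds φ.base_mem, j.eventually_continuousAt,
      j.eventually_sec_mem φ, j.is_section, hwsec] with b h1 h2 h3 h4 h5 h6
    exact ⟨h1, h2, h3, h4, h5, h6⟩
  obtain ⟨N, hN, hNo, hbN⟩ := eventually_nhds_iff.1 hev
  obtain ⟨δ, hδ, hδN⟩ : ∃ δ > 0, Metric.closedBall 0 δ ⊆ φ.z.target ∩ φ.z.symm ⁻¹' N := by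
    refine Metric.nhds_basis_closedBall.mem_iff.1 (Filter.inter_mem ?_ ?_)
    · rw [← φ.z_base]
      exact φ.z.open_target.mem_nhds (φ.z.map_source φ.base_mem)
    · rw [← φ.z_base]
      refine (φ.z.continuousAt_symm (φ.z.map_source φ.base_mem)).preimage_mem_nhds ?_
      rw [φ.z.left_inv φ.base_mem]
      exact hNo.mem_nhds hbN
  have hdN : ∀ b ∈ φ.z.source ∩ φ.z ⁻¹' Metric.closedBall 0 δ, b ∈ N := by
    intro b hb
    have := (hδN hb.2).2
    rwa [Set.mem_preimage, φ.z.left_inv hb.1] at this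
  -- The fiber coordinate is the displacement from the local section of the jet. In `dom` its zeroth
  -- component vanishes, so adding it does not leave the fiber; two displacements below `η / 2`
  -- remain in the ball of radius η.
  set V : X → EuclideanSpace ℂ (Fin (n + 1)) := fun x => φ.w x - φ.w (j.sec (π x)) with hV
  set A : Set X := φ.w.source ∩ π ⁻¹' N with hA
  have hAo : IsOpen A := φ.w.open_source.inter (hNo.preimage hπ)
  have hsecN : ContinuousOn (fun b => φ.w (j.sec b)) N := fun b hb =>
    (ContinuousAt.comp (f := j.sec) (x := b) (φ.w.continuousAt (hN b hb).2.2.2.1)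
      (hN b hb).2.2.1).continuousWithinAt
  have hVc : ContinuousOn V A :=
    (φ.w.continuousOn.mono Set.inter_subset_left).sub
      (hsecN.comp hπ.continuousOn fun x hx => hx.2)
  set dom : Set (EuclideanSpace ℂ (Fin (n + 1))) := {v | v 0 = 0 ∧ ‖v‖ < η / 2} with hdom
  have htar : ∀ b ∈ N, ∀ v ∈ dom, φ.w (j.sec b) + v ∈ φ.w.target := by
    intro b hb v hv
    refine hball ?_
    rw [mem_ball_zero_iff]
    refine (norm_add_le _ _).trans_lt ?_
    linarith [hv.2, (hN b hb).2.2.2.2.2]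
  have hproj : ∀ b ∈ N, ∀ v ∈ dom, π (φ.w.symm (φ.w (j.sec b) + v)) = b := by
    intro b hb v hv
    have h1 := φ.w.map_target (htar b hb v hv)
    refine φ.z.injOn (φ.maps _ h1) (hN b hb).2.1 ?_
    rw [← φ.w_zero _ h1, φ.w.right_inv (htar b hb v hv), PiLp.add_apply, hv.1, add_zero,
      φ.w_zero _ (hN b hb).2.2.2.1, (hN b hb).2.2.2.2.1]
  have hVΘ : ∀ b ∈ N, ∀ v ∈ dom, V (φ.w.symm (φ.w (j.sec b) + v)) = v := by
    intro b hb v hv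
    simp only [hV]
    rw [hproj b hb v hv, φ.w.right_inv (htar b hb v hv), add_sub_cancel_left]
  have hVz : ∀ x ∈ A, V x 0 = 0 := by
    intro x hx
    simp only [hV]
    rw [PiLp.sub_apply, φ.w_zero _ hx.1, φ.w_zero _ (hN _ hx.2).2.2.2.1, (hN _ hx.2).2.2.2.2.1,
      sub_self]
  let T : Tube π j.base (EuclideanSpace ℂ (Fin (n + 1))) :=
    { z := φ.z
      δ := δ
      δ_pos := hδ
      closedBall_subset := fun y hy => (hδN hy).1
      base_mem := φ.base_mem
      z_base := φ.z_base
      W := A ∩ V ⁻¹' Metric.ball 0 (η / 2)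
      isOpen_W := hVc.isOpen_inter_preimage hAo Metric.isOpen_ball
      dom := dom
      zero_mem := ⟨rfl, by simpa using hη⟩
      smul_mem := fun v hv t ht => by
        refine ⟨by rw [PiLp.smul_apply, hv.1, smul_zero], ?_⟩
        rw [norm_smul, Real.norm_of_nonneg ht.1]
        exact (mul_le_of_le_one_left (norm_nonneg _) ht.2).trans_lt hv.2
      V := V
      continuousOn_V := hVc.mono Set.inter_subset_left
      V_mem := fun x hx => ⟨hVz x hx.1, by simpa using hx.2⟩
      Θ := fun q => φ.w.symm (φ.w (j.sec q.1) + q.2)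
      continuousOn_Θ := by
        refine φ.w.continuousOn_symm.comp (ContinuousOn.add ?_ continuous_snd.continuousOn)
          fun q hq => htar _ (hdN _ hq.1) _ hq.2
        exact hsecN.comp continuous_fst.continuousOn fun q hq => hdN _ hq.1
      proj_Θ := fun b hb v hv => hproj b (hdN b hb) v hv
      Θ_mem := fun b hb v hv => by
        refine ⟨⟨φ.w.map_target (htar b (hdN b hb) v hv), ?_⟩, ?_⟩
        · rw [Set.mem_preimage, hproj b (hdN b hb) v hv]
          exact hdN b hb
        · rw [Set.mem_preimage, hVΘ b (hdN b hb) v hv, mem_ball_zero_iff]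
          exact hv.2
      V_Θ := fun b hb v hv => hVΘ b (hdN b hb) v hv
      Θ_V := fun x hx _ => by
        simp only [hV, add_sub_cancel]
        exact φ.w.left_inv hx.1.1 }
  refine ⟨T, rfl, fun b hb => (hN b (hdN b hb)).1, fun b hb => ?_, fun K s hs => ?_⟩
  · change φ.w.symm (φ.w (j.sec b) + 0) = j.sec b
    rw [add_zero, φ.w.left_inv (hN b (hdN b hb)).2.2.2.1]
  · have hVs : ∀ ξ b, V (s ξ b) = φ.w (s ξ b) - φ.w (j.sec b) := fun ξ b => by
      simp only [hV, hs]
    constructor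
    · intro h ε hε
      have h3 : ∀ᶠ b in 𝓝 j.base, ‖φ.z b‖ < 1 :=
        φ.tendsto_z.norm.eventually_lt_const (by simp)
      filter_upwards [h (min ε (η / 4)) (lt_min hε (by positivity)), hNo.mem_nhds hbN, h3]
        with b hb hbN hz ξ
      obtain ⟨h1, h2⟩ := hb ξ
      refine ⟨⟨⟨h1, by rw [Set.mem_preimage, hs]; exact hbN⟩, ?_⟩, ?_⟩
      · rw [Set.mem_preimage, hVs, mem_ball_zero_iff]
        refine h2.trans_lt ?_
        calc min ε (η / 4) * ‖φ.z b‖ ^ j.order ≤ η / 4 * 1 := by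
              gcongr
              · exact min_le_right _ _
              · exact pow_le_one₀ (norm_nonneg _) hz.le
          _ < η / 2 := by linarith
      · change ‖V (s ξ b)‖ ≤ _
        rw [hVs]
        refine h2.trans ?_
        gcongr
        exact min_le_left _ _
    · intro h ε hε
      filter_upwards [h ε hε] with b hb ξ
      refine ⟨(hb ξ).1.1.1, ?_⟩
      rw [← hVs]
      exact (hb ξ).2

/-- Discs in the fiber of a jet spread out to nearby fibers. -/
theorem AdmissibleJet.exists_discs [T2Space B] [CompactSpace B] [T2Space X]
    {j : AdmissibleJet n π} (hsub : ∀ x, π x = j.base → HasSubmersionChart n π x) {D : ℂ → X}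
    (hD : ContinuousOn D (Metric.closedBall 0 1))
    (hDπ : ∀ w ∈ Metric.closedBall (0 : ℂ) 1, π (D w) = j.base) (hD0 : D 0 = j.sec j.base)
    (hD1 : ∀ w : ℂ, ‖w‖ = 1 → D w = j.sec j.base) :
    ∃ N ∈ 𝓝 j.base, ∃ G : B × ℂ → X, ContinuousOn G (N ×ˢ Metric.closedBall 0 1) ∧
      (∀ b ∈ N, ∀ w ∈ Metric.closedBall (0 : ℂ) 1, π (G (b, w)) = b) ∧
      (∀ b ∈ N, G (b, 0) = j.sec b) ∧ (∀ b ∈ N, ∀ w : ℂ, ‖w‖ = 1 → G (b, w) = j.sec b) ∧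
      ∀ w ∈ Metric.closedBall (0 : ℂ) 1, G (j.base, w) = D w := by
  have hev : ∀ᶠ b in 𝓝 j.base, ContinuousAt j.sec b ∧ π (j.sec b) = b :=
    j.eventually_continuousAt.and j.is_section
  obtain ⟨N, ⟨hN, hNc⟩, hNs⟩ := (closed_nhds_basis j.base).mem_iff.1 hev
  have : CompactSpace (Metric.closedBall (0 : ℂ) 1) :=
    isCompact_iff_compactSpace.1 (ProperSpace.isCompact_closedBall 0 1)
  -- The lift is prescribed as the local section on the center and the boundary circle, so both keep
  -- mapping to it in the neighboring fibers.
  let M : Set (Metric.closedBall (0 : ℂ) 1) := {q | ‖(q : ℂ)‖ = 0} ∪ {q | ‖(q : ℂ)‖ = 1}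
  have hMc : IsClosed M :=
    (isClosed_eq continuous_subtype_val.norm continuous_const).union
      (isClosed_eq continuous_subtype_val.norm continuous_const)
  have hlift : IsFiberwiseLift π j.base (fun q : Metric.closedBall (0 : ℂ) 1 => D q) N M
      fun q => j.sec q.1 :=
    { continuousOn := fun q hq => ((hNs hq.1).1.comp (f := Prod.fst) (x := q)
        continuous_fst.continuousAt).continuousWithinAt
      proj := fun b hb q _ => (hNs hb).2
      base := fun q hq => by
        rcases hq with hq | hq
        · rw [norm_eq_zero.1 hq, hD0]
        · rw [hD1 q hq] }
  obtain ⟨N', hN', -, hN'N, g, hg, hgM⟩ := exists_fiberwiseLift hsub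
    (continuousOn_iff_continuous_domRestrict.1 hD) (fun q => hDπ q q.2) hN hNc hMc hlift
  -- Dividing by `max 1 ‖w‖` retracts the plane onto the closed disc, so the lift becomes defined
  -- for all w.
  have hmax : ∀ w : ℂ, 0 < max 1 ‖w‖ := fun w => lt_max_of_lt_left one_pos
  have hret : ∀ w : ℂ, w / (max 1 ‖w‖ : ℝ) ∈ Metric.closedBall (0 : ℂ) 1 := by
    intro w
    rw [mem_closedBall_zero_iff, norm_div, Complex.norm_real, Real.norm_of_nonneg (hmax w).le]
    exact div_le_one_of_le₀ (le_max_right _ _) (hmax w).le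
  have hid : ∀ (w : ℂ) (hw : w ∈ Metric.closedBall (0 : ℂ) 1),
      (⟨w / (max 1 ‖w‖ : ℝ), hret w⟩ : Metric.closedBall (0 : ℂ) 1) = ⟨w, hw⟩ := by
    intro w hw
    rw [mem_closedBall_zero_iff] at hw
    simp [max_eq_left hw]
  have hcont : Continuous fun w : ℂ =>
      (⟨w / (max 1 ‖w‖ : ℝ), hret w⟩ : Metric.closedBall (0 : ℂ) 1) := by
    refine Continuous.subtype_mk (continuous_id.div ?_ fun w => ?_) _
    · exact Complex.continuous_ofReal.comp (continuous_const.max continuous_norm)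
    · exact_mod_cast (hmax w).ne'
  refine ⟨N', hN', fun q => g (q.1, ⟨q.2 / (max 1 ‖q.2‖ : ℝ), hret q.2⟩), ?_, ?_, ?_, ?_, ?_⟩
  · exact hg.continuousOn.comp (continuous_fst.prodMk (hcont.comp continuous_snd)).continuousOn
      fun q hq => ⟨hq.1, trivial⟩
  · exact fun b hb w _ => hg.proj b hb _ trivial
  · intro b hb
    dsimp only
    rw [hid 0 (by simp)]
    exact hgM b hb _ (Or.inl norm_zero)
  · intro b hb w hw
    dsimp only
    rw [hid w (by simp [hw])]
    exact hgM b hb _ (Or.inr hw)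
  · intro w hw
    dsimp only
    rw [hid w hw]
    exact hg.base _ trivial

end Construction

end
end SemiTop


namespace SemiTop
noncomputable section

/-! ### The class of a section with a bubble -/

section CoordinateDiscs

variable {B : Type} [TopologicalSpace B] [ChartedSpace ℂ B]

/-- The dilation of the disc of radius `a` onto the unit disc. -/
def dilation {a : ℝ} (ha : 0 < a) : OpenPartialHomeomorph ℂ ℂ :=
  (Homeomorph.mulLeft₀ ((a : ℂ)⁻¹)
    (inv_ne_zero (Complex.ofReal_ne_zero.2 ha.ne'))).toOpenPartialHomeomorphOfImageEq
      (Metric.ball 0 a) Metric.isOpen_ball (Metric.ball 0 1) (by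
        rw [Homeomorph.image_eq_preimage_symm]
        ext w
        simp [abs_of_pos ha, mul_comm, ha])

theorem dilation_mem {a : ℝ} (ha : 0 < a) : dilation ha ∈ contDiffGroupoid ω 𝓘(ℂ) := by
  refine mem_groupoid_of_pregroupoid.2 ⟨?_, ?_⟩
  · simp only [contDiffPregroupoid]
    exact (contDiff_const.mul contDiff_id).contDiffOn
  · simp only [contDiffPregroupoid]
    exact (contDiff_const.mul contDiff_id).contDiffOn

theorem trans_mem_maximalAtlas {z : OpenPartialHomeomorph B ℂ}
    (hz : z ∈ IsManifold.maximalAtlas 𝓘(ℂ) ω B) {D : OpenPartialHomeomorph ℂ ℂ}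
    (hD : D ∈ contDiffGroupoid ω 𝓘(ℂ)) : z.trans D ∈ IsManifold.maximalAtlas 𝓘(ℂ) ω B := by
  refine mem_maximalAtlas_iff.2 fun e he => ?_
  obtain ⟨h1, h2⟩ := mem_maximalAtlas_iff.1 hz e he
  constructor
  · rw [OpenPartialHomeomorph.trans_symm_eq_symm_trans_symm, OpenPartialHomeomorph.trans_assoc]
    exact (contDiffGroupoid ω 𝓘(ℂ)).trans ((contDiffGroupoid ω 𝓘(ℂ)).symm hD) h1
  · rw [← OpenPartialHomeomorph.trans_assoc]
    exact (contDiffGroupoid ω 𝓘(ℂ)).trans h2 hD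

/-- The radial map from the plane to the sphere which is a homeomorphism from the open unit disc
to `ℂ` and sends everything else to `∞`. -/
def expand : ℂ → OnePoint ℂ :=
  collapseFun (OpenPartialHomeomorph.univUnitBall (E := ℂ)).symm

theorem continuous_expand : Continuous expand :=
  continuous_collapseFun _ rfl

theorem mem_source_univUnitBall_symm {v : ℂ} :
    v ∈ (OpenPartialHomeomorph.univUnitBall (E := ℂ)).symm.source ↔ ‖v‖ < 1 :=
  mem_ball_zero_iff

theorem expand_of_lt {v : ℂ} (hv : ‖v‖ < 1) :
    expand v = (((OpenPartialHomeomorph.univUnitBall (E := ℂ)).symm v : ℂ) : OnePoint ℂ) :=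
  if_pos (mem_source_univUnitBall_symm.2 hv)

theorem expand_of_le {v : ℂ} (hv : 1 ≤ ‖v‖) : expand v = OnePoint.infty :=
  if_neg fun h => not_lt.2 hv (mem_source_univUnitBall_symm.1 h)

theorem expand_zero : expand 0 = ((0 : ℂ) : OnePoint ℂ) := by
  rw [expand_of_lt (by simp)]
  simp

/-- The collapse map of the coordinate disc `|z| < a`. -/
theorem exists_collapse_eq [T2Space B] {z : OpenPartialHomeomorph B ℂ}
    (hz : z ∈ IsManifold.maximalAtlas 𝓘(ℂ) ω B) {a : ℝ} (ha : 0 < a)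
    (hza : Metric.ball 0 a ⊆ z.target) :
    ∃ ψ ∈ IsManifold.maximalAtlas 𝓘(ℂ) ω B, ∃ hψ : ψ.target = Metric.ball 0 1,
      (∀ b ∈ z.source, collapse ψ hψ b = expand ((a : ℂ)⁻¹ * z b)) ∧
      ∀ b ∉ z.source, collapse ψ hψ b = OnePoint.infty := by
  have hψ : (z.trans (dilation ha)).target = Metric.ball 0 1 := by
    rw [OpenPartialHomeomorph.trans_target]
    refine Set.inter_eq_left.2 fun w hw => hza ?_
    exact (dilation ha).map_target hw
  refine ⟨z.trans (dilation ha), trans_mem_maximalAtlas hz (dilation_mem ha), hψ, ?_, ?_⟩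
  · intro b hb
    by_cases hba : z b ∈ Metric.ball 0 a
    · have h1 : b ∈ (z.trans (dilation ha)).source := ⟨hb, hba⟩
      have h2 : (a : ℂ)⁻¹ * z b ∈ Metric.ball (0 : ℂ) 1 := (dilation ha).map_source hba
      have h3 : b ∈ ((z.trans (dilation ha)).trans
          (OpenPartialHomeomorph.univUnitBall (E := ℂ)).symm).source := ⟨h1, h2⟩
      rw [expand_of_lt (mem_ball_zero_iff.1 h2)]
      exact if_pos h3
    · have h3 : b ∉ ((z.trans (dilation ha)).trans
          (OpenPartialHomeomorph.univUnitBall (E := ℂ)).symm).source := fun h => hba h.1.2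
      rw [expand_of_le]
      · exact if_neg h3
      · rw [mem_ball_zero_iff, not_lt] at hba
        rw [norm_mul, norm_inv, Complex.norm_real, Real.norm_of_nonneg ha.le,
          inv_mul_eq_div, one_le_div ha]
        exact hba
  · intro b hb
    have h3 : b ∉ ((z.trans (dilation ha)).trans
        (OpenPartialHomeomorph.univUnitBall (E := ℂ)).symm).source := fun h => hb h.1.1
    exact if_neg h3

end CoordinateDiscs

/-! ### The sphere with two tails, in polar form. -/

section Profiles

/-- The direction `v / ‖v‖` jumps at `v = 0`, but the radial factor vanishes there. -/
theorem continuousAt_max_mul_direction {Y : Type*} [TopologicalSpace Y] {x : Y → ℝ} {v : Y → ℂ}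
    {y : Y} (hx : ContinuousAt x y) (hv : ContinuousAt v y) (h : v y = 0 → x y ≤ 0) :
    ContinuousAt (fun y => ((max (x y) 0 : ℝ) : ℂ) * (v y / ‖v y‖)) y := by
  have hm : ContinuousAt (fun y => max (x y) 0) y := hx.max continuousAt_const
  by_cases hvy : v y = 0
  · have h0 : Filter.Tendsto (fun y => max (x y) 0) (𝓝 y) (𝓝 0) := by
      have := hm.tendsto
      rwa [max_eq_right (h hvy)] at this
    rw [ContinuousAt, hvy]
    simp only [norm_zero, Complex.ofReal_zero, div_zero, mul_zero]
    refine squeeze_zero_norm (fun y' => ?_) h0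
    rw [norm_mul, Complex.norm_real, Real.norm_of_nonneg (le_max_right _ _), norm_div,
      Complex.norm_real, norm_norm]
    exact mul_le_of_le_one_right (le_max_right _ _) (div_self_le_one _)
  · refine (Complex.continuous_ofReal.continuousAt.comp hm).mul (hv.div ?_ ?_)
    · exact Complex.continuous_ofReal.continuousAt.comp hv.norm
    · simpa using hvy

theorem norm_max_mul_direction {x : ℝ} {v : ℂ} (h : v = 0 → x ≤ 0) :
    ‖((max x 0 : ℝ) : ℂ) * (v / ‖v‖)‖ = max x 0 := by
  rw [norm_mul, Complex.norm_real, Real.norm_of_nonneg (le_max_right _ _), norm_div,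
    Complex.norm_real, norm_norm]
  by_cases hv : v = 0
  · simp [hv, h hv]
  · rw [div_self (norm_ne_zero_iff.2 hv), mul_one]

variable {X : Type} [TopologicalSpace X] (f : C(OnePoint ℂ, X)) {p : X}
  (γ₀ : Path p (f ((0 : ℂ) : OnePoint ℂ))) (γ₁ : Path (f OnePoint.infty) p)

/-- The map that runs through the path `γ₀` for `-1 ≤ x ≤ 0`, through `f` along a ray from `0` to
`∞` for `0 ≤ x ≤ 1`, and through `γ₁` for `1 ≤ x ≤ 2`. -/
def tailed (x : ℝ) (y : ℂ) : X :=
  if x ≤ 0 then γ₀.extend (1 + x) else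
    if x ≤ 1 then f (expand y) else
      γ₁.extend (x - 1)

theorem tailed_of_mem {x : ℝ} {y : ℂ} (h0 : 0 ≤ x) (h1 : x ≤ 1) (hy : ‖y‖ = x) :
    tailed f γ₀ γ₁ x y = f (expand y) := by
  unfold tailed
  split_ifs with h
  · obtain rfl : x = 0 := le_antisymm h h0
    rw [norm_eq_zero.1 hy, expand_zero, add_zero, γ₀.extend_one]
  · rfl

theorem tailed_neg_one (y : ℂ) : tailed f γ₀ γ₁ (-1) y = p := by
  simp [tailed]

theorem tailed_of_ge {x : ℝ} {y : ℂ} (h : 1 ≤ x) (hy : 1 ≤ ‖y‖) :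
    tailed f γ₀ γ₁ x y = γ₁.extend (x - 1) := by
  unfold tailed
  rw [if_neg (by linarith)]
  split_ifs with h1
  · obtain rfl : x = 1 := le_antisymm h1 h
    rw [expand_of_le hy, sub_self, γ₁.extend_zero]
  · rfl

theorem continuousOn_tailed : ContinuousOn (fun q : ℝ × ℂ => tailed f γ₀ γ₁ q.1 q.2)
    {q | ‖q.2‖ = max q.1 0} := by
  rw [continuousOn_iff_continuous_domRestrict]
  change Continuous fun q : {q : ℝ × ℂ | ‖q.2‖ = max q.1 0} => tailed f γ₀ γ₁ q.1.1 q.1.2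
  have hx : Continuous fun q : {q : ℝ × ℂ | ‖q.2‖ = max q.1 0} => q.1.1 :=
    continuous_fst.comp continuous_subtype_val
  have hy : Continuous fun q : {q : ℝ × ℂ | ‖q.2‖ = max q.1 0} => q.1.2 :=
    continuous_snd.comp continuous_subtype_val
  unfold tailed
  refine Continuous.if_le (γ₀.continuous_extend.comp (continuous_const.add hx))
    (Continuous.if_le (f.continuous.comp (continuous_expand.comp hy))
      (γ₁.continuous_extend.comp (hx.sub continuous_const)) hx continuous_const ?_)
    hx continuous_const ?_
  · rintro ⟨⟨x, y⟩, hq⟩ h1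
    simp only [Set.mem_ofPred_eq] at hq h1
    subst h1
    change f (expand y) = γ₁.extend (1 - 1)
    rw [expand_of_le (by rw [hq]; simp), sub_self, γ₁.extend_zero]
  · rintro ⟨⟨x, y⟩, hq⟩ h1
    simp only [Set.mem_ofPred_eq] at hq h1
    subst h1
    have hy0 : y = 0 := by simpa using hq
    simp [hy0, expand_zero]

theorem forall_tailed {P : X → Prop} (h₀ : ∀ t, P (γ₀ t)) (hf : ∀ q, P (f q))
    (h₁ : ∀ t, P (γ₁ t)) (x : ℝ) (y : ℂ) : P (tailed f γ₀ γ₁ x y) := by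
  unfold tailed
  split_ifs
  · exact h₀ _
  · exact hf _
  · exact h₁ _

end Profiles

end
end SemiTop


namespace SemiTop
noncomputable section

/-! ### The disc over `b₀` and the deformations that compute its class. -/

section TailedDisc

variable {X : Type} [TopologicalSpace X] (f : C(OnePoint ℂ, X)) {p : X}
  (γ₀ : Path p (f ((0 : ℂ) : OnePoint ℂ))) (γ₁ : Path (f OnePoint.infty) p)

/-- The disc obtained from the sphere `f` by two tails from `0` and `∞` to the point `p`. -/
def tailedDisc (w : ℂ) : X :=
  tailed f γ₀ γ₁ (3 * ‖w‖ - 1) (((max (3 * ‖w‖ - 1) 0 : ℝ) : ℂ) * (w / ‖w‖))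

theorem continuous_tailedDisc : Continuous (tailedDisc f γ₀ γ₁) := by
  have h : ∀ w : ℂ, w = 0 → 3 * ‖w‖ - 1 ≤ 0 := by
    rintro w rfl
    simp
  have hx : Continuous fun w : ℂ => 3 * ‖w‖ - 1 := by fun_prop
  have hy : Continuous fun w : ℂ => ((max (3 * ‖w‖ - 1) 0 : ℝ) : ℂ) * (w / ‖w‖) :=
    continuous_iff_continuousAt.2 fun w =>
      continuousAt_max_mul_direction (v := id) hx.continuousAt continuousAt_id (h w)
  exact (continuousOn_tailed f γ₀ γ₁).comp_continuous (hx.prodMk hy) fun w =>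
    norm_max_mul_direction (h w)

theorem tailedDisc_zero : tailedDisc f γ₀ γ₁ 0 = p := by
  unfold tailedDisc
  rw [norm_zero, mul_zero, zero_sub, tailed_neg_one]

theorem tailedDisc_of_norm_eq_one {w : ℂ} (hw : ‖w‖ = 1) : tailedDisc f γ₀ γ₁ w = p := by
  have h0 : w = 0 → 3 * ‖w‖ - 1 ≤ 0 := by
    rintro rfl
    simp
  unfold tailedDisc
  rw [tailed_of_ge]
  · rw [hw]
    norm_num
  · rw [hw]
    norm_num
  · rw [norm_max_mul_direction h0, hw]
    norm_num

end TailedDisc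

namespace Tube

variable {B X : Type} [TopologicalSpace B] [TopologicalSpace X] {π : X → B} {b₀ : B} {E : Type}
  [NormedAddCommGroup E] [NormedSpace ℝ E] (T : Tube π b₀ E)

open Classical in
/-- A map to the coordinate disc which is the identity near `b₀` for `t = 0` and constant
for `t = 1`. -/
def shrink (r t : ℝ) (b : B) : B :=
  if T.ζ b ≤ r then T.z.symm (((1 - t) * (1 - ramp (2 * (T.ζ b / r) - 1)) : ℝ) * T.z b) else b₀

theorem z_symm_zero : T.z.symm 0 = b₀ := by
  rw [← T.z_base, T.z.left_inv T.base_mem]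

theorem z_symm_mem {v : ℂ} (hv : v ∈ Metric.closedBall 0 T.δ) : T.z.symm v ∈ T.disc :=
  ⟨T.z.map_target (T.closedBall_subset hv), by
    rw [Set.mem_preimage, T.z.right_inv (T.closedBall_subset hv)]
    exact hv⟩

variable {r : ℝ}

theorem shrink_one (b : B) : T.shrink r 1 b = b₀ := by
  simp [shrink, T.z_symm_zero]

theorem shrink_zero (hr : 0 < r) (hrδ : r < T.δ) {b : B} (hb : T.ζ b ≤ 3 / 4 * r) :
    T.shrink r 0 b = b := by
  have h1 : ramp (2 * (T.ζ b / r) - 1) = 0 := by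
    refine ramp_of_le ?_
    have := (div_le_iff₀ hr).2 hb
    linarith
  rw [shrink, if_pos (by linarith), h1]
  simp [T.z.left_inv (T.mem_disc_of_lt (show T.ζ b < T.δ by linarith)).1.1]

theorem shrink_factor_mem {t : ℝ} (ht : t ∈ Set.Icc (0 : ℝ) 1) (x : ℝ) :
    (1 - t) * (1 - ramp x) ∈ Set.Icc (0 : ℝ) 1 := by
  obtain ⟨h1, h2⟩ := ramp_mem x
  obtain ⟨h3, h4⟩ := ht
  exact ⟨mul_nonneg (by linarith) (by linarith), by nlinarith⟩

theorem shrink_arg_mem (hrδ : r < T.δ) {t : ℝ} (ht : t ∈ Set.Icc (0 : ℝ) 1) {b : B}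
    (hb : T.ζ b ≤ r) (x : ℝ) :
    (((1 - t) * (1 - ramp x) : ℝ) : ℂ) * T.z b ∈ Metric.closedBall 0 T.δ := by
  obtain ⟨h1, h2⟩ := shrink_factor_mem ht x
  rw [mem_closedBall_zero_iff, norm_mul, Complex.norm_real, Real.norm_of_nonneg h1,
    ← (T.mem_disc_of_lt (hb.trans_lt hrδ)).2]
  exact (mul_le_of_le_one_left (T.ζ_nonneg b) h2).trans (hb.trans hrδ.le)

theorem shrink_mem (hrδ : r < T.δ) {t : ℝ} (ht : t ∈ Set.Icc (0 : ℝ) 1) (b : B) :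
    T.shrink r t b ∈ T.disc := by
  unfold shrink
  split_ifs with hb
  · exact T.z_symm_mem (T.shrink_arg_mem hrδ ht hb _)
  · exact T.base_mem_disc

theorem continuous_shrink [T2Space B] (hr : 0 < r) (hrδ : r < T.δ) :
    Continuous fun q : unitInterval × B => T.shrink r q.1 q.2 := by
  have hζ : Continuous fun q : unitInterval × B => T.ζ q.2 := T.continuous_ζ.comp continuous_snd
  have ht : Continuous fun q : unitInterval × B => (q.1 : ℝ) :=
    continuous_subtype_val.comp continuous_fst
  unfold shrink
  refine continuous_if_le hζ continuous_const ?_ continuousOn_const ?_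
  · refine (T.z.continuousOn_symm.mono T.closedBall_subset).comp
      (f := fun q : unitInterval × B =>
        (((1 - (q.1 : ℝ)) * (1 - ramp (2 * (T.ζ q.2 / r) - 1)) : ℝ) : ℂ) * T.z q.2)
      (ContinuousOn.mul ?_ ?_) fun q hq => T.shrink_arg_mem hrδ q.1.2 hq _
    · refine (Complex.continuous_ofReal.comp ((continuous_const.sub ht).mul
        (continuous_const.sub (continuous_ramp.comp ?_)))).continuousOn
      exact (continuous_const.mul (hζ.div_const r)).sub continuous_const
    · exact T.z.continuousOn.comp continuous_snd.continuousOn fun q hq =>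
        (T.mem_disc_of_lt (lt_of_le_of_lt hq hrδ)).1.1
  · intro q hq
    rw [hq, div_self hr.ne', ramp_of_ge (by norm_num)]
    simp [T.z_symm_zero]

variable {T}

section BubbleClass

variable {f : C(OnePoint ℂ, X)} {γ₀ : Path (T.e b₀) (f ((0 : ℂ) : OnePoint ℂ))}
  {γ₁ : Path (f OnePoint.infty) (T.e b₀)}

variable (T f γ₀ γ₁) in
open Classical in
/-- A homotopy from the sphere with tails to the sphere `f`, as maps from the coordinate disc of
radius `a`, constant outside it. -/
def retract (a s : ℝ) (b : B) : X :=
  if T.ζ b ≤ a then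
    tailed f γ₀ γ₁ ((1 - s) * (3 * ramp (T.ζ b / a) - 1) + s * (T.ζ b / a))
      (((max ((1 - s) * (3 * ramp (T.ζ b / a) - 1) + s * (T.ζ b / a)) 0 : ℝ) : ℂ) * T.u b)
  else γ₁.extend (1 - s)

theorem continuous_retract [T2Space B] {a : ℝ} (ha : 0 < a) (haδ : a < T.δ) :
    Continuous fun q : unitInterval × B => T.retract f γ₀ γ₁ a q.1 q.2 := by
  have hζ : Continuous fun q : unitInterval × B => T.ζ q.2 := T.continuous_ζ.comp continuous_snd
  have hs : Continuous fun q : unitInterval × B => (q.1 : ℝ) :=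
    continuous_subtype_val.comp continuous_fst
  set x : unitInterval × B → ℝ := fun q =>
    (1 - (q.1 : ℝ)) * (3 * ramp (T.ζ q.2 / a) - 1) + q.1 * (T.ζ q.2 / a) with hx
  have hxc : Continuous x :=
    ((continuous_const.sub hs).mul ((continuous_const.mul
      (continuous_ramp.comp (hζ.div_const a))).sub continuous_const)).add
      (hs.mul (hζ.div_const a))
  have hzero : ∀ q : unitInterval × B, T.ζ q.2 ≤ a → T.z q.2 = 0 → x q ≤ 0 := by
    intro q hq hz
    have h0 : T.ζ q.2 = 0 := by rw [(T.mem_disc_of_lt (hq.trans_lt haδ)).2, hz, norm_zero]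
    simp only [hx, h0, zero_div, mul_zero, add_zero, ramp_of_le (show (0 : ℝ) ≤ 1 / 2 by norm_num)]
    linarith [q.1.2.2]
  unfold retract
  refine continuous_if_le hζ continuous_const ?_ ?_ ?_
  · refine (continuousOn_tailed f γ₀ γ₁).comp
      (f := fun q : unitInterval × B => (x q, ((max (x q) 0 : ℝ) : ℂ) * T.u q.2))
      (hxc.continuousOn.prodMk fun q hq => ?_)
      fun q hq => norm_max_mul_direction (hzero q hq)
    refine (continuousAt_max_mul_direction (v := fun q : unitInterval × B => T.z q.2)
      hxc.continuousAt ?_ (hzero q hq)).continuousWithinAt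
    exact ContinuousAt.comp (f := Prod.snd) (x := q)
      (T.z.continuousAt (T.mem_disc_of_lt (lt_of_le_of_lt hq haδ)).1.1) continuousAt_snd
  · exact (γ₁.continuous_extend.comp (continuous_const.sub hs)).continuousOn
  · intro q hq
    -- On the rim the parameter is 2 - s, that is the point 1 - s of the tail `γ₁`, the constant
    -- value outside. The outer tail and the outside thus retract together to `f ∞`.
    have h1 : x q = 2 - q.1 := by
      simp only [hx, hq, div_self ha.ne', ramp_of_ge le_rfl]
      ring
    have h2 : 1 ≤ x q := by
      rw [h1]
      linarith [q.1.2.2]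
    change tailed f γ₀ γ₁ (x q) (((max (x q) 0 : ℝ) : ℂ) * T.u q.2) = _
    rw [tailed_of_ge f γ₀ γ₁ h2]
    · rw [h1]
      congr 1
      ring
    · rw [u, norm_max_mul_direction (hzero q hq.le)]
      exact le_max_of_le_left h2

theorem retract_zero (Γ : T.Bubble) {a : ℝ} (ha : 0 < a) (haδ : a < T.δ)
    (hG : ∀ w ∈ Metric.closedBall (0 : ℂ) 1, Γ.G (b₀, w) = tailedDisc f γ₀ γ₁ w) (b : B) :
    T.retract f γ₀ γ₁ a 0 b = Γ.insertAlong (fun _ => b₀) a ramp (fun _ => T.e b₀) b := by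
  unfold retract Bubble.insertAlong
  simp only [sub_zero, one_mul, zero_mul, add_zero]
  by_cases h1 : T.ζ b ≤ a
  · rw [if_pos h1]
    by_cases h2 : a / 8 ≤ T.ζ b
    · have h0 : 0 < T.ζ b := lt_of_lt_of_le (by positivity) h2
      have hδ : T.ζ b < T.δ := h1.trans_lt haδ
      have hm := ramp_mem (T.ζ b / a)
      rw [if_pos ⟨h2, h1⟩, hG _ (Bubble.mul_u_mem h0 hδ hm), tailedDisc, norm_mul,
        T.norm_u h0 hδ, mul_one, Complex.norm_real, Real.norm_of_nonneg hm.1]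
      rcases hm.1.eq_or_lt with h | h
      · rw [← h]
        norm_num
      · rw [mul_div_right_comm, div_self (Complex.ofReal_ne_zero.2 h.ne'), one_mul]
    · rw [if_neg fun h => h2 h.1, ramp_of_le]
      · rw [mul_zero, zero_sub, tailed_neg_one]
      · rw [div_le_iff₀ ha]
        linarith
  · rw [if_neg h1, if_neg fun h => h1 h.2, γ₁.extend_one]

theorem retract_one {a : ℝ} (ha : 0 < a) (haδ : a < T.δ) (b : B) :
    T.retract f γ₀ γ₁ a 1 b = f (if T.ζ b ≤ a then expand ((a : ℂ)⁻¹ * T.z b)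
      else OnePoint.infty) := by
  unfold retract
  simp only [sub_self, zero_mul, one_mul, zero_add]
  split_ifs with h
  · have hζ := (T.mem_disc_of_lt (h.trans_lt haδ)).2
    have h0 : 0 ≤ T.ζ b / a := div_nonneg (T.ζ_nonneg b) ha.le
    have hy : ((T.ζ b / a : ℝ) : ℂ) * T.u b = (a : ℂ)⁻¹ * T.z b := by
      rw [u, hζ]
      by_cases hz : T.z b = 0
      · simp [hz]
      · have : (‖T.z b‖ : ℂ) ≠ 0 := by simpa using hz
        push_cast
        field_simp
    rw [max_eq_left h0, hy, tailed_of_mem f γ₀ γ₁ h0 (div_le_one_of_le₀ h ha.le)]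
    rw [norm_mul, norm_inv, Complex.norm_real, Real.norm_of_nonneg ha.le, ← hζ, inv_mul_eq_div]
  · rw [γ₁.extend_zero]

/-- Attaching a bubble made of the sphere `f` adds the class of `f`. -/
theorem Bubble.push_attach [T2Space B] [ChartedSpace ℂ B] (Γ : T.Bubble)
    (hz : T.z ∈ IsManifold.maximalAtlas 𝓘(ℂ) ω B)
    (hG : ∀ w ∈ Metric.closedBall (0 : ℂ) 1, Γ.G (b₀, w) = tailedDisc f γ₀ γ₁ w)
    {o : H 2 (OnePoint ℂ)} {c : H 2 B} (hc : IsFundamentalClass o c) {σ : B → X}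
    (hr : T.IsAdmissible r σ) {τ q : C(B, X)} (hτ : ⇑τ = Γ.attach r ramp σ)
    (hq : ⇑q = T.squeeze 0 r σ) : push 2 τ c = push 2 q c + push 2 f o := by
  have h0 := hr.pos
  have hδ := hr.lt
  have ha : 0 < r / 2 := half_pos h0
  have haδ : r / 2 < T.δ := by linarith
  have hsh := T.continuous_shrink h0 hδ
  have hE : Continuous fun q : unitInterval × B => T.e (T.shrink r q.1 q.2) :=
    T.continuousOn_e.comp_continuous hsh fun q => T.shrink_mem hδ q.1.2 q.2
  have hA : Continuous fun q : unitInterval × B => Γ.insertAlong (T.shrink r q.1) (r / 2) ramp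
      (fun b => T.e (T.shrink r q.1 b)) q.2 :=
    Γ.continuous_insertAlong (K := unitInterval) (θ := fun t => T.shrink r t)
      (a := fun _ => r / 2) (k := fun _ => ramp) (τ := fun t b => T.e (T.shrink r t b))
      continuous_const (fun _ => ha) (fun _ => haδ) hsh
      (fun t b _ => T.shrink_mem hδ t.2 b) (continuous_ramp.comp continuous_snd)
      (fun _ => isStep_ramp.isProfile) hE fun _ _ _ => rfl
  -- `E'` and `A` are the local section and the local section with a bubble, both pulled back along
  -- `shrink`. At time 0 they agree near `b₀` with `q` and `τ`; at time 1 they lie in the fiber over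
  -- `b₀`. Then `R` retracts the tails.
  let E' : unitInterval → C(B, X) := fun t =>
    ⟨fun b => T.e (T.shrink r t b), hE.comp (Continuous.prodMk_right t)⟩
  let A : unitInterval → C(B, X) := fun t =>
    ⟨Γ.insertAlong (T.shrink r t) (r / 2) ramp (fun b => T.e (T.shrink r t b)),
      hA.comp (Continuous.prodMk_right t)⟩
  let R : unitInterval → C(B, X) := fun t =>
    ⟨T.retract f γ₀ γ₁ (r / 2) t,
      (continuous_retract ha haδ).comp (Continuous.prodMk_right t)⟩
  have hE0 : push 2 (E' 0) c = 0 := by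
    have h1 : push 2 (E' 0) c = push 2 (E' 1) c :=
      push_eq_of_homotopic ⟨⟨⟨fun q => T.e (T.shrink r q.1 q.2), hE⟩, fun _ => rfl,
        fun _ => rfl⟩⟩ c
    have h2 : E' 1 = ContinuousMap.const B (T.e b₀) := by
      ext b
      change T.e (T.shrink r 1 b) = T.e b₀
      rw [T.shrink_one]
    rw [h1, h2]
    exact push_const_eq_zero two_ne_zero _ _
  have hA01 : push 2 (A 0) c = push 2 (A 1) c :=
    push_eq_of_homotopic ⟨⟨⟨fun q => Γ.insertAlong (T.shrink r q.1) (r / 2) ramp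
      (fun b => T.e (T.shrink r q.1 b)) q.2, hA⟩, fun _ => rfl, fun _ => rfl⟩⟩ c
  have hAR : A 1 = R 0 := by
    ext b
    change Γ.insertAlong (T.shrink r 1) (r / 2) ramp (fun b => T.e (T.shrink r 1 b)) b =
      T.retract f γ₀ γ₁ (r / 2) 0 b
    have : T.shrink r 1 = fun _ => b₀ := funext fun b => T.shrink_one b
    rw [this, retract_zero Γ ha haδ hG]
  have hR01 : push 2 (R 0) c = push 2 (R 1) c :=
    push_eq_of_homotopic ⟨⟨⟨fun q => T.retract f γ₀ γ₁ (r / 2) q.1 q.2,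
      continuous_retract ha haδ⟩, fun _ => rfl, fun _ => rfl⟩⟩ c
  -- Without tails, the map is `f` after the collapse of the coordinate disc of radius `r/2`, which
  -- sends the fundamental class to `o`.
  have hR1 : push 2 (R 1) c = push 2 f o := by
    obtain ⟨ψ, hψm, hψ, hin, hout⟩ := exists_collapse_eq hz ha
      (Metric.ball_subset_closedBall.trans ((Metric.closedBall_subset_closedBall haδ.le).trans
        T.closedBall_subset))
    have : R 1 = f.comp (collapse ψ hψ) := by
      ext b
      change T.retract f γ₀ γ₁ (r / 2) 1 b = f (collapse ψ hψ b)
      rw [retract_one ha haδ]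
      congr 1
      split_ifs with h
      · exact (hin b (T.mem_disc_of_lt (h.trans_lt haδ)).1.1).symm
      · by_cases hb : b ∈ T.z.source
        · rw [hin b hb, expand_of_le]
          have h1 : r / 2 < ‖T.z b‖ := by
            simp only [ζ, hb, if_true, not_le] at h
            exact h.trans_le (min_le_left _ _)
          rw [norm_mul, norm_inv, Complex.norm_real, Real.norm_of_nonneg ha.le,
            inv_mul_eq_div, one_le_div ha]
          exact h1.le
        · exact (hout b hb).symm
    rw [this, push_comp, hc ψ hψm hψ]
  -- On `U` the section is squeezed onto `e` and `shrink` is the identity; on `V` no bubble is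
  -- present. So `τ` differs from `q` in homology as `A 0` does from `E' 0`.
  have hadd := push_add_push_eq (n := 1) (U := {b | T.ζ b < 3 / 4 * r}) (V := {b | r / 2 < T.ζ b})
    (isOpen_lt T.continuous_ζ continuous_const) (isOpen_lt continuous_const T.continuous_ζ)
    (Set.eq_univ_of_forall fun b => by
      rcases lt_or_ge (T.ζ b) (3 / 4 * r) with h | h
      · exact Or.inl h
      · exact Or.inr (by change r / 2 < T.ζ b; linarith))
    (f₁ := τ) (f₂ := q) (f₃ := A 0) (f₄ := E' 0)
    (fun b hb => by
      change τ b = Γ.insertAlong (T.shrink r 0) (r / 2) ramp (fun b => T.e (T.shrink r 0 b)) b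
      have hb' : T.ζ b ≤ 3 / 4 * r := le_of_lt hb
      unfold Bubble.insertAlong
      dsimp only
      rw [hτ, T.shrink_zero h0 hδ hb', Bubble.attach, Bubble.insert, hr.squeeze_eq_e hb'])
    (fun b hb => by
      change q b = T.e (T.shrink r 0 b)
      have hb' : T.ζ b ≤ 3 / 4 * r := le_of_lt hb
      rw [hq, T.shrink_zero h0 hδ hb', hr.squeeze_eq_e hb'])
    (fun b hb => by rw [hτ, hq, Bubble.attach, Γ.insert_of_gt hb])
    (fun b hb => if_neg fun h => not_le.2 hb h.2) c
  rw [hE0, add_zero, hA01, hAR, hR01, hR1] at hadd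
  exact hadd

end BubbleClass

end Tube

end
end SemiTop


namespace SemiTop
noncomputable section

/-! ### The homotopy equivalence -/

section Final

variable {B : Type} [TopologicalSpace B] [T2Space B]
  [ChartedSpace ℂ B] [IsManifold 𝓘(ℂ) ω B] {n : ℕ} {X : Type} [TopologicalSpace X]
  [ChartedSpace (EuclideanSpace ℂ (Fin (n + 1))) X]
  [IsManifold 𝓘(ℂ, EuclideanSpace ℂ (Fin (n + 1))) ω X] {π : X → B} {J : Type}
  [Finite J] {S : J → AdmissibleJet n π} {j₀ : J}

theorem exists_adapted_tube (hπ : Continuous π) (hS : Function.Injective fun j => (S j).base)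
    {φ : FiberCoordinates n π (S j₀).base ((S j₀).sec (S j₀).base)} {ρ : Fin n → ℂ[X]}
    (hρ : (S j₀).IsGivenBy φ ρ) {O : Set B} (hO : O ∈ 𝓝 (S j₀).base) :
    ∃ T : Tube π (S j₀).base (EuclideanSpace ℂ (Fin (n + 1))), T.IsAdapted S j₀ ∧ T.z = φ.z ∧
      T.disc ⊆ O ∧ ∀ b ∈ T.disc, T.e b = (S j₀).sec b := by
  have hfin : ((fun j => (S j).base) '' {j | j ≠ j₀})ᶜ ∈ 𝓝 (S j₀).base := by
    refine (Set.toFinite _).isClosed.isOpen_compl.mem_nhds ?_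
    rintro ⟨j, hj, h⟩
    exact hj (hS h)
  obtain ⟨T, hz, hd, he, hclose⟩ := φ.exists_tube hπ (Filter.inter_mem hO hfin)
  refine ⟨T, ⟨fun s hs => ?_, fun j hj hb => (hd hb).2 ⟨j, hj, rfl⟩⟩, hz, fun b hb => (hd hb).1, he⟩
  rw [induces_iff_isClose hρ hs]
  exact hclose _ s hs

/-- In the presence of a section, attaching a sphere in a smooth fiber that carries a jet is a
homotopy equivalence between spaces of sections. -/
theorem nonempty_homotopyEquiv_of_section [CompactSpace B] [T2Space X] [CompactSpace X] [PreconnectedSpace X]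
    (hπ : ContMDiff 𝓘(ℂ, EuclideanSpace ℂ (Fin (n + 1))) 𝓘(ℂ) ω π)
    {o : H 2 (OnePoint ℂ)} {c : H 2 B} (hc : IsFundamentalClass o c)
    (hS : Function.Injective fun j => (S j).base) (hj₀ : SmoothFiber n π (S j₀).base)
    (f : C(OnePoint ℂ, X)) (hf : ∀ p, π (f p) = (S j₀).base) {γ : H 2 X}
    (σ : SectStop π c γ S) (α : H 2 X) :
    Nonempty (ContinuousMap.HomotopyEquiv (SectStop π c α S)
      (SectStop π c (α + push 2 f o) S)) := by
  obtain ⟨φ, ρ, hρ, -⟩ := σ.induces j₀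
  -- A section inducing the jet meets its support, so the paths to the section found in the smooth
  -- fiber serve as tails ending at the support.
  have hbase : σ.toMap (S j₀).base = (S j₀).sec (S j₀).base := by
    obtain ⟨T, hT, -, -, he⟩ := exists_adapted_tube hπ.continuous hS hρ Filter.univ_mem
    rw [← he _ T.base_mem_disc]
    exact hT.apply_base σ.isJetFamily ()
  have hjoin : ∀ x, π x = (S j₀).base →
      JoinedIn (π ⁻¹' {(S j₀).base}) ((S j₀).sec (S j₀).base) x := by
    intro x hx
    rw [← hbase]
    exact joinedIn_smoothFiber hπ σ.toMap.continuous σ.is_section hj₀ hx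
  have hj0 := hjoin _ (hf ((0 : ℂ) : OnePoint ℂ))
  have hj1 := (hjoin _ (hf OnePoint.infty)).symm
  obtain ⟨N, hN, G, hGc, hGπ, hG0, hG1, hGD⟩ := (S j₀).exists_discs
    (fun x hx => hasSubmersionChart hπ x (hj₀ x hx))
    (continuous_tailedDisc f hj0.somePath hj1.somePath).continuousOn
    (fun w _ => forall_tailed f _ _ (P := fun x => π x = (S j₀).base)
      (fun t => hj0.somePath_mem t) hf (fun t => hj1.somePath_mem t) _ _)
    (tailedDisc_zero f _ _) fun w hw => tailedDisc_of_norm_eq_one f _ _ hw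
  obtain ⟨T, hT, hz, hd, he⟩ := exists_adapted_tube hπ.continuous hS hρ hN
  obtain ⟨m, hm⟩ := T.exists_gauge
  let Γ : T.Bubble :=
    { G := G
      continuousOn_G := hGc.mono (Set.prod_mono hd subset_rfl)
      proj_G := fun b hb w hw => hGπ b (hd hb) w hw
      G_zero := fun b hb => by rw [hG0 b (hd hb), he b hb]
      G_one := fun b hb w hw => by rw [hG1 b (hd hb) w hw, he b hb] }
  have heb := he _ T.base_mem_disc
  refine hT.nonempty_homotopyEquiv Γ hm (fun γ σ τ hτ => ?_) α
  -- Squeezing is a homotopy starting from σ, so the squeezed section still has its class.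
  have hsq := hT.isJetOperator_squeeze hm
  have hadm := hT.isAdmissible_rad hm σ.isJetFamily ()
  have h1 : hsq.map σ 1 = σ.toMap := DFunLike.coe_injective (hadm.squeeze_one σ.is_section)
  have h2 := Γ.push_attach (f := f) (γ₀ := hj0.somePath.cast heb rfl)
    (γ₁ := hj1.somePath.cast rfl heb) (hz ▸ φ.z_mem) (fun w hw => hGD w hw) hc hadm hτ
    (q := hsq.map σ 0) rfl
  rw [h2, hsq.push_map_eq σ 0 1, h1, σ.class_eq]

end Final

end
end SemiTop

theorem mainTheorem3
    -- the base: a compact connected Riemann surface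
    {B : Type} [TopologicalSpace B] [T2Space B] [CompactSpace B] [ConnectedSpace B]
    [ChartedSpace ℂ B] [IsManifold 𝓘(ℂ) ω B]
    -- the total space: a compact connected complex manifold of dimension `n + 1`
    {n : ℕ} {X : Type} [TopologicalSpace X] [T2Space X] [CompactSpace X] [ConnectedSpace X]
    [ChartedSpace (EuclideanSpace ℂ (Fin (n + 1))) X]
    [IsManifold 𝓘(ℂ, EuclideanSpace ℂ (Fin (n + 1))) ω X]
    -- the fibration
    (π : X → B) (hπ : ContMDiff 𝓘(ℂ, EuclideanSpace ℂ (Fin (n + 1))) 𝓘(ℂ) ω π)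
    (hπ_surj : Function.Surjective π)
    -- the fundamental classes `o` of the Riemann sphere and `c` of `B`
    (o : SemiTop.H 2 (OnePoint ℂ)) (ho : SemiTop.IsOrientation o)
    (c : SemiTop.H 2 B) (hc : SemiTop.IsFundamentalClass o c)
    -- finitely many jets in distinct fibers, one of them in a smooth fiber
    {J : Type} [Finite J] (S : J → SemiTop.AdmissibleJet n π)
    (hS : Function.Injective fun j => (S j).base)
    (j₀ : J) (hj₀ : SemiTop.SmoothFiber n π (S j₀).base)
    -- a rational curve in that fiber, of class `β = f_* o`
    (f : C(OnePoint ℂ, X)) (hf : SemiTop.IsRationalCurve n f)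
    (hf_fiber : ∀ p, π (f p) = (S j₀).base)
    (α β : SemiTop.H 2 X) (hβ : β = SemiTop.push 2 f o) :
    Nonempty (ContinuousMap.HomotopyEquiv
      (SemiTop.SectStop π c α S) (SemiTop.SectStop π c (α + β) S)) ∧
    ∀ m i : ℕ, Nonempty
      (SemiTop.H i (SemiTop.SectStop π c (α + m • β) S) ≃+
        SemiTop.H i (SemiTop.SectStop π c (α + (m + 1) • β) S)) := by
  have key : ∀ α, Nonempty (ContinuousMap.HomotopyEquiv
      (SemiTop.SectStop π c α S) (SemiTop.SectStop π c (α + β) S)) := by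
    intro α
    subst hβ
    -- A section in either class suffices, since `nonempty_homotopyEquiv_of_section` leaves the
    -- class of its section free.
    rcases isEmpty_or_nonempty (SemiTop.SectStop π c α S) with h₁ | ⟨⟨σ⟩⟩
    · rcases isEmpty_or_nonempty (SemiTop.SectStop π c (α + SemiTop.push 2 f o) S) with h₂ | ⟨⟨σ⟩⟩
      · exact ⟨Homeomorph.empty.toHomotopyEquiv⟩
      · exact SemiTop.nonempty_homotopyEquiv_of_section hπ hc hS hj₀ f hf_fiber σ α
    · exact SemiTop.nonempty_homotopyEquiv_of_section hπ hc hS hj₀ f hf_fiber σ α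
  refine ⟨key α, fun m i => ?_⟩
  obtain ⟨e⟩ := key (α + m • β)
  rw [add_assoc, ← succ_nsmul] at e
  exact ⟨SemiTop.homologyEquiv e⟩
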